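/- Let $P=(V_P,E_P)$ be a simple (loop-free) weakly connected directed pattern graph with $k$ vertices, $k$ being a constant; $P$ may be cyclic. Let $G=(V,E)$ be a simple directed data graph with $|E|\ge 1$ in which every vertex has out-degree at most $\lambda$. An occurrence of $P$ in $G$ is a (not necessarily induced) subgraph $(V_{sub},E_{sub})$ of $G$, with $V_{sub}\subseteq V$ and $E_{sub}\subseteq E$, that is isomorphic to $P$; let $\mathrm{OUT}$ be the number of occurrences. Let $$\mathit{polymat}_{dir}(m,\lambda,P)=\max_h 2^{h(V_P)},$$ where $h$ ranges over the functions $h:2^{V_P}\to\mathbb{R}_{\ge 0}$ that satisfy $h(\emptyset)=0$, are monotone ($h(\mathcal X)\le h(\mathcal Y)$ for $\mathcal X\subseteq\mathcal Y$) and submodular ($h(\mathcal X\cup\mathcal Y)+h(\mathcal X\cap\mathcal Y)\le h(\mathcal X)+h(\mathcal Y)$), and fulfil $h(\{X,Y\})\le\log_2 m$ and $h(\{X,Y\})-h(\{X\})\le\log_2\lambda$ for every edge $(X,Y)\in E_P$ (the value is $\infty$ if $h(V_P)$ is unbounded, which happens only for $k=1$). Then one can build, in $O(|E|)$ expected time,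 a data structure on $G$ that supports repeated, mutually independent subgraph sampling operations. Each operation returns an occurrence of $P$ in $G$ uniformly at random if $\mathrm{OUT}\ge1$, declares the absence of any occurrence if $\mathrm{OUT}=0$, and takes $$O\!\left(\frac{\mathit{polymat}_{dir}(|E|,\lambda,P)}{\max\{1,\mathrm{OUT}\}}\right)$$ expected time. Here the model is a randomized word RAM with zero-initialized memory and words of at least $c\log_2|V|$ bits, with unit-cost arithmetic, comparisons, memory accesses and draws of uniformly random integers from $\{0,\dots,r-1\}$. The vertices of $G$ are $0,\dots,|V|-1$, and the input is $|V|$, $|E|$ and an edge list of $G$ in arbitrary order. The constants hidden in $O(\cdot)$ and the constant $c$ depend only on $k$; the preprocessing and sampling programs depend only on $P$. The guarantees of each operation hold conditionally on the preprocessing and on all earlier operations. -/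

import Mathlib

open scoped ENNReal NNReal

namespace DirectedSampling

/-! ### Directed graphs, subgraphs and occurrences -/

/-- A directed graph without self-loops. Antiparallel pairs of edges are allowed. -/
def SimpleDi {V : Type*} (G : Digraph V) : Prop := ∀ v, ¬ G.Adj v v

/-- Ignoring the edge directions yields a connected (in particular nonempty) undirected graph. -/
def WeaklyConnected {V : Type*} (G : Digraph V) : Prop :=
  G.toSimpleGraphInclusive.Connected

/-- A subgraph `(V_sub, E_sub)` of `G`, not necessarily induced. -/
@[ext]
structure SubDigraph {V : Type*} (G : Digraph V) where
  verts : Set V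
  edges : Set (V × V)
  adj_of_mem : ∀ e ∈ edges, G.Adj e.1 e.2
  fst_mem : ∀ e ∈ edges, e.1 ∈ verts
  snd_mem : ∀ e ∈ edges, e.2 ∈ verts

/-- The subgraph `S` is isomorphic to the pattern `P`. -/
def IsOccurrence {V W : Type*} {G : Digraph V} (P : Digraph W) (S : SubDigraph G) : Prop :=
  ∃ f : S.verts ≃ W, ∀ u v : S.verts, u ≠ v →
    (((u : V), (v : V)) ∈ S.edges ↔ P.Adj (f u) (f v))

/-- The set of occurrences of `P` in `G`. -/
def occ {V W : Type*} (G : Digraph V) (P : Digraph W) : Set (SubDigraph G) :=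
  {S | IsOccurrence P S}

/-! ### Polymatroid bounds -/

/-- A rule `(X, Y, N)` over `S`; it restricts a set function `h` by `h Y - h X ≤ log₂ N`. -/
structure Rule (S : Type*) where
  X : Finset S
  Y : Finset S
  N : ℕ

/-- The set functions over `S` that are zero-grounded, monotone and submodular. -/
def polymatroids (S : Type*) [DecidableEq S] : Set (Finset S → ℝ≥0) :=
  {h | h ∅ = 0 ∧ (∀ X Y : Finset S, X ⊆ Y → h X ≤ h Y) ∧
    ∀ X Y : Finset S, h (X ∪ Y) + h (X ∩ Y) ≤ h X + h Y}

/-- The set functions over `S` that obey all the rules in `C`. -/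
def obeying {S : Type*} (C : Set (Rule S)) : Set (Finset S → ℝ≥0) :=
  {h | ∀ r ∈ C, (h r.Y : ℝ) - (h r.X : ℝ) ≤ Real.logb 2 r.N}

/-- The polymatroid bound of `C`: the maximum of `2 ^ h(S)` over all polymatroids `h` obeying `C`.
It is `⊤` when `h(S)` is unbounded, which is the case when some element of `S` is in no rule. -/
noncomputable def polymat {S : Type*} [Fintype S] [DecidableEq S] (C : Set (Rule S)) : ℝ≥0∞ :=
  ⨆ h ∈ polymatroids S ∩ obeying C, ENNReal.ofReal ((2 : ℝ) ^ (h Finset.univ : ℝ))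

/-- For each edge `(X, Y)` of the pattern, the two rules `(∅, {X, Y}, m)` and
`({X}, {X, Y}, lam)`. -/
def dirRules {S : Type*} [DecidableEq S] (m lam : ℕ) (P : Digraph S) : Set (Rule S) :=
  {r | ∃ X Y : S, P.Adj X Y ∧ (r = ⟨∅, {X, Y}, m⟩ ∨ r = ⟨{X}, {X, Y}, lam⟩)}

/-- The directed polymatroid bound of `m`, `lam` and `P`. -/
noncomputable def polymatDir {S : Type*} [Fintype S] [DecidableEq S]
    (m lam : ℕ) (P : Digraph S) : ℝ≥0∞ :=
  polymat (dirRules m lam P)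

/-! ### Randomized word RAM

Words have `w` bits and are represented by the natural numbers below `2 ^ w`. A program has access
to registers and to a memory addressed by words. Every elementary step takes one unit of time. -/

/-- Contents of the registers and of the memory. -/
structure State where
  reg : ℕ → ℕ
  mem : ℕ → ℕ

/-- Binary arithmetic operations. -/
inductive Op
  | add | sub | mul | div | mod

/-- Word arithmetic modulo `2 ^ w`; division and remainder are those of `ℕ`. -/
def Op.eval (w : ℕ) : Op → ℕ → ℕ → ℕ
  | .add, x, y => (x + y) % 2 ^ w
  | .sub, x, y => (x + (2 ^ w - y)) % 2 ^ w
  | .mul, x, y => (x * y) % 2 ^ w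
  | .div, x, y => x / y
  | .mod, x, y => x % y

/-- Instructions. The letters `d`, `x`, `y` are (fixed) register numbers.
* `const d a`: register `d` becomes the constant `a` (modulo `2 ^ w`)
* `arith o d x y`: register `d` becomes (register `x`) `o` (register `y`)
* `load d x`: register `d` becomes the content of the memory cell whose address is in register `x`
* `store x y`: register `y` is written to the memory cell whose address is in register `x`
* `rand d x`: register `d` becomes a fresh uniformly random element of `{0, …, r - 1}`, where `r` is
  the content of register `x` (and `0` if `r = 0`). -/
inductive Instr
  | const (d a : ℕ)
  | arith (o : Op) (d x y : ℕ)
  | load (d x : ℕ)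
  | store (x y : ℕ)
  | rand (d x : ℕ)

def State.setReg (s : State) (d v : ℕ) : State :=
  { s with reg := Function.update s.reg d v }

def State.setMem (s : State) (a v : ℕ) : State :=
  { s with mem := Function.update s.mem a v }

/-- A uniformly random element of `{0, …, r - 1}`. -/
noncomputable def uniformBelow (r : ℕ) : PMF ℕ :=
  if hr : r = 0 then PMF.pure 0
  else PMF.uniformOfFinset (Finset.range r) (Finset.nonempty_range_iff.mpr hr)

/-- Execution of one instruction. -/
noncomputable def Instr.exec (w : ℕ) : Instr → State → PMF State
  | .const d a, s => PMF.pure (s.setReg d (a % 2 ^ w))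
  | .arith o d x y, s => PMF.pure (s.setReg d (o.eval w (s.reg x) (s.reg y)))
  | .load d x, s => PMF.pure (s.setReg d (s.mem (s.reg x)))
  | .store x y, s => PMF.pure (s.setMem (s.reg x) (s.reg y))
  | .rand d x, s => (uniformBelow (s.reg x)).map (s.setReg d)

/-- Comparisons of two registers. -/
inductive Test
  | lt (x y : ℕ)
  | le (x y : ℕ)
  | eq (x y : ℕ)
  | ne (x y : ℕ)

def Test.holds : Test → State → Bool
  | .lt x y, s => decide (s.reg x < s.reg y)
  | .le x y, s => decide (s.reg x ≤ s.reg y)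
  | .eq x y, s => decide (s.reg x = s.reg y)
  | .ne x y, s => decide (s.reg x ≠ s.reg y)

/-- Programs: finite texts, built from instructions by sequencing, branching and while-loops. -/
inductive Prog
  | skip
  | instr (i : Instr)
  | seq (p q : Prog)
  | ite (t : Test) (p q : Prog)
  | loop (t : Test) (p : Prog)

/-- One step of the execution of a program; `skip` is the halted program. -/
noncomputable def step (w : ℕ) : Prog → State → PMF (Prog × State)
  | .skip, s => PMF.pure (.skip, s)
  | .instr i, s => (i.exec w s).map fun s' => (.skip, s')
  | .seq .skip q, s => PMF.pure (q, s)
  | .seq p q, s => (step w p s).map fun c => (.seq c.1 q, c.2)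
  | .ite t p q, s => PMF.pure (if t.holds s then p else q, s)
  | .loop t p, s => PMF.pure (if t.holds s then .seq p (.loop t p) else .skip, s)

/-- The distribution of the configuration after `n` steps. -/
noncomputable def run (w : ℕ) : ℕ → Prog × State → PMF (Prog × State)
  | 0, c => PMF.pure c
  | n + 1, c => (step w c.1 c.2).bind (run w n)

/-- The expected running time of `p` from `s`: the sum over `n` of the probability that the
execution has not halted after `n` steps. -/
noncomputable def expectedTime (w : ℕ) (p : Prog) (s : State) : ℝ≥0∞ :=
  ∑' n : ℕ, (run w n (p, s)).toOuterMeasure {c | c.1 ≠ .skip}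

/-- The probability that `p`, started in `s`, halts in a state that belongs to `A`. -/
noncomputable def haltProb (w : ℕ) (p : Prog) (s : State) (A : Set State) : ℝ≥0∞ :=
  ⨆ n : ℕ, (run w n (p, s)).toOuterMeasure {c | c.1 = .skip ∧ c.2 ∈ A}

/-- The states in which a data structure can be (with positive probability) after the
preprocessing, started in `s₀`, and any number of successive sampling operations. -/
inductive Reachable (w : ℕ) (pre samp : Prog) (s₀ : State) : State → Prop
  | built {s : State} (hs : 0 < haltProb w pre s₀ {s}) : Reachable w pre samp s₀ s
  | next {s t : State} (hs : Reachable w pre samp s₀ s) (ht : 0 < haltProb w samp s {t}) :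
      Reachable w pre samp s₀ t

/-! ### Input and output of the programs -/

/-- The initial state for a data graph with vertices `0, …, n - 1` and the given edge list: the
memory holds `n`, the number of edges, and then the two endpoints of each edge. All the other
cells and all the registers are `0`. -/
def inputState {n : ℕ} (E : List (Fin n × Fin n)) : State where
  reg := fun _ => 0
  mem := fun a =>
    (n :: E.length :: E.flatMap fun e => [(e.1 : ℕ), (e.2 : ℕ)]).getD a 0

/-- The absence of any occurrence is declared by a `0` in register `0`. -/
def DeclaresAbsence (s : State) : Prop := s.reg 0 = 0

/-- The subgraph `S` is returned by a `1` in register `0` together with, in registers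
`1, …, k`, the images of the vertices of the pattern `P` under a map that takes the vertex set and
the edge set of `P` onto those of `S`. -/
def Returns {n k : ℕ} {G : Digraph (Fin n)} (P : Digraph (Fin k)) (S : SubDigraph G)
    (s : State) : Prop :=
  s.reg 0 = 1 ∧
  S.verts = {v : Fin n | ∃ i : Fin k, s.reg (i + 1) = (v : ℕ)} ∧
  S.edges = {e : Fin n × Fin n | ∃ i j : Fin k, P.Adj i j ∧ s.reg (i + 1) = (e.1 : ℕ) ∧
    s.reg (j + 1) = (e.2 : ℕ)}

end DirectedSampling

open DirectedSampling

/-! # Uniform sampling of directed subgraphs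

A sampling operation draws a random *code* and decodes it. A code is a number that, read in a mixed
radix system, prescribes an embedding of the pattern `P` step by step: an `edge` step takes its
digit as the number of an edge of `G` (`m` values), a `lam` step takes it as the rank of an
out-neighbour of a vertex that is already known (`lam` values). Decoding takes constant time, and an
adjacency matrix serves to check the result. If every embedding has exactly one code
(`existsUnique_isCode`), then rejection sampling yields a uniformly random embedding, hence a
uniformly random occurrence, since every occurrence comes from the same number of embeddings, that
of the automorphisms of `P` (`card_isEmb`). If there are `M` codes and `e ≥ OUT` embeddings, this
takes `O(M / e)` time on average. To detect that there is no embedding, every failed trial also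
advances a scan of all the codes, which stops at the first valid one (`tryCode`); so `O(M)` time
suffices in this case (`sampLoop_time`, `sampLoop_time_absent`, `sampLoop_found_prob`).

The memory is zero-initialized, so the adjacency matrix and the lists of out-neighbours can be built
in linear time in tables of quadratic size (`preProg_spec`).

It remains to find a set of codes whose size is within a constant factor of the polymatroid bound.
The bound is estimated from below by explicit polymatroids, namely modular functions plus a multiple
of the number of members of a family of sets that are met (`le_polymatDir`). Let `a = log₂ m` and
`l = log₂ lam`. There are two regimes, and the sampling program selects one by comparing `lam ^ 2` to
`m`.

* If `2 * l ≤ a` (`exists_fam_sparse`), the code starts with an edge out of every source; these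
  edges extend a maximum matching from the sources to the other vertices. Then it proceeds greedily
  by `lam` steps. It gets stuck only if the unknown vertices are closed under predecessors, and then
  an `edge` step inside a minimal such set `U` determines two of them (`exists_greedy`). The sets
  `U` that occur are disjoint. In the dual polymatroid a source has weight `a` and any other vertex
  weight `l`, reduced by `l` on a minimum vertex cover of the edges out of sources, and every `U`
  adds `a - 2 * l`. The theorem of König makes the two values equal.
* If `l ≤ a ≤ 2 * l` (`exists_fam_dense`), most vertices are covered by disjoint edges and odd
  cycles, at a cost of `a / 2` per vertex. For an odd cycle this needs a case distinction, on
  whether the image of one of its vertices `t` is *heavy*, that is, has out-degree above `q ≈ √m`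
  (`part_odd`). There are at most `q` heavy vertices; if `t` is mapped to one of them, it is listed
  and the rest of the cycle has a perfect matching. Otherwise the successor of `t` is one of at most
  `q` out-neighbours, and the rest without this successor has a perfect matching. So the codes come
  in a family of *branches* with `m ^ α * lam ^ β * q ^ γ` codes each, and exactly one branch
  applies to a given embedding (`FamOK`). The covering is made of the orbits of a permutation that
  moves every vertex to an adjacent one, in the pattern enlarged by as many dummy vertices as the
  largest deficiency `#X - #N(X)`; it exists by the theorem of Hall (`exists_injective_dAdj`,
  `covers_of_invariant`). The few vertices paired with dummies are added at a cost of `a` for a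
  source and `l` for any other vertex (`exists_completion`). The dual weights interpolate between
  `a / 2` and those above according to the membership in `X` and `N(X)`.

Programs are analysed by a weakest precondition calculus: `wp w τ p φ s` is the expected value of
`τ` times the number of steps plus `φ` of the final state, so that `τ = 1`, `φ = 0` gives the
expected running time, and `τ = 0` with an indicator function `φ` gives the halting probability.
-/

namespace DirectedSampling

/-! ### Expected values of executions -/

/-- The expectation of `f` under `μ`. -/
noncomputable def avg {α : Type*} (μ : PMF α) (f : α → ℝ≥0∞) : ℝ≥0∞ := ∑' a, μ a * f a

theorem avg_pure {α : Type*} (a : α) (f : α → ℝ≥0∞) : avg (PMF.pure a) f = f a := by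
  unfold avg
  rw [tsum_eq_single a]
  · simp
  · intro b hb; simp [PMF.pure_apply, hb]

theorem avg_bind {α β : Type*} (μ : PMF α) (q : α → PMF β) (f : β → ℝ≥0∞) :
    avg (μ.bind q) f = avg μ fun a => avg (q a) f := by
  unfold avg
  simp only [PMF.bind_apply, ← ENNReal.tsum_mul_right, ← ENNReal.tsum_mul_left]
  rw [ENNReal.tsum_comm]
  simp only [mul_assoc]

theorem avg_map {α β : Type*} (μ : PMF α) (g : α → β) (f : β → ℝ≥0∞) :
    avg (μ.map g) f = avg μ fun a => f (g a) := by
  rw [PMF.map, avg_bind]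
  simp [avg_pure]

theorem avg_mono {α : Type*} (μ : PMF α) {f g : α → ℝ≥0∞} (h : ∀ a, f a ≤ g a) :
    avg μ f ≤ avg μ g :=
  ENNReal.tsum_le_tsum fun a => mul_le_mul_right (h a) _

theorem avg_const {α : Type*} (μ : PMF α) (x : ℝ≥0∞) : avg μ (fun _ => x) = x := by
  simp [avg, ENNReal.tsum_mul_right, PMF.tsum_coe]

theorem avg_iSup {α : Type*} (μ : PMF α) (f : ℕ → α → ℝ≥0∞) (hf : Monotone f) :
    avg μ (fun a => ⨆ n, f n a) = ⨆ n, avg μ (f n) := by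
  let _ : MeasurableSpace α := ⊤
  simp only [avg, ENNReal.mul_iSup]
  rw [← MeasureTheory.lintegral_count, MeasureTheory.lintegral_iSup]
  · simp [MeasureTheory.lintegral_count]
  · exact fun n => measurable_from_top
  · exact fun m n h a => mul_le_mul_right (hf h a) _

theorem toOuterMeasure_eq_avg {α : Type*} (μ : PMF α) (A : Set α) :
    μ.toOuterMeasure A = avg μ (A.indicator 1) := by
  rw [PMF.toOuterMeasure_apply]
  refine tsum_congr fun a => ?_
  by_cases h : a ∈ A <;> simp [h]

/-- The instruction-by-instruction expected value, truncated after `N` steps, of `τ` for each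
executed step plus `φ` of the final state. -/
noncomputable def valN (w : ℕ) (τ : ℝ≥0∞) (φ : State → ℝ≥0∞) : ℕ → Prog × State → ℝ≥0∞
  | 0, c => open Classical in if c.1 = .skip then φ c.2 else 0
  | N + 1, c => open Classical in
      if c.1 = .skip then φ c.2 else τ + avg (step w c.1 c.2) (valN w τ φ N)

/-- The expected value, over the executions of `p` from `s`, of `τ` times the number of steps plus
`φ` of the final state (only `τ` times the number of steps if the execution does not halt). -/
noncomputable def wp (w : ℕ) (τ : ℝ≥0∞) (p : Prog) (φ : State → ℝ≥0∞) (s : State) : ℝ≥0∞ :=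
  ⨆ N, valN w τ φ N (p, s)

section wp
variable {w : ℕ} {τ : ℝ≥0∞} {φ ψ : State → ℝ≥0∞} {p q : Prog} {s : State} {t : Test}

theorem valN_skip (N : ℕ) : valN w τ φ N (.skip, s) = φ s := by
  cases N <;> simp [valN]

theorem valN_zero (h : p ≠ .skip) : valN w τ φ 0 (p, s) = 0 := by
  simp [valN, h]

theorem valN_succ (h : p ≠ .skip) (N : ℕ) :
    valN w τ φ (N + 1) (p, s) = τ + avg (step w p s) (valN w τ φ N) := by
  simp [valN, h]

theorem valN_le_succ (N : ℕ) (c : Prog × State) :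
    valN w τ φ N c ≤ valN w τ φ (N + 1) c := by
  induction N generalizing c with
  | zero =>
    obtain ⟨p, s⟩ := c
    by_cases h : p = .skip
    · subst h; simp [valN_skip]
    · simp [valN_zero h]
  | succ N ih =>
    obtain ⟨p, s⟩ := c
    by_cases h : p = .skip
    · subst h; simp [valN_skip]
    · rw [valN_succ h, valN_succ h]
      gcongr
      exact avg_mono _ ih

theorem valN_monotone : Monotone (valN w τ φ) :=
  monotone_nat_of_le_succ fun N c => valN_le_succ N c

theorem wp_skip : wp w τ .skip φ s = φ s := by
  simp [wp, valN_skip]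

/-- Unfolding of one step of the execution. -/
theorem wp_step (h : p ≠ .skip) :
    wp w τ p φ s = τ + avg (step w p s) fun c => wp w τ c.1 φ c.2 := by
  have h1 : wp w τ p φ s = ⨆ N, valN w τ φ (N + 1) (p, s) :=
    ((valN_monotone.comp fun _ _ h => h).apply₂ (p, s)).iSup_nat_add 1 |>.symm
  rw [h1]
  simp only [valN_succ h, wp]
  rw [avg_iSup _ _ valN_monotone, ENNReal.add_iSup]

theorem wp_instr (i : Instr) : wp w τ (.instr i) φ s = τ + avg (i.exec w s) φ := by
  rw [wp_step (by simp), step, avg_map]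
  simp [wp_skip]

theorem wp_ite :
    wp w τ (.ite t p q) φ s = τ + if t.holds s then wp w τ p φ s else wp w τ q φ s := by
  rw [wp_step (by simp), step, avg_pure]
  split <;> rfl

theorem wp_loop' : wp w τ (.loop t p) φ s =
    τ + if t.holds s then wp w τ (.seq p (.loop t p)) φ s else φ s := by
  rw [wp_step (by simp), step, avg_pure]
  split <;> simp [wp_skip]

theorem step_seq (h : p ≠ .skip) :
    step w (.seq p q) s = (step w p s).map fun c => (.seq c.1 q, c.2) := by
  cases p <;> simp_all [step]

theorem wp_seq :
    wp w τ (.seq p q) φ s = wp w τ p (fun s' => τ + wp w τ q φ s') s := by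
  apply le_antisymm
  · refine iSup_le fun N => ?_
    induction N generalizing p s with
    | zero => simp [valN]
    | succ N ih =>
      rw [valN_succ (by simp)]
      by_cases h : p = .skip
      · subst h
        rw [step, avg_pure, wp_skip]
        gcongr
        exact le_iSup (fun N => valN w τ φ N (q, s)) N
      · rw [step_seq h, avg_map, wp_step h]
        gcongr
        exact avg_mono _ fun c => ih
  · refine iSup_le fun N => ?_
    induction N generalizing p s with
    | zero =>
      by_cases h : p = .skip
      · subst h
        rw [valN_skip, wp_step (p := .seq .skip q) (by simp), step, avg_pure]
      · simp [valN_zero h]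
    | succ N ih =>
      by_cases h : p = .skip
      · subst h
        rw [valN_skip, wp_step (p := .seq .skip q) (by simp), step, avg_pure]
      · rw [valN_succ h, wp_step (by simp), step_seq h, avg_map]
        gcongr
        exact avg_mono _ fun c => ih

theorem wp_loop : wp w τ (.loop t p) φ s =
    τ + if t.holds s then wp w τ p (fun s' => τ + wp w τ (.loop t p) φ s') s else φ s := by
  rw [wp_loop', wp_seq]

/-- A function that does not increase (in expectation) over an iteration bounds the value of the
loop. -/
theorem wp_loop_le (I : State → ℝ≥0∞)
    (h : ∀ s, τ + (if t.holds s then wp w τ p (fun s' => τ + I s') s else φ s) ≤ I s) (s : State) :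
    wp w τ (.loop t p) φ s ≤ I s := by
  have key : ∀ N, (∀ s, valN w τ φ N (.loop t p, s) ≤ I s) ∧
      ∀ p' s, valN w τ φ N (.seq p' (.loop t p), s) ≤ wp w τ p' (fun s' => τ + I s') s := by
    intro N
    induction N with
    | zero => exact ⟨by simp [valN], by simp [valN]⟩
    | succ N ih =>
      refine ⟨fun s => le_trans ?_ (h s), fun p' s => ?_⟩
      · rw [valN_succ (by simp), step, avg_pure]
        gcongr
        split
        · exact ih.2 p s
        · simp [valN_skip]
      · rw [valN_succ (by simp)]
        by_cases hp : p' = .skip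
        · subst hp
          rw [step, avg_pure, wp_skip]
          gcongr
          exact ih.1 s
        · rw [step_seq hp, avg_map, wp_step hp]
          gcongr
          exact avg_mono _ fun c => ih.2 _ _
  exact iSup_le fun N => (key N).1 s

/-- The `N`-th partial sum of the expected running time is the value truncated after `N` steps. -/
theorem expectedTime_eq_wp : expectedTime w p s = wp w 1 p (fun _ => 0) s := by
  rw [expectedTime, ENNReal.tsum_eq_iSup_nat, wp]
  congr 1
  ext N
  generalize hc : (p, s) = c
  clear hc
  have hrun : ∀ n s, (run w n (.skip, s)) = PMF.pure (.skip, s) := by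
    intro n s
    induction n with
    | zero => rfl
    | succ n ih => rw [run, step, PMF.pure_bind, ih]
  induction N generalizing c with
  | zero => simp [valN]
  | succ N ih =>
    obtain ⟨p, s⟩ := c
    by_cases h : p = .skip
    · subst h
      rw [valN_skip]
      simp [hrun, toOuterMeasure_eq_avg, avg_pure]
    · rw [valN_succ h, Finset.sum_range_succ']
      have h0 : (run w 0 (p, s)).toOuterMeasure {c | c.1 ≠ .skip} = 1 := by
        simp [run, toOuterMeasure_eq_avg, avg_pure, h]
      rw [h0, add_comm]
      congr 1
      simp only [toOuterMeasure_eq_avg] at ih ⊢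
      rw [funext fun c => (ih c).symm]
      simp only [run, avg_bind]
      simp only [avg, Finset.mul_sum]
      rw [Summable.tsum_finsetSum fun _ _ => ENNReal.summable]

theorem haltProb_eq_wp (A : Set State) :
    haltProb w p s A = wp w 0 p (A.indicator 1) s := by
  rw [haltProb, wp]
  congr 1
  ext N
  generalize hc : (p, s) = c
  clear hc
  induction N generalizing c with
  | zero =>
    rw [run, toOuterMeasure_eq_avg, avg_pure, valN]
    by_cases h : c.1 = .skip <;> by_cases hA : c.2 ∈ A <;> simp [h, hA, Set.indicator]
  | succ N ih =>
    obtain ⟨p, s⟩ := c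
    by_cases h : p = .skip
    · subst h
      rw [run, step, PMF.pure_bind, ih, valN_skip, valN_skip]
    · simp only [toOuterMeasure_eq_avg] at ih ⊢
      rw [valN_succ h, run, avg_bind, zero_add]
      simp only [ih]

end wp

/-! ### Deterministic executions -/

/-- From `s`, the program `p` deterministically halts in `s'`, within `T` steps. -/
def Runs (w : ℕ) (p : Prog) (s : State) (T : ℕ) (s' : State) : Prop :=
  ∃ t : ℕ, t ≤ T ∧ ∀ τ φ, wp w τ p φ s = t * τ + φ s'

/-- From `s`, the program `p` deterministically halts, within `T` steps, in a state satisfying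
`Q`. -/
def Ex (w : ℕ) (p : Prog) (s : State) (T : ℕ) (Q : State → Prop) : Prop :=
  ∃ s', Runs w p s T s' ∧ Q s'

section Ex
variable {w : ℕ} {p q : Prog} {s : State} {t : Test} {T T₁ T₂ : ℕ} {Q R : State → Prop}

theorem Ex.mono (h : Ex w p s T₁ R) (hT : T₁ ≤ T) (hQ : ∀ s', R s' → Q s') : Ex w p s T Q := by
  obtain ⟨s', ⟨t, ht, h⟩, hR⟩ := h
  exact ⟨s', ⟨t, ht.trans hT, h⟩, hQ _ hR⟩

theorem Ex.skip (h : Q s) : Ex w .skip s T Q :=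
  ⟨s, ⟨0, Nat.zero_le _, fun τ φ => by simp [wp_skip]⟩, h⟩

theorem Ex.seq (h : Ex w p s T₁ fun s' => Ex w q s' T₂ Q) (hT : T₁ + T₂ + 1 ≤ T) :
    Ex w (.seq p q) s T Q := by
  obtain ⟨s₁, ⟨t₁, ht₁, h₁⟩, s₂, ⟨t₂, ht₂, h₂⟩, hQ⟩ := h
  refine ⟨s₂, ⟨t₁ + 1 + t₂, by omega, fun τ φ => ?_⟩, hQ⟩
  rw [wp_seq, h₁, h₂]
  push_cast
  ring

theorem Ex.of_pure {i : Instr} {s' : State} (h : i.exec w s = PMF.pure s') (hQ : Q s')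
    (hT : 1 ≤ T) :
    Ex w (.instr i) s T Q :=
  ⟨s', ⟨1, hT, fun τ φ => by rw [wp_instr, h, avg_pure]; simp⟩, hQ⟩

theorem Ex.const {d a : ℕ} (h : Q (s.setReg d (a % 2 ^ w))) (hT : 1 ≤ T := by omega) :
    Ex w (.instr (.const d a)) s T Q := .of_pure rfl h hT

theorem Ex.arith {o : Op} {d x y : ℕ} (h : Q (s.setReg d (o.eval w (s.reg x) (s.reg y))))
    (hT : 1 ≤ T := by omega) :
    Ex w (.instr (.arith o d x y)) s T Q := .of_pure rfl h hT

theorem Ex.load {d x : ℕ} (h : Q (s.setReg d (s.mem (s.reg x)))) (hT : 1 ≤ T := by omega) :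
    Ex w (.instr (.load d x)) s T Q := .of_pure rfl h hT

theorem Ex.store {x y : ℕ} (h : Q (s.setMem (s.reg x) (s.reg y))) (hT : 1 ≤ T := by omega) :
    Ex w (.instr (.store x y)) s T Q := .of_pure rfl h hT

theorem Ex.ite (hp : t.holds s = true → Ex w p s T₁ Q) (hq : t.holds s = false → Ex w q s T₁ Q)
    (hT : T₁ + 1 ≤ T) : Ex w (.ite t p q) s T Q := by
  cases ht : t.holds s
  · obtain ⟨s', ⟨n, hn, h⟩, hQ⟩ := hq ht
    refine ⟨s', ⟨n + 1, by omega, fun τ φ => ?_⟩, hQ⟩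
    rw [wp_ite, ht, if_neg (by simp), h]
    push_cast; ring
  · obtain ⟨s', ⟨n, hn, h⟩, hQ⟩ := hp ht
    refine ⟨s', ⟨n + 1, by omega, fun τ φ => ?_⟩, hQ⟩
    rw [wp_ite, ht, if_pos rfl, h]
    push_cast; ring

theorem Ex.loop_exit (ht : t.holds s = false) (hQ : Q s) (hT : 1 ≤ T) :
    Ex w (.loop t p) s T Q :=
  ⟨s, ⟨1, hT, fun τ φ => by rw [wp_loop, ht, if_neg (by simp)]; simp⟩, hQ⟩

theorem Ex.loop_iter (ht : t.holds s = true)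
    (h : Ex w p s T₁ fun s' => Ex w (.loop t p) s' T₂ Q) (hT : T₁ + T₂ + 2 ≤ T) :
    Ex w (.loop t p) s T Q := by
  obtain ⟨s₁, ⟨t₁, ht₁, h₁⟩, s₂, ⟨t₂, ht₂, h₂⟩, hQ⟩ := h
  refine ⟨s₂, ⟨t₁ + t₂ + 2, by omega, fun τ φ => ?_⟩, hQ⟩
  rw [wp_loop, ht, if_pos rfl, h₁, h₂]
  push_cast
  ring

/-- A bounded number of iterations that each preserve an invariant. -/
theorem Ex.loop_count (I : ℕ → State → Prop) (N T₁ : ℕ)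
    (hbody : ∀ i < N, ∀ s, I i s → t.holds s = true ∧ Ex w p s T₁ (I (i + 1)))
    (hend : ∀ s, I N s → t.holds s = false) (hs : I 0 s) :
    Ex w (.loop t p) s (N * (T₁ + 2) + 1) (I N) := by
  have : ∀ j ≤ N, ∀ s, I (N - j) s → Ex w (.loop t p) s (j * (T₁ + 2) + 1) (I N) := by
    intro j
    induction j with
    | zero => intro _ s hs; exact Ex.loop_exit (hend s hs) hs (by omega)
    | succ j ih =>
      intro hj s hs
      obtain ⟨h1, h2⟩ := hbody (N - (j + 1)) (by omega) s hs
      refine Ex.loop_iter h1 (h2.mono le_rfl fun s' hs' => ih (by omega) s' ?_) ?_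
      · rwa [show N - j = N - (j + 1) + 1 by omega]
      · ring_nf; omega
  exact this N le_rfl s (by simpa using hs)

end Ex

/-! ### Frames -/

/-- Execution of `p` leaves the memory alone and writes only to registers in `W`. -/
def Prog.WritesOnly (W : Set ℕ) : Prog → Prop
  | .skip => True
  | .instr (.const d _) => d ∈ W
  | .instr (.arith _ d _ _) => d ∈ W
  | .instr (.load d _) => d ∈ W
  | .instr (.store _ _) => False
  | .instr (.rand d _) => d ∈ W
  | .seq p q => p.WritesOnly W ∧ q.WritesOnly W
  | .ite _ p q => p.WritesOnly W ∧ q.WritesOnly W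
  | .loop _ p => p.WritesOnly W

/-- The states `s` and `s'` agree except on the registers in `W`. -/
def SameOutside (W : Set ℕ) (s s' : State) : Prop :=
  s'.mem = s.mem ∧ ∀ r ∉ W, s'.reg r = s.reg r

section frame
variable {w : ℕ} {p : Prog} {s s' : State} {W : Set ℕ}

theorem SameOutside.refl : SameOutside W s s := ⟨rfl, fun _ _ => rfl⟩

theorem SameOutside.trans {s₁ s₂ s₃ : State} (h : SameOutside W s₁ s₂) (h' : SameOutside W s₂ s₃) :
    SameOutside W s₁ s₃ :=
  ⟨h'.1.trans h.1, fun r hr => (h'.2 r hr).trans (h.2 r hr)⟩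

theorem SameOutside.setReg {d v : ℕ} (hd : d ∈ W) : SameOutside W s (s.setReg d v) :=
  ⟨rfl, fun r hr => Function.update_of_ne (fun h : r = d => hr (by rwa [h])) _ _⟩

theorem avg_eq_zero {α : Type*} {μ : PMF α} {f : α → ℝ≥0∞} (h : ∀ a, f a = 0) : avg μ f = 0 := by
  simp [avg, h]

theorem wp_eq_zero_of_writesOnly (hp : p.WritesOnly W) {φ : State → ℝ≥0∞}
    (hφ : ∀ s', SameOutside W s s' → φ s' = 0) : wp w 0 p φ s = 0 := by
  induction p generalizing s φ with
  | skip => rw [wp_skip]; exact hφ _ .refl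
  | instr i =>
    rw [wp_instr, zero_add]
    cases i with
    | const d a => rw [Instr.exec, avg_pure]; exact hφ _ (.setReg hp)
    | arith o d x y => rw [Instr.exec, avg_pure]; exact hφ _ (.setReg hp)
    | load d x => rw [Instr.exec, avg_pure]; exact hφ _ (.setReg hp)
    | store x y => exact hp.elim
    | rand d x =>
      rw [Instr.exec, avg_map]
      exact avg_eq_zero fun a => hφ _ (.setReg hp)
  | seq p q ihp ihq =>
    rw [wp_seq]
    refine ihp hp.1 fun s' hs' => ?_
    rw [zero_add]
    exact ihq hp.2 fun s'' hs'' => hφ _ (hs'.trans hs'')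
  | ite t p q ihp ihq =>
    rw [wp_ite, zero_add]
    split
    · exact ihp hp.1 hφ
    · exact ihq hp.2 hφ
  | loop t p ih =>
    classical
    have := wp_loop_le (w := w) (τ := 0) (t := t) (p := p) (φ := φ)
      (fun s' => if SameOutside W s s' then 0 else ⊤) ?_ s
    · simpa [SameOutside.refl] using this
    · intro s₁
      by_cases h : SameOutside W s s₁
      · rw [if_pos h, zero_add]
        split
        · rw [ih hp]
          intro s₂ h₂
          simp [h.trans h₂]
        · simp [hφ _ h]
      · simp [h]

theorem Ex.frame {T : ℕ} {Q : State → Prop} (h : Ex w p s T Q) (hp : p.WritesOnly W) :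
    Ex w p s T fun s' => Q s' ∧ SameOutside W s s' := by
  classical
  obtain ⟨s', ⟨t, ht, h⟩, hQ⟩ := h
  refine ⟨s', ⟨t, ht, h⟩, hQ, ?_⟩
  by_contra hc
  have h0 := wp_eq_zero_of_writesOnly (w := w) (s := s) hp
    (φ := fun s'' => if SameOutside W s s'' then 0 else 1) (by simp +contextual)
  rw [h] at h0
  simp [hc] at h0

end frame

/-! ### Straight-line code -/

/-- The effect of an instruction other than `rand`. -/
def Instr.detExec (w : ℕ) : Instr → State → State
  | .const d a, s => s.setReg d (a % 2 ^ w)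
  | .arith o d x y, s => s.setReg d (o.eval w (s.reg x) (s.reg y))
  | .load d x, s => s.setReg d (s.mem (s.reg x))
  | .store x y, s => s.setMem (s.reg x) (s.reg y)
  | .rand _ _, s => s

/-- The instruction is not `rand`. -/
def Instr.IsDet : Instr → Prop
  | .rand _ _ => False
  | _ => True

/-- A sequence of instructions. -/
def block (l : List Instr) : Prog := l.foldr (fun i p => .seq (.instr i) p) .skip

theorem Ex.block {w : ℕ} {l : List Instr} {s : State} {T : ℕ} {Q : State → Prop}
    (hl : ∀ i ∈ l, i.IsDet) (hQ : Q (l.foldl (fun s i => i.detExec w s) s))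
    (hT : 2 * l.length ≤ T) : Ex w (block l) s T Q := by
  induction l generalizing s T with
  | nil => exact Ex.skip hQ
  | cons i l ih =>
    simp only [List.length_cons] at hT
    refine Ex.seq (T₁ := 1) (T₂ := 2 * l.length) ?_ (by omega)
    have hi := hl i (by simp)
    have h2 : Ex w (DirectedSampling.block l) (i.detExec w s) (2 * l.length) Q :=
      ih (fun j hj => hl j (by simp [hj])) hQ le_rfl
    cases i with
    | const d a => exact Ex.const h2
    | arith o d x y => exact Ex.arith h2
    | load d x => exact Ex.load h2
    | store x y => exact Ex.store h2
    | rand d x => exact hi.elim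

theorem block_writesOnly {W : Set ℕ} {l : List Instr}
    (h : ∀ i ∈ l, (Prog.instr i).WritesOnly W) : (block l).WritesOnly W := by
  induction l with
  | nil => exact trivial
  | cons i l ih => exact ⟨h i (by simp), ih fun j hj => h j (by simp [hj])⟩

theorem Prog.WritesOnly.mono {W W' : Set ℕ} (h : W ⊆ W') {p : Prog} (hp : p.WritesOnly W) :
    p.WritesOnly W' := by
  induction p with
  | skip => trivial
  | instr i => cases i <;> first | exact h hp | exact hp.elim
  | seq p q ihp ihq => exact ⟨ihp hp.1, ihq hp.2⟩
  | ite t p q ihp ihq => exact ⟨ihp hp.1, ihq hp.2⟩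
  | loop t p ih => exact ih hp

/-! ### The data structure -/

/-- The contents of the data structure: the number `n` of vertices, the number `m` of edges, the
maximum out-degree `lam`, the rounded-up square root `q` of `m`, and the memory with the tables
described by the accessor functions below. In the tables, vertices are numbered from `1`, so that
the initial zeros of the memory stand for the absence of an entry. The edge list stays where the
input has it, below address `2 * S`. -/
structure Data where
  n : ℕ
  m : ℕ
  lam : ℕ
  q : ℕ
  mem : ℕ → ℕ

namespace Data
variable (D : Data)
/-- The row length of the two-dimensional tables. -/
def N1 : ℕ := D.n + 1
/-- The size of a two-dimensional table. -/
def S : ℕ := D.N1 * D.N1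
/-- The tail of the edge number `r`. -/
def eu (r : ℕ) : ℕ := D.mem (2 + 2 * r) + 1
/-- The head of the edge number `r`. -/
def ev (r : ℕ) : ℕ := D.mem (3 + 2 * r) + 1
/-- The entry of the adjacency matrix for `u` and `v`, which is `0` if there is no edge. -/
def adj (u v : ℕ) : ℕ := D.mem (2 * D.S + (u * D.N1 + v))
/-- The out-neighbour number `r` of `u`, or `0` if there is none. -/
def out (u r : ℕ) : ℕ := D.mem (3 * D.S + (u * D.N1 + r))
/-- The vertex number `r` in the list of the vertices of out-degree above `q`, or `0` if there is
none. -/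
def hvy (r : ℕ) : ℕ := D.mem (4 * D.S + r)

/-- All the numbers in the data structure are in range, and fit into `w`-bit words. -/
structure Valid (w : ℕ) : Prop where
  m_pos : 1 ≤ D.m
  lam_pos : 1 ≤ D.lam
  q_pos : 1 ≤ D.q
  m_le : D.m ≤ D.n * D.n
  lam_le : D.lam ≤ D.n
  q_le : D.q ≤ D.n
  eu_le : ∀ r < D.m, D.eu r ≤ D.n
  ev_le : ∀ r < D.m, D.ev r ≤ D.n
  out_le : ∀ u ≤ D.n, ∀ r ≤ D.n, D.out u r ≤ D.n
  hvy_le : ∀ r < D.q, D.hvy r ≤ D.n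
  fits : 6 * D.S < 2 ^ w

end Data

/-! ### Registers

Registers `1, …, k` hold vertices, register `rg k j` is the `j`-th of the remaining ones. The
registers `rg k 0, …, rg k 8` are set in the preprocessing and keep their values afterwards. -/

/-- The `j`-th register above those for the output. -/
abbrev rg (k j : ℕ) : ℕ := k + 1 + j

/-- Constant `1`. -/
abbrev rOne (k : ℕ) := rg k 0
/-- The row length of the tables. -/
abbrev rN1 (k : ℕ) := rg k 1
/-- The number of edges. -/
abbrev rm (k : ℕ) := rg k 2
/-- The maximum out-degree. -/
abbrev rlam (k : ℕ) := rg k 3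
/-- The rounded-up square root of the number of edges. -/
abbrev rq (k : ℕ) := rg k 4
/-- The address of the adjacency matrix. -/
abbrev rAdj (k : ℕ) := rg k 5
/-- The address of the table of out-neighbours. -/
abbrev rOut (k : ℕ) := rg k 6
/-- The address of the list of vertices of high out-degree. -/
abbrev rHvy (k : ℕ) := rg k 7
/-- Constant `0`. -/
abbrev rZero (k : ℕ) := rg k 8
/-- The value that was read. -/
abbrev rY (k : ℕ) := rg k 9
/-- The address to read from. -/
abbrev rA (k : ℕ) := rg k 10
/-- The current digit of the code. -/
abbrev rDg (k : ℕ) := rg k 11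
/-- The remaining digits of the code. -/
abbrev rX (k : ℕ) := rg k 12
/-- Auxiliary constants. -/
abbrev rC (k : ℕ) := rg k 13
/-- `1` as long as no check has failed. -/
abbrev rOK (k : ℕ) := rg k 14
/-- The code within the branch. -/
abbrev rX0 (k : ℕ) := rg k 15
/-- The number of the branch. -/
abbrev rI (k : ℕ) := rg k 16
/-- The number of branches. -/
abbrev rB (k : ℕ) := rg k 17
/-- The code to decode. -/
abbrev rR (k : ℕ) := rg k 18
/-- The number of codes known to be invalid. -/
abbrev rT (k : ℕ) := rg k 19
/-- The number of codes. -/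
abbrev rM (k : ℕ) := rg k 20

/-- The data structure `D` is present in the state `s`. -/
structure Holds (k : ℕ) (D : Data) (s : State) : Prop where
  mem : s.mem = D.mem
  one : s.reg (rOne k) = 1
  N1 : s.reg (rN1 k) = D.N1
  m : s.reg (rm k) = D.m
  lam : s.reg (rlam k) = D.lam
  q : s.reg (rq k) = D.q
  adj : s.reg (rAdj k) = 2 * D.S
  out : s.reg (rOut k) = 3 * D.S
  hvy : s.reg (rHvy k) = 4 * D.S
  zero : s.reg (rZero k) = 0

/-- The registers that sampling may change. -/
def sampRegs (k : ℕ) : Set ℕ := {r | r ≤ k ∨ k + 10 ≤ r}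

theorem Holds.of_same {k : ℕ} {D : Data} {s s' : State} {W : Set ℕ} (h : Holds k D s)
    (hs : SameOutside W s s') (hW : W ⊆ sampRegs k := by intro r; simp [sampRegs]; omega) :
    Holds k D s' := by
  have key : ∀ j < 9, s'.reg (rg k j) = s.reg (rg k j) := fun j hj =>
    hs.2 _ fun hr => by
      have := hW hr
      simp only [sampRegs, Set.mem_ofPred_eq, rg] at this
      omega
  exact ⟨hs.1.trans h.mem, (key 0 (by omega)).trans h.one, (key 1 (by omega)).trans h.N1,
    (key 2 (by omega)).trans h.m, (key 3 (by omega)).trans h.lam, (key 4 (by omega)).trans h.q,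
    (key 5 (by omega)).trans h.adj, (key 6 (by omega)).trans h.out,
    (key 7 (by omega)).trans h.hvy, (key 8 (by omega)).trans h.zero⟩

/-! ### Table look-ups -/

/-- A table from which a vertex can be read: the tails or heads of the edges, the out-neighbours
of the vertex assigned to `u`, or the vertices of high out-degree. -/
inductive Src (k : ℕ)
  | fst
  | snd
  | out (u : Fin k)
  | hvy

/-- The entry number `d` of the table, when the vertices `g` are assigned to the pattern. -/
def Data.val {k : ℕ} (D : Data) (g : Fin k → ℕ) (d : ℕ) : Src k → ℕ
  | .fst => D.eu d
  | .snd => D.ev d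
  | .out u => D.out (g u) d
  | .hvy => D.hvy d

/-- Reads an entry of a table. -/
def Src.prog {k : ℕ} : Src k → Prog
  | .fst => block [.const (rC k) 2, .arith .mul (rA k) (rDg k) (rC k),
      .arith .add (rA k) (rA k) (rC k), .load (rY k) (rA k),
      .arith .add (rY k) (rY k) (rOne k)]
  | .snd => block [.const (rC k) 2, .arith .mul (rA k) (rDg k) (rC k), .const (rC k) 3,
      .arith .add (rA k) (rA k) (rC k), .load (rY k) (rA k),
      .arith .add (rY k) (rY k) (rOne k)]
  | .out u => block [.arith .mul (rA k) (u + 1) (rN1 k), .arith .add (rA k) (rA k) (rDg k),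
      .arith .add (rA k) (rOut k) (rA k), .load (rY k) (rA k)]
  | .hvy => block [.arith .add (rA k) (rHvy k) (rDg k), .load (rY k) (rA k)]

/-- The index `d` is in the range of the table. -/
def Data.InRange {k : ℕ} (D : Data) (g : Fin k → ℕ) (d : ℕ) : Src k → Prop
  | .fst => d < D.m
  | .snd => d < D.m
  | .out u => g u ≤ D.n ∧ d ≤ D.n
  | .hvy => d < D.q

/-- The vertices assigned to the pattern. -/
def State.asg (k : ℕ) (s : State) : Fin k → ℕ := fun u => s.reg (u + 1)

section
variable {k w : ℕ} {D : Data} {s : State}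

theorem Data.Valid.val_le (hD : D.Valid w) {g : Fin k → ℕ} {d : ℕ} {c : Src k}
    (h : D.InRange g d c) : D.val g d c ≤ D.n := by
  cases c with
  | fst => exact hD.eu_le _ h
  | snd => exact hD.ev_le _ h
  | out u => exact hD.out_le _ h.1 _ h.2
  | hvy => exact hD.hvy_le _ h

theorem Data.row_lt (D : Data) {u r : ℕ} (hu : u ≤ D.n) (hr : r ≤ D.n) :
    u * D.N1 + r < D.S := by
  unfold Data.S Data.N1
  nlinarith

theorem Src.writesOnly (c : Src k) : c.prog.WritesOnly {rY k, rA k, rC k} := by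
  cases c <;> refine block_writesOnly ?_ <;> simp [Prog.WritesOnly]

theorem Src.spec (hD : D.Valid w) (hs : Holds k D s) {c : Src k}
    (hc : D.InRange (s.asg k) (s.reg (rDg k)) c) :
    Ex w c.prog s 12 fun s' => s'.reg (rY k) = D.val (s.asg k) (s.reg (rDg k)) c := by
  have hf := hD.fits
  have hn : D.n * D.n ≤ D.S := by unfold Data.S Data.N1; nlinarith
  have hn2 : D.n < D.S := by unfold Data.S Data.N1; nlinarith
  have hm := hD.m_le
  have hval := hD.val_le hc
  cases c with
  | fst =>
    refine Ex.block (by simp [Instr.IsDet]) ?_ (by simp)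
    simp only [Data.InRange] at hc
    simp only [Data.val, Data.eu] at hval ⊢
    simp [Instr.detExec, State.setReg, Op.eval, hs.mem, hs.one]
    rw [Nat.mod_eq_of_lt (show s.reg (rDg k) * 2 + 2 < 2 ^ w by omega),
      show s.reg (rDg k) * 2 + 2 = 2 + 2 * s.reg (rDg k) by ring]
    exact Nat.mod_eq_of_lt (by omega)
  | snd =>
    refine Ex.block (by simp [Instr.IsDet]) ?_ (by simp)
    simp only [Data.InRange] at hc
    simp only [Data.val, Data.ev] at hval ⊢
    simp [Instr.detExec, State.setReg, Op.eval, hs.mem, hs.one]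
    rw [Nat.mod_eq_of_lt (show s.reg (rDg k) * 2 + 3 < 2 ^ w by omega),
      show s.reg (rDg k) * 2 + 3 = 3 + 2 * s.reg (rDg k) by ring]
    exact Nat.mod_eq_of_lt (by omega)
  | out u =>
    have hu := u.isLt
    refine Ex.block (by simp [Instr.IsDet]) ?_ (by simp)
    simp only [Data.InRange] at hc
    simp only [Data.val, Data.out, State.asg] at hval hc ⊢
    have hrow := D.row_lt hc.1 hc.2
    simp [Instr.detExec, State.setReg, Op.eval, hs.mem, hs.N1, hs.out]
    rw [Nat.mod_eq_of_lt (by omega)]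
  | hvy =>
    refine Ex.block (by simp [Instr.IsDet]) ?_ (by simp)
    simp only [Data.InRange] at hc
    simp only [Data.val, Data.hvy] at hval ⊢
    have := hD.q_le
    simp [Instr.detExec, State.setReg, Op.eval, hs.mem, hs.hvy]
    rw [Nat.mod_eq_of_lt (by omega)]

end

/-! ### Codes of embeddings -/

/-- A step of a decoding plan, which consumes one digit of the code.
* `edge u v`: the digit is the number of the edge that the vertices `u`, `v` are mapped to
* `lam u v`: the digit is the rank of the image of `v` among the out-neighbours of that of `u`
* `heavy t`: the digit is the number of the image of `t` in the list of the vertices of out-degree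
  above `q`
* `light t h`: the same as `lam t h`, but the out-degree of the image of `t` is at most `q`. -/
inductive Stp (k : ℕ)
  | edge (u v : Fin k)
  | lam (u v : Fin k)
  | heavy (t : Fin k)
  | light (t h : Fin k)

section
variable {k : ℕ}

/-- The vertices that have to be known before the step. -/
def Stp.needs : Stp k → Finset (Fin k)
  | .edge _ _ => ∅
  | .lam u _ => {u}
  | .heavy _ => ∅
  | .light t _ => {t}

/-- The vertices that the step determines. -/
def Stp.sets : Stp k → Finset (Fin k)
  | .edge u v => {u, v}
  | .lam _ v => {v}
  | .heavy t => {t}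
  | .light _ h => {h}

/-- The vertices known after the steps `l`, when those in `K` are known before. -/
def known (K : Finset (Fin k)) (l : List (Stp k)) : Finset (Fin k) :=
  l.foldl (fun K s => K ∪ s.sets) K

/-- Every step finds the vertices it needs, when those in `K` are known before. -/
def Ordered : Finset (Fin k) → List (Stp k) → Prop
  | _, [] => True
  | K, s :: l => s.needs ⊆ K ∧ Ordered (K ∪ s.sets) l

/-- The number of values of the digit of a step. -/
def Stp.rad (D : Data) : Stp k → ℕ
  | .edge _ _ => D.m
  | .lam _ _ => D.lam
  | .heavy _ => D.q
  | .light _ _ => D.q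

/-- The digit `d` is the one that belongs to the assignment `g` in the step. -/
def Stp.Rel (D : Data) (d : ℕ) (g : Fin k → ℕ) : Stp k → Prop
  | .edge u v => g u = D.eu d ∧ g v = D.ev d
  | .lam u v => g v = D.out (g u) d
  | .heavy t => g t = D.hvy d
  | .light t h => g h = D.out (g t) d ∧ D.out (g t) D.q = 0

/-- The number `x`, read in a mixed radix system, is the code that belongs to the assignment `g`
in the sequence of steps. -/
def BRel (D : Data) (g : Fin k → ℕ) : ℕ → List (Stp k) → Prop
  | _, [] => True
  | x, s :: l => s.Rel D (x % s.rad D) g ∧ BRel D g (x / s.rad D) l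

/-- `g` embeds the pattern into the data graph. -/
def Emb (D : Data) (P : Digraph (Fin k)) (g : Fin k → ℕ) : Prop :=
  (∀ u, g u ≤ D.n) ∧ (∀ u v, P.Adj u v → D.adj (g u) (g v) ≠ 0) ∧ ∀ u v, u ≠ v → g u ≠ g v

/-- `x` is the code of the embedding `g`: its residue modulo the number of branches selects the
branch, and the quotient is a code of `g` in that branch. -/
def IsCode (D : Data) (P : Digraph (Fin k)) (fam : List (List (Stp k))) (x : ℕ) (g : Fin k → ℕ) :
    Prop :=
  (∃ b, fam[x % fam.length]? = some b ∧ BRel D g (x / fam.length) b) ∧ Emb D P g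

/-! ### The decoding program -/

/-- The register with the number of values of the digit. -/
def Stp.radReg : Stp k → ℕ
  | .edge _ _ => rm k
  | .lam _ _ => rlam k
  | .heavy _ => rq k
  | .light _ _ => rq k

/-- Extracts the next digit of the code. -/
def Stp.digitProg (s : Stp k) : Prog :=
  block [.arith .mod (rDg k) (rX k) s.radReg, .arith .div (rX k) (rX k) s.radReg]

/-- Reads a vertex and assigns it to `v`. -/
def readProg (v : Fin k) (c : Src k) : Prog :=
  .seq c.prog (.instr (.arith .add (v + 1) (rY k) (rZero k)))

/-- Records a failure if the test holds. -/
def failIf (k : ℕ) (t : Test) : Prog := .ite t (.instr (.const (rOK k) 0)) .skip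

/-- Reads a vertex and compares it to the one assigned to `v`. -/
def compareProg (v : Fin k) (c : Src k) : Prog :=
  .seq c.prog (failIf k (.ne (rY k) (v + 1)))

/-- Carries out the assignments of a step. -/
def Stp.assign : Stp k → Prog
  | .edge u v => .seq (readProg u .fst) (readProg v .snd)
  | .lam u v => readProg v (.out u)
  | .heavy t => readProg t .hvy
  | .light t h => readProg h (.out t)

/-- Checks the relation between the digit and the assignment. -/
def Stp.check : Stp k → Prog
  | .edge u v => .seq (compareProg u .fst) (compareProg v .snd)
  | .lam u v => compareProg v (.out u)
  | .heavy t => compareProg t .hvy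
  | .light t h => .seq (compareProg h (.out t)) <|
      .seq (.instr (.arith .add (rDg k) (rq k) (rZero k))) <|
        .seq (Src.out t).prog (failIf k (.ne (rY k) (rZero k)))

/-- Carries out the assignments of a sequence of steps. -/
def assignAll : List (Stp k) → Prog
  | [] => .skip
  | s :: l => .seq s.digitProg (.seq s.assign (assignAll l))

/-- Checks the relation between the digits and the assignment, for a sequence of steps. -/
def checkAll : List (Stp k) → Prog
  | [] => .skip
  | s :: l => .seq s.digitProg (.seq s.check (checkAll l))

/-- Decodes the code in `rX0` along a branch. All the assignments are made before the checks, since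
a vertex may be assigned several times, and the checks compare the digits to the final values. -/
def branchProg (b : List (Stp k)) : Prog :=
  .seq (.instr (.arith .add (rX k) (rX0 k) (rZero k))) <| .seq (assignAll b) <|
    .seq (.instr (.arith .add (rX k) (rX0 k) (rZero k))) (checkAll b)

/-- Runs the branch whose number is in `rI`; the numbers start with `i`. -/
def dispatch : ℕ → List (List (Stp k)) → Prog
  | _, [] => .skip
  | i, b :: l => .seq (.instr (.const (rC k) i)) <|
      .seq (.ite (.eq (rI k) (rC k)) (branchProg b) .skip) (dispatch (i + 1) l)

/-- Checks that an edge of the pattern is mapped to an edge. -/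
def adjCheck (e : Fin k × Fin k) : Prog :=
  .seq (block [.arith .mul (rA k) (e.1 + 1) (rN1 k), .arith .add (rA k) (rA k) (e.2 + 1),
    .arith .add (rA k) (rAdj k) (rA k), .load (rY k) (rA k)]) (failIf k (.eq (rY k) (rZero k)))

/-- Checks that two vertices have different images. -/
def neCheck (e : Fin k × Fin k) : Prog := failIf k (.eq (e.1 + 1) (e.2 + 1))

/-- Runs programs in sequence. -/
def seqAll {α : Type*} (f : α → Prog) (l : List α) : Prog := l.foldr (fun a p => .seq (f a) p) .skip

open Classical in
/-- The edges of the pattern. -/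
noncomputable def edgeList (P : Digraph (Fin k)) : List (Fin k × Fin k) :=
  (Finset.univ.filter fun e : Fin k × Fin k => P.Adj e.1 e.2).toList

/-- The pairs of different vertices of the pattern. -/
noncomputable def neList (k : ℕ) : List (Fin k × Fin k) :=
  (Finset.univ.filter fun e : Fin k × Fin k => e.1 ≠ e.2).toList

/-- Decodes the code in `rR`, whose validity is recorded in `rOK`. -/
noncomputable def decode (P : Digraph (Fin k)) (fam : List (List (Stp k))) : Prog :=
  .seq (block [.const (rOK k) 1, .arith .mod (rI k) (rR k) (rB k),
    .arith .div (rX0 k) (rR k) (rB k)]) <|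
  .seq (dispatch 0 fam) <| .seq (seqAll adjCheck (edgeList P)) (seqAll neCheck (neList k))

/-! ### Correctness of the decoding program -/

/-- The registers that decoding may change. -/
def decRegs (k : ℕ) : Set ℕ := {r | (1 ≤ r ∧ r ≤ k) ∨ (k + 10 ≤ r ∧ r ≤ k + 17)}

/-- The registers that checking may change. -/
def chkRegs (k : ℕ) : Set ℕ := {r | k + 10 ≤ r ∧ r ≤ k + 15}

variable {w : ℕ} {D : Data} {s : State}

theorem Src.writesOnly_chk (c : Src k) : c.prog.WritesOnly (chkRegs k) :=
  c.writesOnly.mono (by intro r; simp [chkRegs, rY, rA, rC, rg]; omega)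

theorem Stp.digitProg_writesOnly (c : Stp k) : c.digitProg.WritesOnly {rX k, rDg k} :=
  block_writesOnly (by simp [Prog.WritesOnly])

theorem failIf_writesOnly (t : Test) : (failIf k t).WritesOnly (chkRegs k) :=
  ⟨by simp [Prog.WritesOnly, chkRegs, rOK, rg], trivial⟩

theorem Stp.check_writesOnly (c : Stp k) : c.check.WritesOnly (chkRegs k) := by
  have h1 : ∀ (v : Fin k) c, (compareProg v c).WritesOnly (chkRegs k) :=
    fun v c => ⟨c.writesOnly_chk, failIf_writesOnly _⟩
  cases c with
  | edge u v => exact ⟨h1 _ _, h1 _ _⟩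
  | lam u v => exact h1 _ _
  | heavy t => exact h1 _ _
  | light t h => exact ⟨h1 _ _, by simp [Prog.WritesOnly, chkRegs, rDg, rg], (Src.out t).writesOnly_chk,
      failIf_writesOnly _⟩

theorem checkAll_writesOnly (l : List (Stp k)) : (checkAll l).WritesOnly (chkRegs k) := by
  induction l with
  | nil => trivial
  | cons c l ih => exact ⟨c.digitProg_writesOnly.mono (by intro r; simp [chkRegs, rDg, rX, rg]; omega),
      c.check_writesOnly, ih⟩

theorem chkRegs_subset : chkRegs k ⊆ decRegs k := by
  intro r; simp [chkRegs, decRegs]; omega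

theorem assignAll_writesOnly (l : List (Stp k)) :
    (assignAll l).WritesOnly {r | (1 ≤ r ∧ r ≤ k) ∨ (k + 10 ≤ r ∧ r ≤ k + 14)} := by
  have h1 : ∀ (v : Fin k) c, (readProg v c).WritesOnly
      {r | (1 ≤ r ∧ r ≤ k) ∨ (k + 10 ≤ r ∧ r ≤ k + 14)} :=
    fun v c => ⟨c.writesOnly.mono (by intro r; simp [rY, rA, rC, rg]; omega),
      by simp [Prog.WritesOnly]⟩
  induction l with
  | nil => trivial
  | cons c l ih =>
    refine ⟨c.digitProg_writesOnly.mono (by intro r; simp [rDg, rX, rg]; omega), ?_, ih⟩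
    cases c with
    | edge u v => exact ⟨h1 _ _, h1 _ _⟩
    | lam u v => exact h1 _ _
    | heavy t => exact h1 _ _
    | light t h => exact h1 _ _

end

section
variable {k w : ℕ} {D : Data} {s s' : State}

theorem SameOutside.asg {W : Set ℕ} (h : SameOutside W s s') (hW : ∀ r ∈ W, k < r) :
    s'.asg k = s.asg k := by
  funext u
  have := u.isLt
  exact h.2 _ fun hr => by have := hW _ hr; omega

theorem Stp.rad_pos (hD : D.Valid w) (c : Stp k) : 0 < c.rad D := by
  cases c
  · exact hD.m_pos
  · exact hD.lam_pos
  · exact hD.q_pos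
  · exact hD.q_pos

theorem Stp.digitProg_spec (hs : Holds k D s) (c : Stp k) :
    Ex w c.digitProg s 4 fun s' => s'.reg (rDg k) = s.reg (rX k) % c.rad D ∧
      s'.reg (rX k) = s.reg (rX k) / c.rad D := by
  have h : s.reg c.radReg = c.rad D := by
    cases c
    · exact hs.m
    · exact hs.lam
    · exact hs.q
    · exact hs.q
  have h1 : c.radReg ≠ rDg k := by cases c <;> simp [radReg]
  refine Ex.block (by simp [Instr.IsDet]) ?_ (by simp)
  simp [Instr.detExec, State.setReg, Op.eval, h, Function.update_of_ne h1]

theorem readProg_spec (hD : D.Valid w) (hs : Holds k D s) (v : Fin k) {c : Src k}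
    (hc : D.InRange (s.asg k) (s.reg (rDg k)) c) :
    Ex w (readProg v c) s 14 fun s' => s'.reg (v + 1) = D.val (s.asg k) (s.reg (rDg k)) c ∧
      SameOutside {r | r = v + 1 ∨ k + 10 ≤ r ∧ r ≠ rX k ∧ r ≠ rDg k ∧ r ≠ rOK k} s s' := by
  have h1 := D.val (s.asg k) (s.reg (rDg k)) c
  refine Ex.seq (T₁ := 12) (T₂ := 1) ?_ (by omega)
  refine ((Src.spec hD hs hc).frame c.writesOnly).mono le_rfl ?_
  rintro s₁ ⟨h1, h2⟩
  have hf : D.n < 2 ^ w := by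
    have := hD.fits
    have hn2 : D.n < D.S := by unfold Data.S Data.N1; nlinarith
    omega
  have h0 : s₁.reg (rZero k) = 0 := by rw [h2.2 _ (by simp)]; exact hs.zero
  refine Ex.arith ⟨?_, ?_⟩
  · simp [State.setReg, Op.eval, h1, h0]
    exact Nat.mod_eq_of_lt ((hD.val_le hc).trans_lt hf)
  · refine SameOutside.trans ⟨h2.1, fun r hr => h2.2 r ?_⟩ (.setReg (by simp))
    simp [rY, rA, rX, rC, rg, rDg, rOK] at hr ⊢
    omega

theorem failIf_spec (t : Test) :
    Ex w (failIf k t) s 2 fun s' => (s'.reg (rOK k) = 1 ↔ s.reg (rOK k) = 1 ∧ t.holds s = false) ∧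
      SameOutside {rOK k} s s' := by
  refine Ex.ite (T₁ := 1) (fun h => Ex.const ⟨?_, .setReg (by simp)⟩)
    (fun h => Ex.skip ⟨?_, .refl⟩) (by omega)
  · simp [State.setReg, h]
  · simp [h]

theorem compareProg_spec (hD : D.Valid w) (hs : Holds k D s) (v : Fin k) {c : Src k}
    (hc : D.InRange (s.asg k) (s.reg (rDg k)) c) :
    Ex w (compareProg v c) s 16 fun s' =>
      (s'.reg (rOK k) = 1 ↔ s.reg (rOK k) = 1 ∧
        s.asg k v = D.val (s.asg k) (s.reg (rDg k)) c) ∧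
      SameOutside {rY k, rA k, rC k, rOK k} s s' := by
  have hv := v.isLt
  refine Ex.seq (T₁ := 12) (T₂ := 2) ?_ (by omega)
  refine ((Src.spec hD hs hc).frame c.writesOnly).mono le_rfl ?_
  rintro s₁ ⟨h1, h2⟩
  have e1 : s₁.reg (rOK k) = s.reg (rOK k) := h2.2 _ (by simp)
  have e2 : s₁.reg (v + 1) = s.asg k v := h2.2 _ (by simp [rY, rA, rC, rg]; omega)
  refine (failIf_spec _).mono le_rfl ?_
  rintro s₂ ⟨h3, h4⟩
  refine ⟨?_, ?_⟩
  · simp only [h3, e1, Test.holds, h1, e2, ne_eq, decide_not, Bool.not_eq_false', decide_eq_true_eq]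
    exact and_congr_right fun _ => eq_comm
  · refine SameOutside.trans ⟨h2.1, fun r hr => h2.2 r ?_⟩ ⟨h4.1, fun r hr => h4.2 r ?_⟩
    · simp at hr ⊢; tauto
    · simp at hr ⊢; tauto

/-- The vertices in `K` have been assigned vertices of the data graph (or `0`). -/
def Bdd (D : Data) (K : Finset (Fin k)) (s : State) : Prop := ∀ v ∈ K, s.asg k v ≤ D.n

theorem readProg_frame {v : Fin k}
    (h : SameOutside {r | r = v + 1 ∨ k + 10 ≤ r ∧ r ≠ rX k ∧ r ≠ rDg k ∧ r ≠ rOK k} s s') :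
    (∀ u ≠ v, s'.asg k u = s.asg k u) ∧ s'.reg (rX k) = s.reg (rX k) ∧
      s'.reg (rDg k) = s.reg (rDg k) ∧ (Holds k D s → Holds k D s') := by
  have hv := v.isLt
  refine ⟨fun u hu => h.2 _ ?_, h.2 _ ?_, h.2 _ ?_, fun hs => hs.of_same h ?_⟩
  · have := u.isLt
    have : (u : ℕ) ≠ v := fun e => hu (Fin.ext e)
    simp; omega
  · simp [rX, rg]; omega
  · simp [rDg, rg]; omega
  · intro r; simp [sampRegs]; omega

/-- The assignments of a step are correct, provided that the earlier ones are. -/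
theorem Stp.assign_spec (hD : D.Valid w) (hs : Holds k D s) {K : Finset (Fin k)}
    (hK : Bdd D K s) (c : Stp k) (hc : c.needs ⊆ K) (hd : s.reg (rDg k) < c.rad D) :
    Ex w c.assign s 40 fun s' => Holds k D s' ∧ s'.reg (rX k) = s.reg (rX k) ∧
      Bdd D (K ∪ c.sets) s' ∧ ∀ g, c.Rel D (s.reg (rDg k)) g → (∀ v ∈ K, s.asg k v = g v) →
        ∀ v ∈ K ∪ c.sets, s'.asg k v = g v := by
  have hlam := hD.lam_le
  have hq := hD.q_le
  have single : ∀ (v : Fin k) (src : Src k), D.InRange (s.asg k) (s.reg (rDg k)) src →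
      c.sets = {v} → (∀ g, c.Rel D (s.reg (rDg k)) g → (∀ v ∈ K, s.asg k v = g v) →
        g v = D.val (s.asg k) (s.reg (rDg k)) src) →
      Ex w (readProg v src) s 40 fun s' => Holds k D s' ∧ s'.reg (rX k) = s.reg (rX k) ∧
      Bdd D (K ∪ c.sets) s' ∧ ∀ g, c.Rel D (s.reg (rDg k)) g → (∀ v ∈ K, s.asg k v = g v) →
        ∀ v ∈ K ∪ c.sets, s'.asg k v = g v := by
    intro v src hr hset hg
    refine (readProg_spec hD hs v hr).mono (by omega) ?_
    rintro s' ⟨h1, h2⟩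
    obtain ⟨h3, h4, h5, h6⟩ := readProg_frame (D := D) h2
    have hv : s'.asg k v = D.val (s.asg k) (s.reg (rDg k)) src := h1
    refine ⟨h6 hs, h4, fun u hu => ?_, fun g hrel hgK u hu => ?_⟩
    · by_cases huv : u = v
      · subst huv; rw [hv]; exact hD.val_le hr
      · rw [h3 u huv]; exact hK u (by simpa [hset, huv] using hu)
    · by_cases huv : u = v
      · subst huv; rw [hv]; exact (hg g hrel hgK).symm
      · rw [h3 u huv]; exact hgK u (by simpa [hset, huv] using hu)
  cases c with
  | edge u v =>
    refine Ex.seq (T₁ := 14) (T₂ := 14) ?_ (by omega)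
    refine (readProg_spec hD hs u (c := .fst) hd).mono le_rfl ?_
    rintro s₁ ⟨h1, h2⟩
    obtain ⟨h3, h4, h5, h6⟩ := readProg_frame (D := D) h2
    have hu : s₁.asg k u = D.eu (s.reg (rDg k)) := h1
    refine (readProg_spec hD (h6 hs) v (c := .snd) (by rw [h5]; exact hd)).mono le_rfl ?_
    rintro s₂ ⟨h1', h2'⟩
    obtain ⟨h3', h4', h5', h6'⟩ := readProg_frame (D := D) h2'
    have hv : s₂.asg k v = D.ev (s.reg (rDg k)) := by rw [← h5]; exact h1'
    refine ⟨h6' (h6 hs), h4'.trans h4, fun x hx => ?_, fun g hrel hgK x hx => ?_⟩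
    · by_cases hxv : x = v
      · subst hxv; rw [hv]; exact hD.ev_le _ hd
      · rw [h3' x hxv]
        by_cases hxu : x = u
        · subst hxu; rw [hu]; exact hD.eu_le _ hd
        · rw [h3 x hxu]; exact hK x (by simpa [sets, hxv, hxu] using hx)
    · by_cases hxv : x = v
      · subst hxv; rw [hv]; exact hrel.2.symm
      · rw [h3' x hxv]
        by_cases hxu : x = u
        · subst hxu; rw [hu]; exact hrel.1.symm
        · rw [h3 x hxu]; exact hgK x (by simpa [sets, hxv, hxu] using hx)
  | lam u v =>
    have hu : u ∈ K := hc (by simp [needs])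
    simp only [rad] at hd
    refine single v (.out u) ⟨hK u hu, by omega⟩ rfl fun g hrel hgK => ?_
    rw [Data.val, hgK u hu]; exact hrel
  | heavy t => exact single t .hvy hd rfl fun g hrel hgK => hrel
  | light t h =>
    have hu : t ∈ K := hc (by simp [needs])
    simp only [rad] at hd
    refine single h (.out t) ⟨hK t hu, by omega⟩ rfl fun g hrel hgK => ?_
    rw [Data.val, hgK t hu]; exact hrel.1

theorem assignAll_spec (hD : D.Valid w) (l : List (Stp k)) (hs : Holds k D s) {K : Finset (Fin k)}
    (hK : Bdd D K s) (hl : Ordered K l) :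
    Ex w (assignAll l) s (46 * l.length) fun s' => Bdd D (known K l) s' ∧
      ∀ g, BRel D g (s.reg (rX k)) l → (∀ v ∈ K, s.asg k v = g v) →
        ∀ v ∈ known K l, s'.asg k v = g v := by
  induction l generalizing s K with
  | nil => exact Ex.skip ⟨hK, fun g _ h => h⟩
  | cons c l ih =>
    refine Ex.seq (T₁ := 4) (T₂ := 40 + 46 * l.length + 1) ?_
      (by simp only [List.length_cons]; omega)
    refine ((c.digitProg_spec hs).frame c.digitProg_writesOnly).mono le_rfl ?_
    rintro s₁ ⟨⟨h1, h2⟩, h3⟩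
    have hs₁ : Holds k D s₁ := hs.of_same h3
      (by intro r; simp [sampRegs, rX, rDg, rg]; omega)
    have ha : s₁.asg k = s.asg k := h3.asg (by simp [rX, rDg, rg]; omega)
    refine Ex.seq (T₁ := 40) (T₂ := 46 * l.length) ?_ (by omega)
    refine (c.assign_spec hD hs₁ (K := K) (fun v hv => by rw [ha]; exact hK v hv) hl.1
      (by rw [h1]; exact Nat.mod_lt _ (c.rad_pos hD))).mono le_rfl ?_
    rintro s₂ ⟨h4, h5, h6, h7⟩
    refine (ih h4 h6 hl.2).mono le_rfl ?_
    rintro s₃ ⟨h8, h9⟩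
    refine ⟨h8, fun g hg hgK => h9 g ?_ (h7 g ?_ ?_)⟩
    · rw [h5, h2]; exact hg.2
    · rw [h1]; exact hg.1
    · rw [ha]; exact hgK

theorem Stp.check_spec (hD : D.Valid w) (hs : Holds k D s) (hK : ∀ v : Fin k, s.asg k v ≤ D.n)
    (c : Stp k) (hd : s.reg (rDg k) < c.rad D) :
    Ex w c.check s 40 fun s' => s'.reg (rX k) = s.reg (rX k) ∧
      (s'.reg (rOK k) = 1 ↔ s.reg (rOK k) = 1 ∧ c.Rel D (s.reg (rDg k)) (s.asg k)) := by
  have hlam := hD.lam_le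
  have hq := hD.q_le
  have hW : ∀ r ∈ ({rY k, rA k, rC k, rOK k} : Set ℕ), k < r := by
    simp [rY, rA, rC, rOK, rg]; omega
  have hW' : ({rY k, rA k, rC k, rOK k} : Set ℕ) ⊆ sampRegs k := by
    intro r; simp [sampRegs, rY, rA, rC, rOK, rg]; omega
  have fX : ∀ {s s' : State}, SameOutside {rY k, rA k, rC k, rOK k} s s' →
      s'.reg (rX k) = s.reg (rX k) := fun h => h.2 _ (by simp)
  have fD : ∀ {s s' : State}, SameOutside {rY k, rA k, rC k, rOK k} s s' →
      s'.reg (rDg k) = s.reg (rDg k) := fun h => h.2 _ (by simp)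
  cases c with
  | edge u v =>
    refine Ex.seq (T₁ := 16) (T₂ := 16) ?_ (by omega)
    refine (compareProg_spec hD hs u (c := .fst) hd).mono le_rfl ?_
    rintro s₁ ⟨h1, h2⟩
    refine (compareProg_spec hD (hs.of_same h2 hW') v (c := .snd)
      (by rw [fD h2]; exact hd)).mono le_rfl ?_
    rintro s₂ ⟨h3, h4⟩
    refine ⟨(fX h4).trans (fX h2), ?_⟩
    rw [h3, h1, h2.asg hW, fD h2, Rel, and_assoc]
    rfl
  | lam u v =>
    simp only [rad] at hd
    refine (compareProg_spec hD hs v (c := .out u) ⟨hK u, by omega⟩).mono (by omega) ?_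
    rintro s₁ ⟨h1, h2⟩
    exact ⟨fX h2, h1⟩
  | heavy t =>
    refine (compareProg_spec hD hs t (c := .hvy) hd).mono (by omega) ?_
    rintro s₁ ⟨h1, h2⟩
    exact ⟨fX h2, h1⟩
  | light t h =>
    simp only [rad] at hd
    refine Ex.seq (T₁ := 16) (T₂ := 18) ?_ (by omega)
    refine (compareProg_spec hD hs h (c := .out t) ⟨hK t, by omega⟩).mono le_rfl ?_
    rintro s₁ ⟨h1, h2⟩
    have hs₁ := hs.of_same h2 hW'
    have hf : D.n < 2 ^ w := by
      have := hD.fits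
      have hn2 : D.n < D.S := by unfold Data.S Data.N1; nlinarith
      omega
    refine Ex.seq (T₁ := 1) (T₂ := 16) (Ex.arith ?_) (by omega)
    simp only [Op.eval, hs₁.q, hs₁.zero, add_zero, Nat.mod_eq_of_lt (hq.trans_lt hf)]
    set s₂ := s₁.setReg (rDg k) D.q with hs₂
    have h12 : SameOutside {rDg k} s₁ s₂ := .setReg (by simp)
    have ha : s₂.asg k = s.asg k := by
      rw [h12.asg (by simp [rDg, rg]; omega), h2.asg hW]
    have hdg : s₂.reg (rDg k) = D.q := by simp [hs₂, State.setReg]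
    have hH : Holds k D s₂ := hs₁.of_same h12 (by intro r; simp [sampRegs, rDg, rg]; omega)
    refine Ex.seq (T₁ := 12) (T₂ := 2) ?_ (by omega)
    refine ((Src.spec hD hH (c := .out t) ⟨by rw [ha]; exact hK t, by omega⟩).frame
      (Src.writesOnly _)).mono le_rfl ?_
    rintro s₃ ⟨h3, h4⟩
    refine (failIf_spec _).mono le_rfl ?_
    rintro s₄ ⟨h5, h6⟩
    refine ⟨?_, ?_⟩
    · rw [h6.2 _ (by simp), h4.2 _ (by simp), h12.2 _ (by simp), fX h2]
    · have e0 : s₃.reg (rZero k) = 0 := by rw [h4.2 _ (by simp)]; exact hH.zero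
      have e1 : s₃.reg (rOK k) = s₁.reg (rOK k) := by
        rw [h4.2 _ (by simp), h12.2 _ (by simp)]
      rw [h5, e1, h1]
      simp only [Test.holds, h3, e0, ha, hdg, Rel, Data.val]
      simp [and_assoc]

theorem checkAll_spec (hD : D.Valid w) (l : List (Stp k)) (hs : Holds k D s)
    (hK : ∀ v : Fin k, s.asg k v ≤ D.n) :
    Ex w (checkAll l) s (46 * l.length) fun s' =>
      s'.reg (rOK k) = 1 ↔ s.reg (rOK k) = 1 ∧ BRel D (s.asg k) (s.reg (rX k)) l := by
  induction l generalizing s with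
  | nil => exact Ex.skip (by simp [BRel])
  | cons c l ih =>
    refine Ex.seq (T₁ := 4) (T₂ := 40 + 46 * l.length + 1) ?_
      (by simp only [List.length_cons]; omega)
    refine ((c.digitProg_spec hs).frame c.digitProg_writesOnly).mono le_rfl ?_
    rintro s₁ ⟨⟨h1, h2⟩, h3⟩
    have hs₁ : Holds k D s₁ := hs.of_same h3
      (by intro r; simp [sampRegs, rX, rDg, rg]; omega)
    have ha : s₁.asg k = s.asg k := h3.asg (by simp [rX, rDg, rg]; omega)
    refine Ex.seq (T₁ := 40) (T₂ := 46 * l.length) ?_ (by omega)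
    refine ((c.check_spec hD hs₁ (by rw [ha]; exact hK)
      (by rw [h1]; exact Nat.mod_lt _ (c.rad_pos hD))).frame c.check_writesOnly).mono le_rfl ?_
    rintro s₂ ⟨⟨h4, h5⟩, h6⟩
    have ha₂ : s₂.asg k = s.asg k := by rw [h6.asg (by simp [chkRegs]; omega), ha]
    refine (ih (hs₁.of_same h6 (by intro r; simp [chkRegs, sampRegs]; omega))
      (by rw [ha₂]; exact hK)).mono le_rfl ?_
    intro s₃ h7
    rw [h7, h5, ha₂, ha, h4, h2, h1, h3.2 (rOK k) (by simp), and_assoc, BRel]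

end

section
variable {k w : ℕ} {D : Data} {s s' : State} {P : Digraph (Fin k)}

theorem branchProg_writesOnly (b : List (Stp k)) :
    (branchProg b).WritesOnly {r | (1 ≤ r ∧ r ≤ k) ∨ (k + 10 ≤ r ∧ r ≤ k + 15)} := by
  have h : rX k ∈ {r | (1 ≤ r ∧ r ≤ k) ∨ (k + 10 ≤ r ∧ r ≤ k + 15)} := by
    simp [rX, rg]
  exact ⟨h, (assignAll_writesOnly b).mono (by intro r; simp; omega), h,
    (checkAll_writesOnly b).mono (by intro r; simp [chkRegs]; omega)⟩

/-- The branch `b`, run on the code `x`, yields the unique assignment with that code, or records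
a failure. -/
def BranchDone (D : Data) (x : ℕ) (b : List (Stp k)) (s : State) : Prop :=
  (∀ v : Fin k, s.asg k v ≤ D.n) ∧
  (s.reg (rOK k) = 1 ↔ BRel D (s.asg k) x b) ∧ ∀ g, BRel D g x b → g = s.asg k

theorem branchProg_spec (hD : D.Valid w) (hs : Holds k D s) (b : List (Stp k))
    (hb : Ordered ∅ b) (hb' : known ∅ b = Finset.univ) (hOK : s.reg (rOK k) = 1)
    (hx : s.reg (rX0 k) < 2 ^ w) :
    Ex w (branchProg b) s (92 * b.length + 5) (BranchDone D (s.reg (rX0 k)) b) := by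
  refine Ex.seq (T₁ := 1) (T₂ := 92 * b.length + 3) (Ex.arith ?_) (by omega)
  simp only [Op.eval, hs.zero, add_zero, Nat.mod_eq_of_lt hx]
  set s₁ := s.setReg (rX k) (s.reg (rX0 k)) with hs₁
  have h1 : SameOutside {rX k} s s₁ := .setReg (by simp)
  have hH₁ : Holds k D s₁ := hs.of_same h1 (by intro r; simp [sampRegs, rX, rg]; omega)
  refine Ex.seq (T₁ := 46 * b.length) (T₂ := 46 * b.length + 2) ?_ (by omega)
  refine ((assignAll_spec hD b hH₁ (K := ∅) (by simp [Bdd]) hb).frame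
    (assignAll_writesOnly b)).mono le_rfl ?_
  rintro s₂ ⟨⟨h2, h3⟩, h4⟩
  have hH₂ : Holds k D s₂ := hH₁.of_same h4 (by intro r; simp [sampRegs]; omega)
  have e2 : s₂.reg (rX0 k) = s.reg (rX0 k) := by
    rw [h4.2 _ (by simp [rX0, rg]; omega), h1.2 _ (by simp)]
  refine Ex.seq (T₁ := 1) (T₂ := 46 * b.length) (Ex.arith ?_) (by omega)
  simp only [Op.eval, hH₂.zero, add_zero, e2, Nat.mod_eq_of_lt hx]
  set s₃ := s₂.setReg (rX k) (s.reg (rX0 k)) with hs₃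
  have h5 : SameOutside {rX k} s₂ s₃ := .setReg (by simp)
  have hH₃ : Holds k D s₃ := hH₂.of_same h5 (by intro r; simp [sampRegs, rX, rg]; omega)
  have ha : s₃.asg k = s₂.asg k := h5.asg (by simp [rX, rg]; omega)
  have hbd : ∀ v : Fin k, s₂.asg k v ≤ D.n := fun v => h2 v (by simp [hb'])
  refine ((checkAll_spec hD b hH₃ (by rw [ha]; exact hbd)).frame
    (checkAll_writesOnly b)).mono le_rfl ?_
  rintro s₄ ⟨h6, h7⟩
  have ha₄ : s₄.asg k = s₂.asg k := by rw [h7.asg (by simp [chkRegs]; omega), ha]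
  refine ⟨by rw [ha₄]; exact hbd, ?_, fun g hg => ?_⟩
  · have e4 : s₃.reg (rX k) = s.reg (rX0 k) := by simp [hs₃, State.setReg]
    rw [h6, ha₄, ha, e4, h5.2 _ (by simp), h4.2 _ (by simp [rOK, rg]; omega), h1.2 _ (by simp)]
    simp [hOK]
  · rw [ha₄]
    funext v
    refine (h3 g ?_ (by simp) v (by simp [hb'])).symm
    simpa [hs₁, State.setReg] using hg

/-- A bound for the running time of the dispatching of the branches. -/
def dispatchTime : List (List (Stp k)) → ℕ
  | [] => 0
  | b :: l => 92 * b.length + 9 + dispatchTime l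

theorem dispatch_writesOnly (i : ℕ) (l : List (List (Stp k))) :
    (dispatch i l).WritesOnly {r | (1 ≤ r ∧ r ≤ k) ∨ (k + 10 ≤ r ∧ r ≤ k + 15)} := by
  induction l generalizing i with
  | nil => trivial
  | cons b l ih =>
    exact ⟨by simp [Prog.WritesOnly, rC, rg], ⟨branchProg_writesOnly b, trivial⟩, ih _⟩

theorem dispatch_skip (hi : ∀ j, i ≤ j → s.reg (rI k) ≠ j) (l : List (List (Stp k)))
    (hw : i + l.length < 2 ^ w) :
    Ex w (dispatch i l) s (dispatchTime l) (SameOutside {rC k} s) := by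
  induction l generalizing i s with
  | nil => exact Ex.skip .refl
  | cons b l ih =>
    simp only [List.length_cons] at hw
    refine Ex.seq (T₁ := 1) (T₂ := 3 + dispatchTime l) (Ex.const ?_)
      (by simp only [dispatchTime]; omega)
    rw [Nat.mod_eq_of_lt (by omega)]
    have h1 : SameOutside {rC k} s (s.setReg (rC k) i) := .setReg (by simp)
    refine Ex.seq (T₁ := 1) (T₂ := dispatchTime l) (Ex.ite (T₁ := 0) (fun h => ?_) (fun h => ?_)
      (by omega)) (by omega)
    · simp [Test.holds, State.setReg] at h
      exact absurd h (hi i le_rfl)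
    · refine Ex.skip ((ih (i := i + 1) (fun j hj => ?_) (by omega)).mono le_rfl
        fun s' hs' => h1.trans hs')
      rw [h1.2 _ (by simp)]
      exact hi j (by omega)

theorem BranchDone.of_same {W : Set ℕ} {x : ℕ} {b : List (Stp k)} (h : BranchDone D x b s)
    (hs : SameOutside W s s') (hW : ∀ r ∈ W, k < r ∧ r ≠ rOK k) : BranchDone D x b s' := by
  unfold BranchDone
  rw [hs.asg fun r hr => (hW r hr).1, hs.2 (rOK k) fun hr => (hW _ hr).2 rfl]
  exact h

theorem dispatch_spec (hD : D.Valid w) (hs : Holds k D s) (l : List (List (Stp k)))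
    (hl : ∀ b ∈ l, Ordered ∅ b ∧ known ∅ b = Finset.univ) (hOK : s.reg (rOK k) = 1)
    (hx : s.reg (rX0 k) < 2 ^ w) {i : ℕ} (hi : i ≤ s.reg (rI k)) (hw : i + l.length < 2 ^ w) :
    Ex w (dispatch i l) s (dispatchTime l) fun s' =>
      ∀ b, l[s.reg (rI k) - i]? = some b → BranchDone D (s.reg (rX0 k)) b s' := by
  induction l generalizing i s with
  | nil => exact Ex.skip (by simp)
  | cons b l ih =>
    simp only [List.length_cons] at hw
    refine Ex.seq (T₁ := 1) (T₂ := 92 * b.length + 7 + dispatchTime l) (Ex.const ?_)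
      (by simp only [dispatchTime]; omega)
    rw [Nat.mod_eq_of_lt (by omega)]
    have h1 : SameOutside {rC k} s (s.setReg (rC k) i) := .setReg (by simp)
    set s₁ := s.setReg (rC k) i with hs₁
    have hH₁ : Holds k D s₁ := hs.of_same h1 (by intro r; simp [sampRegs, rC, rg]; omega)
    have eI : s₁.reg (rI k) = s.reg (rI k) := h1.2 _ (by simp)
    have eX : s₁.reg (rX0 k) = s.reg (rX0 k) := h1.2 _ (by simp)
    have eO : s₁.reg (rOK k) = 1 := (h1.2 _ (by simp)).trans hOK
    have eC : s₁.reg (rC k) = i := by simp [hs₁, State.setReg]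
    refine Ex.seq (T₁ := 92 * b.length + 6) (T₂ := dispatchTime l)
      (Ex.ite (T₁ := 92 * b.length + 5) (fun h => ?_) (fun h => ?_) (by omega)) (by omega)
    · have hIi : s.reg (rI k) = i := by simpa [Test.holds, eI, eC] using h
      refine ((branchProg_spec hD hH₁ b (hl b (by simp)).1 (hl b (by simp)).2 eO
        (by rw [eX]; exact hx)).frame (branchProg_writesOnly b)).mono le_rfl ?_
      rintro s₂ ⟨h2, h3⟩
      refine (dispatch_skip (i := i + 1) (fun j hj => ?_) l (by omega)).mono le_rfl
        fun s' hs' b' hb' => ?_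
      · rw [h3.2 _ (by simp [rI, rg]; omega), eI]; omega
      · rw [hIi] at hb'
        obtain rfl : b = b' := by simpa using hb'
        rw [eX] at h2
        exact h2.of_same hs' (by simp [rC, rOK, rg]; omega)
    · have hIi : s.reg (rI k) ≠ i := by simpa [Test.holds, eI, eC] using h
      refine Ex.skip ((ih hH₁ (fun b hb => hl b (by simp [hb])) eO (by rw [eX]; exact hx)
        (i := i + 1) (by rw [eI]; omega) (by omega)).mono le_rfl fun s' hs' b' hb' => ?_)
      rw [eX] at hs'
      refine hs' b' ?_
      rw [eI]
      rw [show s.reg (rI k) - i = s.reg (rI k) - (i + 1) + 1 by omega] at hb'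
      simpa using hb'

/-- A sequence of checks. -/
theorem seqAll_spec {α : Type*} {f : α → Prog} {C : α → Prop} {T : ℕ} (hs : Holds k D s)
    (hK : ∀ v : Fin k, s.asg k v ≤ D.n) (l : List α)
    (hf : ∀ a ∈ l, ∀ s' : State, Holds k D s' → s'.asg k = s.asg k →
      Ex w (f a) s' T fun s'' => (s''.reg (rOK k) = 1 ↔ s'.reg (rOK k) = 1 ∧ C a) ∧
        SameOutside (chkRegs k) s' s'') :
    Ex w (seqAll f l) s ((T + 1) * l.length) fun s' =>
      (s'.reg (rOK k) = 1 ↔ s.reg (rOK k) = 1 ∧ ∀ a ∈ l, C a) ∧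
        SameOutside (chkRegs k) s s' := by
  induction l generalizing s with
  | nil => exact Ex.skip ⟨by simp, .refl⟩
  | cons a l ih =>
    refine Ex.seq (T₁ := T) (T₂ := (T + 1) * l.length) ?_
      (by simp only [List.length_cons]; ring_nf; omega)
    refine (hf a (by simp) s hs rfl).mono le_rfl ?_
    rintro s₁ ⟨h1, h2⟩
    have ha : s₁.asg k = s.asg k := h2.asg (by simp [chkRegs]; omega)
    refine (ih (hs.of_same h2 (by intro r; simp [chkRegs, sampRegs]; omega)) (by rw [ha]; exact hK)
      fun a ha' s' hs' hs'' => hf a (by simp [ha']) s' hs' (hs''.trans ha)).mono le_rfl ?_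
    rintro s₂ ⟨h3, h4⟩
    refine ⟨?_, h2.trans h4⟩
    rw [h3, h1]
    simp [and_assoc]

theorem adjCheck_spec (hD : D.Valid w) (hs : Holds k D s) (hK : ∀ v : Fin k, s.asg k v ≤ D.n)
    (e : Fin k × Fin k) :
    Ex w (adjCheck e) s 11 fun s' => (s'.reg (rOK k) = 1 ↔
      s.reg (rOK k) = 1 ∧ D.adj (s.asg k e.1) (s.asg k e.2) ≠ 0) ∧
        SameOutside (chkRegs k) s s' := by
  have hu := e.1.isLt
  have hv := e.2.isLt
  have hr := D.row_lt (hK e.1) (hK e.2)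
  have hf := hD.fits
  have h0 : Ex w (block [.arith .mul (rA k) (e.1 + 1) (rN1 k),
      .arith .add (rA k) (rA k) (e.2 + 1), .arith .add (rA k) (rAdj k) (rA k),
      .load (rY k) (rA k)]) s 8
      fun s' => s'.reg (rY k) = D.adj (s.asg k e.1) (s.asg k e.2) := by
    refine Ex.block (by simp [Instr.IsDet]) ?_ (by simp)
    have h1 : (e.2 : ℕ) + 1 ≠ rA k := by simp [rA, rg]; omega
    unfold State.asg at hr ⊢
    simp [Instr.detExec, State.setReg, Op.eval, hs.mem, hs.N1, hs.adj, Data.adj,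
      Function.update_of_ne h1]
    rw [Nat.mod_eq_of_lt (by omega)]
  refine Ex.seq (T₁ := 8) (T₂ := 2) ?_ (by omega)
  refine (h0.frame (W := {rY k, rA k}) (block_writesOnly (by simp [Prog.WritesOnly]))).mono
    le_rfl ?_
  rintro s₁ ⟨h1, h2⟩
  refine (failIf_spec _).mono le_rfl ?_
  rintro s₂ ⟨h3, h4⟩
  refine ⟨?_, SameOutside.trans ⟨h2.1, fun r hr => h2.2 r ?_⟩ ⟨h4.1, fun r hr => h4.2 r ?_⟩⟩
  · have e0 : s₁.reg (rZero k) = 0 := by rw [h2.2 _ (by simp)]; exact hs.zero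
    have e1 : s₁.reg (rOK k) = s.reg (rOK k) := h2.2 _ (by simp)
    rw [h3, e1]
    simp [Test.holds, h1, e0]
  · simp [chkRegs, rY, rA, rg] at hr ⊢; omega
  · simp [chkRegs, rOK, rg] at hr ⊢; omega

theorem neCheck_spec (e : Fin k × Fin k) :
    Ex w (neCheck e) s 2 fun s' => (s'.reg (rOK k) = 1 ↔
      s.reg (rOK k) = 1 ∧ s.asg k e.1 ≠ s.asg k e.2) ∧ SameOutside (chkRegs k) s s' := by
  refine (failIf_spec _).mono le_rfl ?_
  rintro s₂ ⟨h3, h4⟩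
  refine ⟨?_, ⟨h4.1, fun r hr => h4.2 r ?_⟩⟩
  · rw [h3]
    simp [Test.holds, State.asg]
  · simp [chkRegs, rOK, rg] at hr ⊢; omega

/-- A bound for the running time of decoding. -/
noncomputable def decodeTime (P : Digraph (Fin k)) (fam : List (List (Stp k))) : ℕ :=
  dispatchTime fam + 12 * (edgeList P).length + 3 * (neList k).length + 9

theorem seqAll_writesOnly {α : Type*} {W : Set ℕ} {f : α → Prog} {l : List α}
    (h : ∀ a ∈ l, (f a).WritesOnly W) : (seqAll f l).WritesOnly W := by
  induction l with
  | nil => trivial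
  | cons a l ih => exact ⟨h a (by simp), ih fun b hb => h b (by simp [hb])⟩

theorem decode_writesOnly (P : Digraph (Fin k)) (fam : List (List (Stp k))) :
    (decode P fam).WritesOnly (decRegs k) := by
  refine ⟨block_writesOnly ?_, (dispatch_writesOnly 0 fam).mono ?_, seqAll_writesOnly ?_,
    seqAll_writesOnly ?_⟩
  · simp [Prog.WritesOnly, decRegs, rOK, rI, rX0, rg]
  · intro r; simp [decRegs]; omega
  · exact fun e _ => ⟨block_writesOnly (by simp [Prog.WritesOnly, decRegs, rA, rY, rg]),
      (failIf_writesOnly _).mono chkRegs_subset⟩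
  · exact fun e _ => (failIf_writesOnly _).mono chkRegs_subset

theorem decode_spec (hD : D.Valid w) (hs : Holds k D s) {fam : List (List (Stp k))}
    (hfam : ∀ b ∈ fam, Ordered ∅ b ∧ known ∅ b = Finset.univ) (hne : fam ≠ [])
    (hB : s.reg (rB k) = fam.length) (hBw : fam.length < 2 ^ w) (hR : s.reg (rR k) < 2 ^ w) :
    Ex w (decode P fam) s (decodeTime P fam) fun s' =>
      ((s'.reg (rOK k) = 1 ↔ IsCode D P fam (s.reg (rR k)) (s'.asg k)) ∧
        ∀ g, IsCode D P fam (s.reg (rR k)) g → g = s'.asg k) ∧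
      SameOutside (decRegs k) s s' := by
  refine Ex.frame ?_ (decode_writesOnly P fam)
  have hpos : 0 < fam.length := List.length_pos_iff.mpr hne
  have hf := hD.fits
  have hone : 1 % 2 ^ w = 1 := Nat.mod_eq_of_lt (by omega)
  refine Ex.seq (T₁ := 6)
    (T₂ := dispatchTime fam + 12 * (edgeList P).length + 3 * (neList k).length + 2) ?_
    (by unfold decodeTime; omega)
  have h0 : Ex w (block [.const (rOK k) 1, .arith .mod (rI k) (rR k) (rB k),
      .arith .div (rX0 k) (rR k) (rB k)]) s 6 fun s' => s'.reg (rOK k) = 1 ∧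
        s'.reg (rI k) = s.reg (rR k) % fam.length ∧
        s'.reg (rX0 k) = s.reg (rR k) / fam.length := by
    refine Ex.block (by simp [Instr.IsDet]) ?_ (by simp)
    simp [Instr.detExec, State.setReg, Op.eval, hB, hone]
  refine (h0.frame (W := {rOK k, rI k, rX0 k})
    (block_writesOnly (by simp [Prog.WritesOnly]))).mono le_rfl ?_
  rintro s₁ ⟨⟨h1, h2, h3⟩, h4⟩
  have hH₁ : Holds k D s₁ := hs.of_same h4 (by intro r; simp [sampRegs, rOK, rI, rX0, rg]; omega)
  refine Ex.seq (T₁ := dispatchTime fam)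
    (T₂ := 12 * (edgeList P).length + 3 * (neList k).length + 1) ?_ (by omega)
  refine ((dispatch_spec hD hH₁ fam hfam h1
    (by rw [h3]; exact (Nat.div_le_self _ _).trans_lt hR) (Nat.zero_le _)
    (by simpa using hBw)).frame (dispatch_writesOnly 0 fam)).mono le_rfl ?_
  rintro s₂ ⟨h5, h6⟩
  have hH₂ : Holds k D s₂ := hH₁.of_same h6 (by intro r; simp [sampRegs]; omega)
  have hlt : s.reg (rR k) % fam.length < fam.length := Nat.mod_lt _ hpos
  set b := fam[s.reg (rR k) % fam.length] with hb
  have hb' : fam[s.reg (rR k) % fam.length]? = some b := List.getElem?_eq_getElem hlt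
  obtain ⟨h7, h8, h9⟩ := h5 b (by rw [h2]; simpa using hb')
  refine Ex.seq (T₁ := 12 * (edgeList P).length) (T₂ := 3 * (neList k).length) ?_ (by omega)
  refine (seqAll_spec (T := 11) (C := fun e : Fin k × Fin k =>
    D.adj (s₂.asg k e.1) (s₂.asg k e.2) ≠ 0) hH₂ h7 (edgeList P) fun e _ s' hs' ha => ?_).mono
      le_rfl ?_
  · rw [← ha]
    exact adjCheck_spec hD hs' (by rw [ha]; exact h7) e
  rintro s₃ ⟨h10, h11⟩
  have ha₃ : s₃.asg k = s₂.asg k := h11.asg (by simp [chkRegs]; omega)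
  refine (seqAll_spec (T := 2) (D := D) (C := fun e : Fin k × Fin k =>
    s₂.asg k e.1 ≠ s₂.asg k e.2)
    (hH₂.of_same h11 (by intro r; simp [chkRegs, sampRegs]; omega)) (by rw [ha₃]; exact h7)
    (neList k) fun e _ s' hs' ha => ?_).mono le_rfl ?_
  · rw [← ha₃, ← ha]
    exact neCheck_spec e
  rintro s₄ ⟨h12, h13⟩
  have ha₄ : s₄.asg k = s₂.asg k := by rw [h13.asg (by simp [chkRegs]; omega), ha₃]
  rw [ha₄]
  refine ⟨?_, fun g hg => h9 g ?_⟩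
  · rw [h12, h10, h8, h3]
    simp only [IsCode, Emb, edgeList, neList, Finset.mem_toList, Finset.mem_filter,
      Finset.mem_univ, true_and, Prod.forall, and_assoc]
    simp [hb', h7]
  · obtain ⟨⟨b', hb'', hg'⟩, -⟩ := hg
    rw [hb'] at hb''
    obtain rfl : b = b' := by simpa using hb''
    rw [h3]
    exact hg'

end

section
variable {k n : ℕ} {D : Data} {G : Digraph (Fin n)} {P : Digraph (Fin k)}

/-! ### Each embedding has exactly one code -/

/-- The tables in `D` describe the data graph `G`. -/
structure Data.Rep (D : Data) (G : Digraph (Fin n)) : Prop where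
  n_eq : D.n = n
  lam_le : D.lam ≤ D.n
  q_le : D.q ≤ D.n
  adj : ∀ u v, u ≤ n → v ≤ n →
    (D.adj u v ≠ 0 ↔ ∃ u' v' : Fin n, u = u' + 1 ∧ v = v' + 1 ∧ G.Adj u' v')
  edge : ∀ u v : Fin n, G.Adj u v → ∃ r < D.m, D.eu r = u + 1 ∧ D.ev r = v + 1
  edge_inj : ∀ r < D.m, ∀ r' < D.m, D.eu r = D.eu r' → D.ev r = D.ev r' → r = r'
  out : ∀ u v : Fin n, G.Adj u v → ∃ r < D.lam, D.out (u + 1) r = v + 1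
  out_inj : ∀ u ≤ n, ∀ r ≤ n, ∀ r' ≤ n, D.out u r = D.out u r' → D.out u r ≠ 0 → r = r'
  light : ∀ u ≤ n, ∀ r ≤ n, D.out u r ≠ 0 → D.out u D.q = 0 → r < D.q
  heavy : ∀ u : Fin n, D.out (u + 1) D.q ≠ 0 → ∃ r < D.q, D.hvy r = u + 1
  heavy_out : ∀ r < D.q, D.hvy r ≠ 0 → D.out (D.hvy r) D.q ≠ 0
  heavy_inj : ∀ r < D.q, ∀ r' < D.q, D.hvy r = D.hvy r' → D.hvy r ≠ 0 → r = r'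

/-- The edges used in a step are edges of the pattern. -/
def Stp.OnP (P : Digraph (Fin k)) : Stp k → Prop
  | .edge u v => P.Adj u v
  | .lam u v => P.Adj u v
  | .heavy _ => True
  | .light t h => P.Adj t h

/-- The step applies to embeddings that map exactly the vertices in `H` to vertices of out-degree
above `q`. -/
def Stp.Compat (H : Fin k → Prop) : Stp k → Prop
  | .heavy t => H t
  | .light t _ => ¬ H t
  | _ => True

/-- The number of codes in a branch. -/
def prodRad (D : Data) (b : List (Stp k)) : ℕ := (b.map (Stp.rad D)).prod

/-- The branches in `fam` each determine the whole embedding, each embedding belongs to exactly one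
of them, and the number of codes in each of them is `m ^ α * lam ^ β * q ^ γ`. -/
structure FamOK (P : Digraph (Fin k)) (fam : List (List (Stp k))) (α β γ : ℕ) : Prop where
  ordered : ∀ b ∈ fam, Ordered ∅ b ∧ known ∅ b = Finset.univ
  onP : ∀ b ∈ fam, ∀ s ∈ b, s.OnP P
  uniq : ∀ H : Fin k → Prop, ∃! i : ℕ, ∃ b : List (Stp k), fam[i]? = some b ∧ ∀ s ∈ b, s.Compat H
  prod : ∀ b ∈ fam, ∀ D, prodRad D b = D.m ^ α * D.lam ^ β * D.q ^ γ

/-- An embedding of the pattern into the data graph. -/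
def IsEmb (P : Digraph (Fin k)) (G : Digraph (Fin n)) (f : Fin k → Fin n) : Prop :=
  (∀ u v, P.Adj u v → G.Adj (f u) (f v)) ∧ Function.Injective f

/-- Every vertex of the pattern is on an edge. -/
def NoIsolated (P : Digraph (Fin k)) : Prop := ∀ u, ∃ v, P.Adj u v ∨ P.Adj v u

theorem Data.Rep.emb_of_isEmb (hR : D.Rep G) {f : Fin k → Fin n} (hf : IsEmb P G f) :
    Emb D P fun u => f u + 1 := by
  refine ⟨fun u => by rw [hR.n_eq]; exact (f u).isLt, fun u v huv => ?_, fun u v huv h => ?_⟩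
  · exact (hR.adj _ _ (f u).isLt (f v).isLt).mpr
      ⟨_, _, rfl, rfl, hf.1 u v huv⟩
  · exact huv (hf.2 (Fin.ext (by simpa using h)))

theorem Data.Rep.exists_isEmb (hR : D.Rep G) (hP : NoIsolated P) {g : Fin k → ℕ}
    (hg : Emb D P g) : ∃ f : Fin k → Fin n, IsEmb P G f ∧ g = fun u => (f u : ℕ) + 1 := by
  have h1 := hg.1
  rw [hR.n_eq] at h1
  have h2 : ∀ u v, P.Adj u v → ∃ u' v' : Fin n, g u = u' + 1 ∧ g v = v' + 1 ∧ G.Adj u' v' :=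
    fun u v huv => (hR.adj _ _ (h1 u) (h1 v)).mp (hg.2.1 u v huv)
  have h3 : ∀ u, ∃ u' : Fin n, g u = u' + 1 := by
    intro u
    obtain ⟨v, hv | hv⟩ := hP u
    · obtain ⟨u', v', h, -⟩ := h2 _ _ hv; exact ⟨u', h⟩
    · obtain ⟨v', u', -, h, -⟩ := h2 _ _ hv; exact ⟨u', h⟩
  choose f hf using h3
  refine ⟨f, ⟨fun u v huv => ?_, fun u v huv => ?_⟩, funext hf⟩
  · obtain ⟨u', v', e1, e2, h⟩ := h2 _ _ huv
    have e1' : f u = u' := Fin.ext (by have := hf u; omega)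
    have e2' : f v = v' := Fin.ext (by have := hf v; omega)
    rwa [e1', e2']
  · by_contra hne
    exact hg.2.2 u v hne (by rw [hf, hf, huv])

theorem Stp.exists_digit (hR : D.Rep G) {f : Fin k → Fin n} (hf : IsEmb P G f) {c : Stp k}
    (hc : c.OnP P) (hH : c.Compat fun t => D.out (f t + 1) D.q ≠ 0) :
    ∃ d < c.rad D, c.Rel D d fun u => f u + 1 := by
  have hn := hR.n_eq
  have hlam := hR.lam_le
  cases c with
  | edge u v =>
    obtain ⟨r, hr, h1, h2⟩ := hR.edge _ _ (hf.1 u v hc)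
    exact ⟨r, hr, h1.symm, h2.symm⟩
  | lam u v =>
    obtain ⟨r, hr, h1⟩ := hR.out _ _ (hf.1 u v hc)
    exact ⟨r, hr, h1.symm⟩
  | heavy t =>
    obtain ⟨r, hr, h1⟩ := hR.heavy (f t) hH
    exact ⟨r, hr, h1.symm⟩
  | light t h =>
    obtain ⟨r, hr, h1⟩ := hR.out _ _ (hf.1 t h hc)
    have h0 : D.out (f t + 1) D.q = 0 := by simpa [Compat] using hH
    exact ⟨r, hR.light (f t + 1) (f t).isLt r (by omega) (by omega) h0, h1.symm, h0⟩

theorem Stp.Rel.digit_unique (hR : D.Rep G) {f : Fin k → Fin n} {c : Stp k} {d d' : ℕ}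
    (hd : d < c.rad D) (hd' : d' < c.rad D) (h : c.Rel D d fun u => f u + 1)
    (h' : c.Rel D d' fun u => f u + 1) : d = d' := by
  have hn := hR.n_eq
  have hlam := hR.lam_le
  have hq := hR.q_le
  cases c with
  | edge u v =>
    exact hR.edge_inj d hd d' hd' (h.1.symm.trans h'.1) (h.2.symm.trans h'.2)
  | lam u v =>
    simp only [rad] at hd hd'
    simp only [Rel] at h h'
    exact hR.out_inj (f u + 1) (f u).isLt d (by omega) d' (by omega) (by omega) (by omega)
  | heavy t =>
    simp only [Rel] at h h'
    exact hR.heavy_inj d hd d' hd' (by omega) (by omega)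
  | light t y =>
    simp only [rad] at hd hd'
    simp only [Rel] at h h'
    exact hR.out_inj (f t + 1) (f t).isLt d (by omega) d' (by omega) (by omega) (by omega)

theorem Stp.Rel.compat (hR : D.Rep G) {f : Fin k → Fin n} {c : Stp k} {d : ℕ}
    (hd : d < c.rad D) (h : c.Rel D d fun u => f u + 1) :
    c.Compat fun t => D.out (f t + 1) D.q ≠ 0 := by
  cases c with
  | edge u v => trivial
  | lam u v => trivial
  | heavy t =>
    simp only [Rel] at h
    simp only [Compat]
    rw [h]
    exact hR.heavy_out d hd (by omega)
  | light t y => exact not_not.mpr h.2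

theorem BRel.compat (hR : D.Rep G) {f : Fin k → Fin n} {b : List (Stp k)} {x : ℕ}
    (hb : ∀ s ∈ b, 0 < s.rad D) (h : BRel D (fun u => f u + 1) x b) :
    ∀ s ∈ b, s.Compat fun t => D.out (f t + 1) D.q ≠ 0 := by
  induction b generalizing x with
  | nil => simp
  | cons c b ih =>
    intro s hs
    rcases List.mem_cons.mp hs with rfl | hs
    · exact h.1.compat hR (Nat.mod_lt _ (hb _ (by simp)))
    · exact ih (fun s hs => hb s (by simp [hs])) h.2 s hs

theorem exists_bRel (hR : D.Rep G) {f : Fin k → Fin n} (hf : IsEmb P G f) {b : List (Stp k)}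
    (hb : ∀ s ∈ b, s.OnP P) (hH : ∀ s ∈ b, s.Compat fun t => D.out (f t + 1) D.q ≠ 0) :
    ∃ x < prodRad D b, BRel D (fun u => f u + 1) x b := by
  induction b with
  | nil => exact ⟨0, by simp [prodRad], trivial⟩
  | cons c b ih =>
    obtain ⟨x, hx, h⟩ := ih (fun s hs => hb s (by simp [hs])) fun s hs => hH s (by simp [hs])
    obtain ⟨d, hd, h'⟩ := c.exists_digit hR hf (hb c (by simp)) (hH c (by simp))
    refine ⟨d + c.rad D * x, ?_, ?_⟩
    · simp only [prodRad, List.map_cons, List.prod_cons] at hx ⊢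
      nlinarith
    · refine ⟨?_, ?_⟩
      · rwa [Nat.add_mul_mod_self_left, Nat.mod_eq_of_lt hd]
      · rwa [Nat.add_mul_div_left _ _ (by omega), Nat.div_eq_of_lt hd, zero_add]

theorem BRel.unique (hR : D.Rep G) {f : Fin k → Fin n} {b : List (Stp k)} {x x' : ℕ}
    (hx : x < prodRad D b) (hx' : x' < prodRad D b) (h : BRel D (fun u => f u + 1) x b)
    (h' : BRel D (fun u => f u + 1) x' b) : x = x' := by
  induction b generalizing x x' with
  | nil => simp [prodRad] at hx hx'; omega
  | cons c b ih =>
    simp only [prodRad, List.map_cons, List.prod_cons] at hx hx'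
    have hpos : 0 < c.rad D := Nat.pos_of_ne_zero fun h0 => by simp [h0] at hx
    have h1 := h.1.digit_unique hR (Nat.mod_lt _ hpos) (Nat.mod_lt _ hpos) h'.1
    have h2 := ih (Nat.div_lt_of_lt_mul hx) (Nat.div_lt_of_lt_mul hx') h.2 h'.2
    rw [← Nat.mod_add_div x (c.rad D), ← Nat.mod_add_div x' (c.rad D), h1, h2]

/-- The number of codes. All the branches have equally many, so that the first one
stands for any. -/
def numCodes (D : Data) (fam : List (List (Stp k))) : ℕ := fam.length * prodRad D (fam.headD [])

variable {fam : List (List (Stp k))} {α β γ : ℕ}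

theorem FamOK.ne_nil (hF : FamOK P fam α β γ) : fam ≠ [] := by
  rintro rfl
  obtain ⟨i, ⟨b, hb, -⟩, -⟩ := hF.uniq fun _ => True
  simp at hb

theorem FamOK.prodRad_eq (hF : FamOK P fam α β γ) {b : List (Stp k)} (hb : b ∈ fam) :
    prodRad D b = prodRad D (fam.headD []) := by
  rw [hF.prod b hb]
  cases fam with
  | nil => exact absurd rfl hF.ne_nil
  | cons c l => rw [List.headD_cons, hF.prod c (by simp)]

theorem FamOK.numCodes_eq (hF : FamOK P fam α β γ) :
    numCodes D fam = fam.length * (D.m ^ α * D.lam ^ β * D.q ^ γ) := by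
  rw [numCodes]
  cases fam with
  | nil => exact absurd rfl hF.ne_nil
  | cons c l => rw [List.headD_cons, hF.prod c (by simp)]

/-- An embedding has exactly one code: the branch is determined by the vertices that are mapped to
vertices of out-degree above `q`, and the digits by the injectivity of the tables. -/
theorem existsUnique_isCode (hF : FamOK P fam α β γ) (hR : D.Rep G)
    (hpos : ∀ s : Stp k, 0 < s.rad D) {f : Fin k → Fin n} (hf : IsEmb P G f) :
    ∃! x, x < numCodes D fam ∧ IsCode D P fam x fun u => f u + 1 := by
  have hlen : 0 < fam.length := List.length_pos_iff.mpr hF.ne_nil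
  obtain ⟨i, ⟨b, hb, hc⟩, huniq⟩ := hF.uniq fun t => D.out (f t + 1) D.q ≠ 0
  obtain ⟨hi, rfl⟩ := List.getElem?_eq_some_iff.mp hb
  have hmem : fam[i] ∈ fam := List.getElem_mem hi
  obtain ⟨x, hx, hB⟩ := exists_bRel hR hf (hF.onP _ hmem) hc
  rw [hF.prodRad_eq hmem] at hx
  have hmod : (i + fam.length * x) % fam.length = i := by
    rw [Nat.add_mul_mod_self_left, Nat.mod_eq_of_lt hi]
  have hdiv : (i + fam.length * x) / fam.length = x := by
    rw [Nat.add_mul_div_left _ _ hlen, Nat.div_eq_of_lt hi, zero_add]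
  refine ⟨i + fam.length * x, ⟨?_, ⟨fam[i], ?_, ?_⟩, hR.emb_of_isEmb hf⟩, ?_⟩
  · rw [numCodes]; nlinarith
  · rw [hmod, hb]
  · rwa [hdiv]
  · rintro y ⟨hy, ⟨b', hb', hB'⟩, -⟩
    have h1 : y % fam.length = i :=
      huniq _ ⟨b', hb', hB'.compat hR fun s _ => hpos s⟩
    rw [h1, hb] at hb'
    obtain rfl : fam[i] = b' := by simpa using hb'
    have h2 : y / fam.length = x := by
      refine BRel.unique hR ?_ ?_ hB' hB
      · rw [hF.prodRad_eq hmem]; exact Nat.div_lt_of_lt_mul hy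
      · rwa [hF.prodRad_eq hmem]
    rw [← Nat.mod_add_div y fam.length, h1, h2]

end

section
variable {k n w : ℕ} {D : Data} {G : Digraph (Fin n)} {P : Digraph (Fin k)}
  {fam : List (List (Stp k))} {α β γ : ℕ} {s s' : State}

/-- A code determines the embedding. -/
theorem BRel.asg_unique {g g' : Fin k → ℕ} {K : Finset (Fin k)} {b : List (Stp k)} {x : ℕ}
    (hb : Ordered K b) (h : BRel D g x b) (h' : BRel D g' x b) (hK : ∀ v ∈ K, g v = g' v) :
    ∀ v ∈ known K b, g v = g' v := by
  induction b generalizing K x with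
  | nil => exact hK
  | cons c b ih =>
    refine ih hb.2 h.2 h'.2 fun v hv => ?_
    rcases Finset.mem_union.mp hv with hv | hv
    · exact hK v hv
    · have h1 := h.1
      have h2 := h'.1
      have h3 := hb.1
      cases c with
      | edge u u' =>
        simp only [Stp.Rel, Stp.sets, Finset.mem_insert, Finset.mem_singleton] at h1 h2 hv
        rcases hv with rfl | rfl <;> omega
      | lam u u' =>
        simp only [Stp.Rel, Stp.sets, Finset.mem_singleton, Stp.needs,
          Finset.singleton_subset_iff] at h1 h2 h3 hv
        rw [hv, h1, h2, hK u h3]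
      | heavy t =>
        simp only [Stp.Rel, Stp.sets, Finset.mem_singleton] at h1 h2 hv
        rw [hv, h1, h2]
      | light t y =>
        simp only [Stp.Rel, Stp.sets, Finset.mem_singleton, Stp.needs,
          Finset.singleton_subset_iff] at h1 h2 h3 hv
        rw [hv, h1.1, h2.1, hK t h3]

theorem IsCode.asg_unique (hF : FamOK P fam α β γ) {x : ℕ} {g g' : Fin k → ℕ}
    (h : IsCode D P fam x g) (h' : IsCode D P fam x g') : g = g' := by
  obtain ⟨⟨b, hb, hB⟩, -⟩ := h
  obtain ⟨⟨b', hb', hB'⟩, -⟩ := h'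
  obtain rfl : b = b' := by simpa [hb] using hb'
  have hmem := List.mem_of_getElem? hb
  obtain ⟨h1, h2⟩ := hF.ordered b hmem
  funext v
  exact hB.asg_unique h1 hB' (by simp) v (by simp [h2])

open Classical in
/-- There are as many codes of embeddings with a property as there are such embeddings. -/
theorem card_codes (hF : FamOK P fam α β γ) (hR : D.Rep G) (hpos : ∀ s : Stp k, 0 < s.rad D)
    (Q : (Fin k → Fin n) → Prop) :
    ((Finset.range (numCodes D fam)).filter fun x =>
      ∃ f : Fin k → Fin n, (IsEmb P G f ∧ Q f) ∧ IsCode D P fam x fun u => f u + 1).card =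
    (Finset.univ.filter fun f : Fin k → Fin n => IsEmb P G f ∧ Q f).card := by
  symm
  have hex : ∀ f : Fin k → Fin n, IsEmb P G f →
      ∃ x, x < numCodes D fam ∧ IsCode D P fam x fun u => f u + 1 :=
    fun f hf => (existsUnique_isCode hF hR hpos hf).exists
  choose! code hcode using hex
  refine Finset.card_nbij code (fun f hf => ?_) (fun f hf f' hf' h => ?_) (fun x hx => ?_)
  · simp only [Finset.coe_filter, Finset.mem_univ, true_and,
      Finset.mem_range, Set.mem_ofPred_eq] at hf ⊢
    exact ⟨(hcode f hf.1).1, f, hf, (hcode f hf.1).2⟩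
  · simp only [Finset.coe_filter, Finset.mem_univ, true_and, Set.mem_ofPred_eq] at hf hf'
    have h1 := (hcode f hf.1).2
    rw [h] at h1
    have := IsCode.asg_unique hF h1 (hcode f' hf'.1).2
    funext u
    exact Fin.ext (by simpa using congrFun this u)
  · simp only [Finset.coe_filter, Finset.mem_range, Set.mem_ofPred_eq] at hx
    obtain ⟨hx, f, hf, hc⟩ := hx
    refine ⟨f, by simpa using hf, ?_⟩
    exact (existsUnique_isCode hF hR hpos hf.1).unique (hcode f hf.1) ⟨hx, hc⟩

/-! ### The sampling program -/

/-- Computes the number of codes. -/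
def setup (fam : List (List (Stp k))) : Prog :=
  block ([.const (rB k) fam.length, .arith .add (rM k) (rB k) (rZero k)] ++
    (fam.headD []).map (fun c => .arith .mul (rM k) (rM k) c.radReg) ++
    [.const (rT k) 0, .const 0 0])

/-- Returns the decoded embedding, and stops the loop. -/
def succeed (k : ℕ) : Prog :=
  .seq (seqAll (fun u : Fin k => .instr (.arith .sub (u + 1) (u + 1) (rOne k)))
    (List.finRange k)) <|
    block [.const 0 1, .arith .add (rT k) (rM k) (rZero k)]

/-- What is to be done with a random code in `rR`: it is decoded, and if it is invalid, then the
scan of all the codes that started with `0` proceeds to the next one, unless it has found a valid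
one. -/
noncomputable def tryCode (P : Digraph (Fin k)) (fam : List (List (Stp k))) : Prog :=
  .seq (decode P fam) <| .ite (.eq (rOK k) (rOne k)) (succeed k) <|
    .seq (.instr (.arith .add (rR k) (rT k) (rZero k))) <| .seq (decode P fam) <|
      .ite (.eq (rOK k) (rOne k)) .skip (.instr (.arith .add (rT k) (rT k) (rOne k)))

/-- One iteration of the sampling loop. -/
noncomputable def trial (P : Digraph (Fin k)) (fam : List (List (Stp k))) : Prog :=
  .seq (.instr (.rand (rR k) (rM k))) (tryCode P fam)

/-- The sampling loop. Random codes are tried until a valid one is found, or until all the codes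
have been scanned without finding a valid one. -/
noncomputable def sampLoop (P : Digraph (Fin k)) (fam : List (List (Stp k))) : Prog :=
  .loop (.lt (rT k) (rM k)) (trial P fam)

/-- Sampling with the codes given by `fam`. -/
noncomputable def sampWith (P : Digraph (Fin k)) (fam : List (List (Stp k))) : Prog :=
  .seq (setup fam) (sampLoop P fam)

/-- The code is that of an embedding. -/
def ValidCode (D : Data) (P : Digraph (Fin k)) (fam : List (List (Stp k))) (x : ℕ) : Prop :=
  ∃ g, IsCode D P fam x g

/-- The invariant of the sampling loop. -/
structure Head (D : Data) (P : Digraph (Fin k)) (fam : List (List (Stp k))) (s : State) : Prop where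
  holds : Holds k D s
  B : s.reg (rB k) = fam.length
  M : s.reg (rM k) = numCodes D fam
  zero : s.reg 0 = 0
  T_le : s.reg (rT k) ≤ numCodes D fam
  invalid : ∀ x < s.reg (rT k), ¬ ValidCode D P fam x

/-- The state after a successful trial, which has found the embedding `f`. -/
structure Found (f : Fin k → Fin n) (s : State) : Prop where
  T_eq : s.reg (rT k) = s.reg (rM k)
  one : s.reg 0 = 1
  out : ∀ u : Fin k, s.reg (u + 1) = f u

/-- The outcome `s'` of a trial of the code `x`. -/
def Outcome (D : Data) (P : Digraph (Fin k)) (G : Digraph (Fin n)) (fam : List (List (Stp k)))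
    (s : State) (x : ℕ) (s' : State) : Prop :=
  (∃ f : Fin k → Fin n, IsEmb P G f ∧ IsCode D P fam x (fun u => f u + 1) ∧ Found f s') ∨
  (¬ ValidCode D P fam x ∧ Head D P fam s' ∧
    (s'.reg (rT k) = s.reg (rT k) + 1 ∨
      s'.reg (rT k) = s.reg (rT k) ∧ ValidCode D P fam (s.reg (rT k))))

theorem succeed_spec (hs : Holds k D s) (hw : 1 < 2 ^ w) {f : Fin k → Fin n} (hn : n < 2 ^ w)
    (hM : s.reg (rM k) < 2 ^ w) (hf : s.asg k = fun u => (f u : ℕ) + 1) :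
    Ex w (succeed k) s (2 * k + 5) (Found f) := by
  have key : ∀ (l : List (Fin k)) (s : State), s.reg (rOne k) = 1 → l.Nodup →
      (∀ u ∈ l, s.reg (u + 1) = f u + 1) →
      Ex w (seqAll (fun u : Fin k => .instr (.arith .sub (u + 1) (u + 1) (rOne k))) l) s
        (2 * l.length) fun s' => (∀ u ∈ l, s'.reg (u + 1) = f u) ∧
          ∀ r : ℕ, (∀ u ∈ l, r ≠ u + 1) → s'.reg r = s.reg r := by
    intro l
    induction l with
    | nil => exact fun s _ _ _ => Ex.skip ⟨by simp, by simp⟩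
    | cons v l ih =>
      intro s h1 hnd hl
      have hv := v.isLt
      rw [List.nodup_cons] at hnd
      refine Ex.seq (T₁ := 1) (T₂ := 2 * l.length) (Ex.arith ?_)
        (by simp only [List.length_cons]; omega)
      have e : Op.eval w .sub (s.reg (v + 1)) (s.reg (rOne k)) = f v := by
        rw [Op.eval, h1, hl v (by simp)]
        have := (f v).isLt
        rw [show (f v : ℕ) + 1 + (2 ^ w - 1) = f v + 2 ^ w by omega, Nat.add_mod_right]
        exact Nat.mod_eq_of_lt (by omega)
      rw [e]
      have hne : ∀ u ∈ l, (u : ℕ) + 1 ≠ v + 1 := fun u hu h =>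
        hnd.1 (by rwa [show v = u from Fin.ext (by omega)])
      refine (ih (s.setReg (v + 1) (f v)) ?_ hnd.2 fun u hu => ?_).mono le_rfl ?_
      · rw [State.setReg]
        simp only
        rw [Function.update_of_ne (by simp [rOne, rg]; omega), h1]
      · rw [State.setReg]
        simp only
        rw [Function.update_of_ne (hne u hu), hl u (by simp [hu])]
      · rintro s' ⟨h2, h3⟩
        refine ⟨fun u hu => ?_, fun r hr => ?_⟩
        · rcases List.mem_cons.mp hu with rfl | hu
          · rw [h3 _ fun x hx => (hne x hx).symm]
            simp [State.setReg]
          · exact h2 u hu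
        · rw [h3 r fun u hu => hr u (by simp [hu])]
          exact Function.update_of_ne (hr v (by simp)) _ _
  refine Ex.seq (T₁ := 2 * k) (T₂ := 4) ?_ (by omega)
  refine (key (List.finRange k) s hs.one (List.nodup_finRange k)
    fun u _ => congrFun hf u).mono (by simp) ?_
  rintro s₁ ⟨h1, h2⟩
  have hz : s₁.reg (rZero k) = 0 := by
    rw [h2 _ fun u _ => by have := u.isLt; simp [rZero, rg]; omega]; exact hs.zero
  have hM₁ : s₁.reg (rM k) = s.reg (rM k) :=
    h2 _ fun u _ => by have := u.isLt; simp [rM, rg]; omega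
  refine Ex.block (by simp [Instr.IsDet]) ?_ (by simp)
  refine ⟨?_, ?_, fun u => ?_⟩
  · simp [Instr.detExec, State.setReg, Op.eval, hz, hM₁, Nat.mod_eq_of_lt hM, rT, rM, rZero, rg]
  · simp [Instr.detExec, State.setReg, Op.eval, Nat.mod_eq_of_lt hw, rT, rg]
  · have := u.isLt
    have h3 : (u : ℕ) + 1 ≠ k + 1 + 19 := by omega
    simp [Instr.detExec, State.setReg, Op.eval, rT, rg, h1, Function.update_of_ne h3]

/-- The hypotheses on the data, the pattern and the codes under which sampling works. -/
structure Setting (w : ℕ) (D : Data) (G : Digraph (Fin n)) (P : Digraph (Fin k))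
    (fam : List (List (Stp k))) (α β γ : ℕ) : Prop where
  valid : D.Valid w
  rep : D.Rep G
  noIsolated : NoIsolated P
  famOK : FamOK P fam α β γ
  codes_lt : numCodes D fam < 2 ^ w

theorem Setting.numCodes_pos (h : Setting w D G P fam α β γ) : 0 < numCodes D fam := by
  rw [h.famOK.numCodes_eq]
  have := h.valid.m_pos
  have := h.valid.lam_pos
  have := h.valid.q_pos
  have := List.length_pos_iff.mpr h.famOK.ne_nil
  positivity

theorem Setting.length_lt (h : Setting w D G P fam α β γ) : fam.length < 2 ^ w := by
  refine lt_of_le_of_lt ?_ h.codes_lt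
  have := h.numCodes_pos
  rw [numCodes] at this ⊢
  exact Nat.le_mul_of_pos_right _ (Nat.pos_of_mul_pos_left this)

/-- A bound for the running time of the deterministic part of a trial. -/
noncomputable def tryTime (P : Digraph (Fin k)) (fam : List (List (Stp k))) : ℕ :=
  2 * decodeTime P fam + 2 * k + 20

theorem Head.decoded (h : Head D P fam s) {W : Set ℕ} (hs : SameOutside W s s')
    (hW : ∀ r ∈ W, 1 ≤ r ∧ r ≤ k + 17 ∨ r = k + 19 := by
      intro r; simp [decRegs]; omega) (hW' : W ⊆ sampRegs k := by
      intro r; simp [decRegs, sampRegs]; omega) : Head D P fam s' := by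
  have key : ∀ r, (r = 0 ∨ r = k + 18 ∨ r = k + 20 ∨ r = k + 21) → s'.reg r = s.reg r := fun r hr =>
    hs.2 r fun hr' => by have := hW r hr'; omega
  refine ⟨h.holds.of_same hs hW', ?_, ?_, ?_, ?_, ?_⟩
  · rw [key _ (by simp [rB, rg]), h.B]
  · rw [key _ (by simp [rM, rg]), h.M]
  · rw [key _ (by simp), h.zero]
  · rw [key _ (by simp [rT, rg])]; exact h.T_le
  · rw [key _ (by simp [rT, rg])]; exact h.invalid

theorem tryCode_spec (h : Setting w D G P fam α β γ) (hs : Head D P fam s)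
    (hT : s.reg (rT k) < numCodes D fam) {x : ℕ} (hx : x < numCodes D fam) :
    Ex w (tryCode P fam) (s.setReg (rR k) x) (tryTime P fam) (Outcome D P G fam s x) := by
  have hcodes := h.codes_lt
  have hf := h.valid.fits
  have hw1 : 1 < 2 ^ w := by omega
  set s₀ := s.setReg (rR k) x with hs₀
  have h0 : SameOutside {rR k} s s₀ := .setReg (by simp)
  have hH₀ : Head D P fam s₀ := hs.decoded h0 (by simp [rR, rg])
    (by intro r; simp [rR, rg, sampRegs]; omega)
  have eR : s₀.reg (rR k) = x := by simp [hs₀, State.setReg]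
  refine Ex.seq (T₁ := decodeTime P fam) (T₂ := decodeTime P fam + 2 * k + 18) ?_
    (by unfold tryTime; omega)
  refine (decode_spec h.valid hH₀.holds h.famOK.ordered h.famOK.ne_nil hH₀.B h.length_lt
    (by rw [eR]; omega)).mono le_rfl ?_
  rintro s₁ ⟨⟨h1, h2⟩, h3⟩
  rw [eR] at h1 h2
  have hH₁ : Head D P fam s₁ := hH₀.decoded h3
  refine Ex.ite (T₁ := decodeTime P fam + 2 * k + 16) (fun ht => ?_) (fun ht => ?_) (by omega)
  · have hc := h1.mp (by simpa [Test.holds, hH₁.holds.one] using ht)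
    obtain ⟨f, hfe, hfg⟩ := h.rep.exists_isEmb h.noIsolated hc.2
    have hn : n < 2 ^ w := by
      rw [← h.rep.n_eq]
      have hn2 : D.n < D.S := by unfold Data.S Data.N1; nlinarith
      omega
    refine (succeed_spec hH₁.holds hw1 hn (by rw [hH₁.M]; exact hcodes) hfg).mono (by omega)
      fun s' hs' => Or.inl ⟨f, hfe, ?_, hs'⟩
    rw [← hfg]; exact hc
  · have hinv : ¬ ValidCode D P fam x := by
      rintro ⟨g, hg⟩
      rw [h2 g hg] at hg
      have := h1.mpr hg
      simp [Test.holds, hH₁.holds.one, this] at ht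
    refine Ex.seq (T₁ := 1) (T₂ := decodeTime P fam + 5) (Ex.arith ?_) (by omega)
    have eT : s₁.reg (rT k) = s.reg (rT k) := by
      rw [h3.2 _ (by simp [decRegs, rT, rg]; omega), h0.2 _ (by simp)]
    have eop : Op.eval w .add (s₁.reg (rT k)) (s₁.reg (rZero k)) = s.reg (rT k) := by
      rw [Op.eval, hH₁.holds.zero, add_zero, eT, Nat.mod_eq_of_lt (by omega)]
    rw [eop]
    set s₂ := s₁.setReg (rR k) (s.reg (rT k)) with hs₂
    have h4 : SameOutside {rR k} s₁ s₂ := .setReg (by simp)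
    have hH₂ : Head D P fam s₂ := hH₁.decoded h4 (by simp [rR, rg])
      (by intro r; simp [rR, rg, sampRegs]; omega)
    have eR₂ : s₂.reg (rR k) = s.reg (rT k) := by simp [hs₂, State.setReg]
    refine Ex.seq (T₁ := decodeTime P fam) (T₂ := 4) ?_ (by omega)
    refine (decode_spec h.valid hH₂.holds h.famOK.ordered h.famOK.ne_nil hH₂.B h.length_lt
      (by rw [eR₂]; omega)).mono le_rfl ?_
    rintro s₃ ⟨⟨h5, h6⟩, h7⟩
    rw [eR₂] at h5 h6
    have hH₃ : Head D P fam s₃ := hH₂.decoded h7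
    have eT₃ : s₃.reg (rT k) = s.reg (rT k) := by
      rw [h7.2 _ (by simp [decRegs, rT, rg]; omega), h4.2 _ (by simp), eT]
    refine Ex.ite (T₁ := 1) (fun ht => Ex.skip (Or.inr ⟨hinv, hH₃, Or.inr ⟨eT₃, ?_⟩⟩))
      (fun ht => Ex.arith (Or.inr ⟨hinv, ?_, Or.inl ?_⟩)) (by omega)
    · exact ⟨_, h5.mp (by simpa [Test.holds, hH₃.holds.one] using ht)⟩
    · have hinv' : ¬ ValidCode D P fam (s.reg (rT k)) := by
        rintro ⟨g, hg⟩
        rw [h6 g hg] at hg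
        have := h5.mpr hg
        simp [Test.holds, hH₃.holds.one, this] at ht
      rw [Op.eval, hH₃.holds.one, eT₃, Nat.mod_eq_of_lt (by omega)]
      have h8 : SameOutside {rT k} s₃ (s₃.setReg (rT k) (s.reg (rT k) + 1)) := .setReg (by simp)
      refine ⟨hH₃.holds.of_same h8 (by intro r; simp [rT, rg, sampRegs]; omega), ?_, ?_, ?_, ?_, ?_⟩
      · rw [h8.2 _ (by simp), hH₃.B]
      · rw [h8.2 _ (by simp), hH₃.M]
      · rw [h8.2 _ (by simp [rT, rg]), hH₃.zero]
      · simp [State.setReg]; omega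
      · intro y hy
        simp only [State.setReg, Function.update_self] at hy
        rcases Nat.lt_succ_iff_lt_or_eq.mp hy with hy | rfl
        · exact hs.invalid y hy
        · exact hinv'
    · simp [State.setReg, Op.eval, hH₃.holds.one, eT₃,
        Nat.mod_eq_of_lt (show s.reg (rT k) + 1 < 2 ^ w by omega)]

end

section
variable {k n w : ℕ} {D : Data} {G : Digraph (Fin n)} {P : Digraph (Fin k)}
  {fam : List (List (Stp k))} {α β γ : ℕ} {s s' : State}

/-! ### Analysis of the sampling loop -/

theorem avg_uniformBelow {M : ℕ} (hM : 0 < M) (F : ℕ → ℝ≥0∞) :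
    avg (uniformBelow M) F = (M : ℝ≥0∞)⁻¹ * ∑ x ∈ Finset.range M, F x := by
  rw [uniformBelow, dif_neg hM.ne', avg, tsum_eq_sum (s := Finset.range M), Finset.mul_sum]
  · refine Finset.sum_congr rfl fun x hx => ?_
    rw [PMF.uniformOfFinset_apply_of_mem _ hx, Finset.card_range]
  · intro x hx
    rw [PMF.uniformOfFinset_apply_of_notMem _ hx, zero_mul]

theorem wp_le_one {φ : State → ℝ≥0∞} (hφ : ∀ s, φ s ≤ 1) (p : Prog) (s : State) :
    wp w 0 p φ s ≤ 1 := by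
  refine iSup_le fun N => ?_
  generalize (p, s) = c
  induction N generalizing c with
  | zero => simp only [valN]; split <;> simp [hφ]
  | succ N ih =>
    simp only [valN]
    split
    · exact hφ _
    · rw [zero_add]
      exact (avg_mono _ ih).trans (avg_const _ _).le

/-- The value of one iteration of the sampling loop. -/
theorem trial_wp (h : Setting w D G P fam α β γ) (hs : Head D P fam s)
    (hT : s.reg (rT k) < numCodes D fam) :
    ∃ (nxt : ℕ → State) (t : ℕ → ℕ), (∀ x < numCodes D fam, Outcome D P G fam s x (nxt x)) ∧
      (∀ x < numCodes D fam, t x ≤ tryTime P fam) ∧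
      ∀ τ ψ, wp w τ (trial P fam) ψ s = τ + (numCodes D fam : ℝ≥0∞)⁻¹ *
        ∑ x ∈ Finset.range (numCodes D fam), (τ + (t x * τ + ψ (nxt x))) := by
  have key : ∀ x, ∃ (s' : State) (t : ℕ), x < numCodes D fam → Outcome D P G fam s x s' ∧
      t ≤ tryTime P fam ∧
      ∀ τ φ, wp w τ (tryCode P fam) φ (s.setReg (rR k) x) = t * τ + φ s' := by
    intro x
    by_cases hx : x < numCodes D fam
    · obtain ⟨s', ⟨t, ht, hr⟩, ho⟩ := tryCode_spec h hs hT hx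
      exact ⟨s', t, fun _ => ⟨ho, ht, hr⟩⟩
    · exact ⟨s, 0, fun hx' => absurd hx' hx⟩
  choose nxt t hnt using key
  refine ⟨nxt, t, fun x hx => (hnt x hx).1, fun x hx => (hnt x hx).2.1, fun τ ψ => ?_⟩
  rw [trial, wp_seq, wp_instr, Instr.exec, avg_map, hs.M, avg_uniformBelow h.numCodes_pos]
  congr 2
  refine Finset.sum_congr rfl fun x hx => ?_
  rw [(hnt x (Finset.mem_range.mp hx)).2.2]

/-- After a successful trial the loop ends, since `rT` has been set to the number of codes. -/
theorem sampLoop_found {f : Fin k → Fin n} (hs : Found f s) (τ : ℝ≥0∞) (φ : State → ℝ≥0∞) :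
    wp w τ (sampLoop P fam) φ s = τ + φ s := by
  rw [sampLoop, wp_loop, if_neg]
  simp [Test.holds, hs.T_eq]

theorem Head.lt_of_valid (hs : Head D P fam s) {x : ℕ} (hx : x < numCodes D fam)
    (hv : ValidCode D P fam x) : s.reg (rT k) < numCodes D fam := by
  by_contra hc
  exact hs.invalid x (by omega) hv

theorem Head.test (hs : Head D P fam s) :
    (Test.lt (rT k) (rM k)).holds s = decide (s.reg (rT k) < numCodes D fam) := by
  rw [Test.holds, hs.M]

/-- The value of the sampling loop in terms of that after one iteration. -/
theorem sampLoop_wp (h : Setting w D G P fam α β γ) (hs : Head D P fam s)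
    (hT : s.reg (rT k) < numCodes D fam) :
    ∃ (nxt : ℕ → State), (∀ x < numCodes D fam, Outcome D P G fam s x (nxt x)) ∧
      ∀ φ, wp w 0 (sampLoop P fam) φ s = (numCodes D fam : ℝ≥0∞)⁻¹ *
        ∑ x ∈ Finset.range (numCodes D fam), wp w 0 (sampLoop P fam) φ (nxt x) := by
  obtain ⟨nxt, t, h1, -, h3⟩ := trial_wp h hs hT
  refine ⟨nxt, h1, fun φ => ?_⟩
  conv_lhs => rw [sampLoop, wp_loop, if_pos (by rw [hs.test]; simpa using hT), h3]
  simp [sampLoop]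

/-- The iteration inequality for upper bounds of the running time. -/
theorem trial_time_le (h : Setting w D G P fam α β γ) (hs : Head D P fam s)
    (hT : s.reg (rT k) < numCodes D fam) (I : State → ℝ≥0∞) (B : ℕ → ℝ≥0∞)
    (hI : ∀ x < numCodes D fam, ∀ s', Outcome D P G fam s x s' → I s' ≤ B x) :
    1 + wp w 1 (trial P fam) (fun s' => 1 + I s') s ≤ (tryTime P fam + 4 : ℕ) +
      (numCodes D fam : ℝ≥0∞)⁻¹ * ∑ x ∈ Finset.range (numCodes D fam), B x := by
  obtain ⟨nxt, t, h1, h2, h3⟩ := trial_wp h hs hT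
  rw [h3]
  have hM : (numCodes D fam : ℝ≥0∞) ≠ 0 := by exact_mod_cast h.numCodes_pos.ne'
  have hle : ∑ x ∈ Finset.range (numCodes D fam), (1 + (t x * 1 + (1 + I (nxt x)))) ≤
      ∑ x ∈ Finset.range (numCodes D fam), (((tryTime P fam + 2 : ℕ) : ℝ≥0∞) + B x) := by
    refine Finset.sum_le_sum fun x hx => ?_
    have hx' := Finset.mem_range.mp hx
    calc (1 : ℝ≥0∞) + (t x * 1 + (1 + I (nxt x))) = ((t x + 2 : ℕ) : ℝ≥0∞) + I (nxt x) := by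
          push_cast; ring
      _ ≤ _ := by
          gcongr
          · exact h2 x hx'
          · exact hI x hx' _ (h1 x hx')
  refine (add_le_add_right (add_le_add_right (mul_le_mul_right hle _) _) _).trans ?_
  rw [Finset.sum_add_distrib, mul_add, Finset.sum_const, Finset.card_range, nsmul_eq_mul,
    ← mul_assoc, ENNReal.inv_mul_cancel hM (ENNReal.natCast_ne_top _), one_mul]
  push_cast
  apply le_of_eq
  ring

open Classical in
/-- The number of valid codes. -/
noncomputable def numValid (D : Data) (P : Digraph (Fin k)) (fam : List (List (Stp k))) : ℕ :=
  ((Finset.range (numCodes D fam)).filter (ValidCode D P fam)).card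

theorem sum_valid_add (a b : ℝ≥0∞) : open Classical in
    (∑ x ∈ Finset.range (numCodes D fam), if ValidCode D P fam x then a else b) =
      numValid D P fam * a + (numCodes D fam - numValid D P fam : ℕ) * b := by
  classical
  rw [Finset.sum_ite, Finset.sum_const, Finset.sum_const, nsmul_eq_mul, nsmul_eq_mul]
  congr 3
  have := Finset.card_filter_add_card_filter_not (s := Finset.range (numCodes D fam))
    (ValidCode D P fam)
  rw [Finset.card_range] at this
  rw [numValid]
  omega

theorem numValid_le : numValid D P fam ≤ numCodes D fam := by
  classical
  exact (Finset.card_filter_le _ _).trans (Finset.card_range _).le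

/-- If there are valid codes, then one of them is found after `numCodes / numValid` trials on
average. -/
theorem sampLoop_time (h : Setting w D G P fam α β γ) (hv : 0 < numValid D P fam)
    (hs : Head D P fam s) :
    wp w 1 (sampLoop P fam) (fun _ => 0) s ≤
      (tryTime P fam + 5 : ℕ) * (numCodes D fam / numValid D P fam) := by
  classical
  set M := numCodes D fam with hM
  set e := numValid D P fam with he
  set c : ℝ≥0∞ := ((tryTime P fam + 5 : ℕ) : ℝ≥0∞) with hc
  obtain ⟨x₀, hx₀⟩ := Finset.card_pos.mp hv
  simp only [Finset.mem_filter, Finset.mem_range] at hx₀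
  have hM0 : (M : ℝ≥0∞) ≠ 0 := by exact_mod_cast h.numCodes_pos.ne'
  have he0 : (e : ℝ≥0∞) ≠ 0 := by exact_mod_cast hv.ne'
  set J : ℝ≥0∞ := c * (M / e) with hJ
  -- `J` solves `J = c + (1 - e / M) * J`; states that do not occur are assigned `⊤`
  have := wp_loop_le (w := w) (τ := 1) (t := .lt (rT k) (rM k)) (p := trial P fam) (φ := fun _ => 0)
    (fun s => if Head D P fam s then J else if s.reg (rT k) < s.reg (rM k) then ⊤ else 1) ?_ s
  · simpa [hs, sampLoop] using this
  intro s
  by_cases hs : Head D P fam s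
  · have hT := hs.lt_of_valid hx₀.1 hx₀.2
    rw [if_pos hs, if_pos (by rw [hs.test]; simpa using hT)]
    refine (trial_time_le h hs hT _ (fun x => if ValidCode D P fam x then 1 else J) ?_).trans ?_
    · rintro x hx s' (⟨f, hf, hcode, hfound⟩ | ⟨hinv, hh, -⟩)
      · have hh : ¬ Head D P fam s' := fun hh => by
          have := hh.zero
          rw [hfound.one] at this
          exact one_ne_zero this
        rw [if_neg hh, if_neg hfound.T_eq.not_lt, if_pos ⟨_, hcode⟩]
      · rw [if_pos hh, if_neg hinv]
    · rw [sum_valid_add, ← hM, ← he, mul_one]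
      have hJe : (M : ℝ≥0∞)⁻¹ * (e * J) = c := by
        rw [hJ, mul_left_comm (e : ℝ≥0∞), ENNReal.mul_div_cancel he0 (ENNReal.natCast_ne_top _),
          mul_left_comm, ENNReal.inv_mul_cancel hM0 (ENNReal.natCast_ne_top _), mul_one]
      have h1 : (M : ℝ≥0∞)⁻¹ * e ≤ 1 := by
        rw [mul_comm, ← div_eq_mul_inv]
        exact ENNReal.div_le_of_le_mul (by rw [one_mul]; exact_mod_cast numValid_le)
      calc _ = ((tryTime P fam + 4 : ℕ) : ℝ≥0∞) + ((M : ℝ≥0∞)⁻¹ * e +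
            (M : ℝ≥0∞)⁻¹ * ((M - e : ℕ) * J)) := by rw [mul_add]
        _ ≤ ((tryTime P fam + 4 : ℕ) : ℝ≥0∞) + (1 + (M : ℝ≥0∞)⁻¹ * ((M - e : ℕ) * J)) := by gcongr
        _ = c + (M : ℝ≥0∞)⁻¹ * ((M - e : ℕ) * J) := by rw [hc]; push_cast; ring
        _ = (M : ℝ≥0∞)⁻¹ * ((e + (M - e : ℕ)) * J) := by rw [← hJe]; ring
        _ = J := by
          rw [← Nat.cast_add, Nat.add_sub_cancel' numValid_le, ← mul_assoc,
            ENNReal.inv_mul_cancel hM0 (ENNReal.natCast_ne_top _), one_mul]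
  · by_cases hT : s.reg (rT k) < s.reg (rM k)
    · simp [hs, hT]
    · simp [hs, hT, Test.holds]

/-- If there are no valid codes, then the scan ends after `numCodes` trials. -/
theorem sampLoop_time_absent (h : Setting w D G P fam α β γ)
    (hv : ∀ x < numCodes D fam, ¬ ValidCode D P fam x) (hs : Head D P fam s) :
    wp w 1 (sampLoop P fam) (fun _ => 0) s ≤ (tryTime P fam + 5 : ℕ) * numCodes D fam := by
  classical
  set M := numCodes D fam with hM
  set c : ℕ := tryTime P fam + 4 with hc
  have hM0 : (M : ℝ≥0∞) ≠ 0 := by exact_mod_cast h.numCodes_pos.ne'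
  -- without valid codes every trial advances the scan
  have := wp_loop_le (w := w) (τ := 1) (t := .lt (rT k) (rM k)) (p := trial P fam) (φ := fun _ => 0)
    (fun s => if Head D P fam s then ((c * (M - s.reg (rT k)) + 1 : ℕ) : ℝ≥0∞) else ⊤) ?_ s
  · rw [if_pos hs] at this
    refine this.trans ?_
    have hpos := h.numCodes_pos
    norm_cast
    calc _ ≤ c * M + M := by gcongr <;> omega
      _ = _ := by rw [hc]; ring
  intro s
  by_cases hs : Head D P fam s
  · rw [if_pos hs, hs.test]
    by_cases hT : s.reg (rT k) < M
    · rw [if_pos (by simpa using hT)]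
      refine (trial_time_le h hs hT _
        (fun _ => ((c * (M - (s.reg (rT k) + 1)) + 1 : ℕ) : ℝ≥0∞)) ?_).trans ?_
      · rintro x hx s' (⟨f, hf, hcode, hfound⟩ | ⟨hinv, hh, hT' | ⟨-, hT'⟩⟩)
        · exact absurd ⟨_, hcode⟩ (hv x hx)
        · rw [if_pos hh, hT']
        · exact absurd hT' (hv _ hT)
      · rw [Finset.sum_const, Finset.card_range, nsmul_eq_mul, ← hM, ← mul_assoc,
          ENNReal.inv_mul_cancel hM0 (ENNReal.natCast_ne_top _), one_mul]
        norm_cast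
        rw [show M - s.reg (rT k) = M - (s.reg (rT k) + 1) + 1 by omega]
        apply le_of_eq
        rw [hc]; ring
    · rw [if_neg (by simpa using hT), add_zero]
      simp
  · simp [hs]

/-- If there are no valid codes, then the loop ends with a `0` in register `0`. -/
theorem sampLoop_absent (h : Setting w D G P fam α β γ)
    (hv : ∀ x < numCodes D fam, ¬ ValidCode D P fam x) (hs : Head D P fam s) :
    wp w 0 (sampLoop P fam) ({t | DeclaresAbsence t}.indicator 1) s = 1 := by
  have hM0 : (numCodes D fam : ℝ≥0∞) ≠ 0 := by exact_mod_cast h.numCodes_pos.ne'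
  obtain ⟨j, hj⟩ : ∃ j, numCodes D fam - s.reg (rT k) = j := ⟨_, rfl⟩
  induction j generalizing s with
  | zero =>
    rw [sampLoop, wp_loop, if_neg (by rw [hs.test]; simp; omega), zero_add]
    simp [DeclaresAbsence, hs.zero]
  | succ j ih =>
    obtain ⟨nxt, h1, h2⟩ := sampLoop_wp h hs (by omega)
    rw [h2]
    have h3 : ∀ x ∈ Finset.range (numCodes D fam),
        wp w 0 (sampLoop P fam) ({t | DeclaresAbsence t}.indicator 1) (nxt x) = 1 := by
      intro x hx
      have hx' := Finset.mem_range.mp hx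
      rcases h1 x hx' with ⟨f, hf, hcode, hfound⟩ | ⟨hinv, hh, hT' | ⟨-, hT'⟩⟩
      · exact absurd ⟨_, hcode⟩ (hv x hx')
      · exact ih hh (by omega)
      · exact absurd hT' (hv _ (by omega))
    rw [Finset.sum_congr rfl h3, Finset.sum_const, Finset.card_range, nsmul_eq_mul, mul_one,
      ENNReal.inv_mul_cancel hM0 (ENNReal.natCast_ne_top _)]

open Classical in
/-- If there are valid codes, then the loop ends with a uniformly random one of them. -/
theorem sampLoop_found_prob (h : Setting w D G P fam α β γ) (hv : 0 < numValid D P fam)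
    (hs : Head D P fam s) (A : Set State) (Q : (Fin k → Fin n) → Prop)
    (hA : ∀ f s', IsEmb P G f → Found f s' → (s' ∈ A ↔ Q f)) :
    wp w 0 (sampLoop P fam) (A.indicator 1) s =
      (((Finset.range (numCodes D fam)).filter fun x =>
        ∃ f : Fin k → Fin n, (IsEmb P G f ∧ Q f) ∧ IsCode D P fam x fun u => f u + 1).card :
          ℝ≥0∞) / numValid D P fam := by
  set M := numCodes D fam with hM
  set e := numValid D P fam with he
  set a := ((Finset.range M).filter fun x =>
        ∃ f : Fin k → Fin n, (IsEmb P G f ∧ Q f) ∧ IsCode D P fam x fun u => f u + 1).card with ha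
  obtain ⟨x₀, hx₀⟩ := Finset.card_pos.mp hv
  simp only [Finset.mem_filter, Finset.mem_range] at hx₀
  have hM0 : (M : ℝ≥0∞) ≠ 0 := by exact_mod_cast h.numCodes_pos.ne'
  have he0 : (e : ℝ≥0∞) ≠ 0 := by exact_mod_cast hv.ne'
  set H : State → ℝ≥0∞ := wp w 0 (sampLoop P fam) (A.indicator 1) with hH
  have hH1 : ∀ s, H s ≤ 1 := wp_le_one (fun s => Set.indicator_le_self' (by simp) s) _
  -- the value of the loop after the trial of a valid code
  have hval : ∀ x < M, ∀ s s', Outcome D P G fam s x s' → ValidCode D P fam x → H s' =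
      if ∃ f : Fin k → Fin n, (IsEmb P G f ∧ Q f) ∧ IsCode D P fam x fun u => f u + 1
        then 1 else 0 := by
    rintro x hx s s' (⟨f, hf, hcode, hfound⟩ | ⟨hinv, -⟩) hvx
    · rw [hH, sampLoop_found hfound, zero_add]
      by_cases hq : Q f
      · rw [if_pos ⟨f, ⟨hf, hq⟩, hcode⟩, Set.indicator_of_mem ((hA f s' hf hfound).mpr hq)]
        rfl
      · rw [if_neg, Set.indicator_of_notMem (fun hmem => hq ((hA f s' hf hfound).mp hmem))]
        rintro ⟨f', ⟨hf', hq'⟩, hcode'⟩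
        have := IsCode.asg_unique h.famOK hcode hcode'
        obtain rfl : f = f' := funext fun u => Fin.ext (by simpa using congrFun this u)
        exact hq hq'
    · exact absurd hvx hinv
  have hsum : ∀ b : ℝ≥0∞, (∑ x ∈ Finset.range M, if ValidCode D P fam x then
      (if ∃ f : Fin k → Fin n, (IsEmb P G f ∧ Q f) ∧ IsCode D P fam x fun u => f u + 1
        then 1 else 0) else b) = a + (M - e : ℕ) * b := by
    intro b
    have h1 := sum_valid_add (D := D) (P := P) (fam := fam) 0 b
    rw [mul_zero, zero_add, ← hM, ← he] at h1
    rw [← h1, ha, Finset.card_filter, Nat.cast_sum, ← Finset.sum_add_distrib]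
    refine Finset.sum_congr rfl fun x _ => ?_
    by_cases hvx : ValidCode D P fam x
    · simp [hvx]
    · rw [if_neg hvx, if_neg hvx, if_neg]
      · simp
      · rintro ⟨f, -, hcode⟩
        exact hvx ⟨_, hcode⟩
  have hcancel : ∀ b : ℝ≥0∞, (M : ℝ≥0∞) * ((M : ℝ≥0∞)⁻¹ * b) = b := fun b => by
    rw [← mul_assoc, ENNReal.mul_inv_cancel hM0 (ENNReal.natCast_ne_top _), one_mul]
  have hMe : ((e : ℝ≥0∞) + (M - e : ℕ)) = M := by
    rw [← Nat.cast_add, Nat.add_sub_cancel' numValid_le]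
  -- the supremum and the infimum over the states satisfying the invariant obey the same equation
  set hi : ℝ≥0∞ := ⨆ t : {t // Head D P fam t}, H t with hhi
  set lo : ℝ≥0∞ := ⨅ t : {t // Head D P fam t}, H t with hlo
  have hi1 : hi ≤ 1 := iSup_le fun t => hH1 t
  have lo1 : lo ≤ 1 := (iInf_le (fun t : {t // Head D P fam t} => H t) ⟨s, hs⟩).trans (hH1 s)
  have up : hi ≤ a / e := by
    have h1 : hi ≤ (M : ℝ≥0∞)⁻¹ * (a + (M - e : ℕ) * hi) := by
      refine iSup_le fun ⟨t, ht⟩ => ?_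
      obtain ⟨nxt, h1, h2⟩ := sampLoop_wp h ht (ht.lt_of_valid hx₀.1 hx₀.2)
      rw [hH, h2, ← hsum hi]
      refine mul_le_mul_right (Finset.sum_le_sum fun x hx => ?_) _
      by_cases hvx : ValidCode D P fam x
      · rw [if_pos hvx]
        exact (hval x (Finset.mem_range.mp hx) _ _ (h1 x (Finset.mem_range.mp hx)) hvx).le
      · rw [if_neg hvx]
        rcases h1 x (Finset.mem_range.mp hx) with ⟨f, -, hcode, -⟩ | ⟨-, hh, -⟩
        · exact absurd ⟨_, hcode⟩ hvx
        · exact le_iSup (fun t : {t // Head D P fam t} => H t) ⟨_, hh⟩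
    have h2 : (M : ℝ≥0∞) * hi ≤ a + (M - e : ℕ) * hi := by
      rw [← hcancel (a + (M - e : ℕ) * hi)]
      exact mul_le_mul_right h1 _
    rw [← hMe, add_mul] at h2
    have h3 : (e : ℝ≥0∞) * hi ≤ a := (ENNReal.add_le_add_iff_right
      (ENNReal.mul_ne_top (ENNReal.natCast_ne_top _) (hi1.trans_lt ENNReal.one_lt_top).ne)).mp h2
    rw [ENNReal.le_div_iff_mul_le (.inl he0) (.inl (ENNReal.natCast_ne_top _)), mul_comm]
    exact h3
  have down : a / e ≤ lo := by
    have h1 : (M : ℝ≥0∞)⁻¹ * (a + (M - e : ℕ) * lo) ≤ lo := by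
      refine le_iInf fun ⟨t, ht⟩ => ?_
      obtain ⟨nxt, h1, h2⟩ := sampLoop_wp h ht (ht.lt_of_valid hx₀.1 hx₀.2)
      rw [hH, h2, ← hsum lo]
      refine mul_le_mul_right (Finset.sum_le_sum fun x hx => ?_) _
      by_cases hvx : ValidCode D P fam x
      · rw [if_pos hvx]
        exact (hval x (Finset.mem_range.mp hx) _ _ (h1 x (Finset.mem_range.mp hx)) hvx).ge
      · rw [if_neg hvx]
        rcases h1 x (Finset.mem_range.mp hx) with ⟨f, -, hcode, -⟩ | ⟨-, hh, -⟩
        · exact absurd ⟨_, hcode⟩ hvx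
        · exact iInf_le (fun t : {t // Head D P fam t} => H t) ⟨_, hh⟩
    have h2 : (a : ℝ≥0∞) + (M - e : ℕ) * lo ≤ M * lo := by
      rw [← hcancel (a + (M - e : ℕ) * lo)]
      exact mul_le_mul_right h1 _
    rw [← hMe, add_mul] at h2
    have h3 : (a : ℝ≥0∞) ≤ e * lo := (ENNReal.add_le_add_iff_right
      (ENNReal.mul_ne_top (ENNReal.natCast_ne_top _) (lo1.trans_lt ENNReal.one_lt_top).ne)).mp h2
    exact ENNReal.div_le_of_le_mul (by rwa [mul_comm])
  exact le_antisymm ((le_iSup (fun t : {t // Head D P fam t} => H t) ⟨s, hs⟩).trans up)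
    (down.trans (iInf_le (fun t : {t // Head D P fam t} => H t) ⟨s, hs⟩))

end

section
variable {k n w : ℕ} {D : Data} {G : Digraph (Fin n)} {P : Digraph (Fin k)}
  {fam : List (List (Stp k))} {α β γ : ℕ} {s s' : State}

/-! ### Occurrences and embeddings -/

/-- The occurrence of the pattern given by an embedding. -/
def image (f : {f : Fin k → Fin n // IsEmb P G f}) : SubDigraph G where
  verts := {v | ∃ i, f.1 i = v}
  edges := {e | ∃ i j, P.Adj i j ∧ f.1 i = e.1 ∧ f.1 j = e.2}
  adj_of_mem := by
    rintro e ⟨i, j, h, h1, h2⟩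
    rw [← h1, ← h2]; exact f.2.1 i j h
  fst_mem := by
    rintro e ⟨i, j, h, h1, h2⟩; exact ⟨i, h1⟩
  snd_mem := by
    rintro e ⟨i, j, h, h1, h2⟩; exact ⟨j, h2⟩

theorem occ_eq_range (hP : SimpleDi P) (hG : SimpleDi G) :
    occ G P = Set.range (image (P := P) (G := G)) := by
  ext S
  constructor
  · rintro ⟨f, hf⟩
    have hemb : IsEmb P G fun i => (f.symm i : Fin n) := by
      refine ⟨fun u v huv => ?_, fun u v huv => f.symm.injective (Subtype.ext huv)⟩
      have hne : u ≠ v := fun h => hP u (by rwa [← h] at huv)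
      exact S.adj_of_mem _ ((hf (f.symm u) (f.symm v) (f.symm.injective.ne hne)).mpr (by simpa))
    refine ⟨⟨_, hemb⟩, SubDigraph.ext ?_ ?_⟩
    · ext v
      exact ⟨fun ⟨i, hi⟩ => hi ▸ (f.symm i).2, fun hv => ⟨f ⟨v, hv⟩, by simp⟩⟩
    · ext ⟨u, v⟩
      constructor
      · rintro ⟨i, j, hij, h1, h2⟩
        simp only at h1 h2
        have hne : i ≠ j := fun h => hP i (by rwa [← h] at hij)
        rw [← h1, ← h2]
        exact (hf (f.symm i) (f.symm j) (f.symm.injective.ne hne)).mpr (by simpa)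
      · intro he
        have hu := S.fst_mem _ he
        have hv := S.snd_mem _ he
        have hne : u ≠ v := by rintro rfl; exact hG u (S.adj_of_mem _ he)
        exact ⟨f ⟨u, hu⟩, f ⟨v, hv⟩,
          (hf ⟨u, hu⟩ ⟨v, hv⟩ (fun h => hne (congrArg Subtype.val h))).mp he, by simp, by simp⟩
  · rintro ⟨f, rfl⟩
    let φ : Fin k → (image f).verts := fun i => ⟨f.1 i, i, rfl⟩
    have hφ : Function.Bijective φ :=
      ⟨fun i j h => f.2.2 (congrArg Subtype.val h), fun ⟨v, i, hi⟩ => ⟨i, Subtype.ext hi⟩⟩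
    refine ⟨(Equiv.ofBijective φ hφ).symm, fun u v _ => ?_⟩
    obtain ⟨i, rfl⟩ := (Equiv.ofBijective φ hφ).surjective u
    obtain ⟨j, rfl⟩ := (Equiv.ofBijective φ hφ).surjective v
    rw [Equiv.symm_apply_apply, Equiv.symm_apply_apply]
    constructor
    · rintro ⟨i', j', h, e1, e2⟩
      rwa [← f.2.2 e1, ← f.2.2 e2]
    · exact fun h => ⟨i, j, h, rfl, rfl⟩

open Classical in
/-- An occurrence is given by as many embeddings as the pattern has automorphisms. -/
theorem card_image_eq (f₀ : {f : Fin k → Fin n // IsEmb P G f}) :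
    (Finset.univ.filter fun f : {f : Fin k → Fin n // IsEmb P G f} => image f = image f₀).card =
    (Finset.univ.filter fun π : Equiv.Perm (Fin k) =>
      ∀ i j, P.Adj (π i) (π j) ↔ P.Adj i j).card := by
  symm
  have hcomp : ∀ π : Equiv.Perm (Fin k), (∀ i j, P.Adj (π i) (π j) ↔ P.Adj i j) →
      IsEmb P G fun i => f₀.1 (π i) := fun π hπ =>
    ⟨fun u v huv => f₀.2.1 _ _ ((hπ u v).mpr huv), fun u v huv => π.injective (f₀.2.2 huv)⟩
  refine Finset.card_bij (fun π hπ => ⟨_, hcomp π (by simpa using hπ)⟩) ?_ ?_ ?_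
  · intro π hπ
    simp only [Finset.mem_filter, Finset.mem_univ, true_and] at hπ ⊢
    refine SubDigraph.ext ?_ ?_
    · ext v
      exact ⟨fun ⟨i, hi⟩ => ⟨_, hi⟩, fun ⟨i, hi⟩ => ⟨π.symm i, by simpa using hi⟩⟩
    · ext e
      refine ⟨fun ⟨i, j, h, h1, h2⟩ => ⟨_, _, (hπ i j).mpr h, h1, h2⟩, fun ⟨i, j, h, h1, h2⟩ =>
        ⟨π.symm i, π.symm j, ?_, by simpa using h1, by simpa using h2⟩⟩
      rw [← hπ]; simpa using h
  · intro π hπ π' hπ' h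
    ext i
    have := congrFun (congrArg Subtype.val h) i
    exact congrArg Fin.val (f₀.2.2 this)
  · intro f hf
    simp only [Finset.mem_filter, Finset.mem_univ, true_and] at hf
    have h1 : ∀ i, ∃ j, f₀.1 j = f.1 i := fun i => by
      have : f.1 i ∈ (image f).verts := ⟨i, rfl⟩
      rwa [hf] at this
    choose π hπ using h1
    have hinj : Function.Injective π := fun i j h => f.2.2 (by rw [← hπ, ← hπ, h])
    refine ⟨Equiv.ofBijective π ⟨hinj, Finite.surjective_of_injective hinj⟩, ?_, ?_⟩
    · simp only [Finset.mem_filter, Finset.mem_univ, true_and]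
      intro i j
      constructor
      · intro h
        have : ((f.1 i, f.1 j) : Fin n × Fin n) ∈ (image f₀).edges := ⟨_, _, h, hπ i, hπ j⟩
        rw [← hf] at this
        obtain ⟨i', j', h', e1, e2⟩ := this
        rwa [← f.2.2 e1, ← f.2.2 e2]
      · intro h
        have : ((f.1 i, f.1 j) : Fin n × Fin n) ∈ (image f).edges := ⟨_, _, h, rfl, rfl⟩
        rw [hf] at this
        obtain ⟨i', j', h', e1, e2⟩ := this
        change P.Adj (π i) (π j)
        rwa [f₀.2.2 ((hπ i).trans e1.symm), f₀.2.2 ((hπ j).trans e2.symm)]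
    · exact Subtype.ext (funext hπ)

open Classical in
/-- The number of automorphisms of the pattern. -/
noncomputable def numAut (P : Digraph (Fin k)) : ℕ :=
  (Finset.univ.filter fun π : Equiv.Perm (Fin k) => ∀ i j, P.Adj (π i) (π j) ↔ P.Adj i j).card

theorem numAut_pos : 0 < numAut P :=
  Finset.card_pos.mpr ⟨1, by simp⟩

open Classical in
theorem card_isEmb (hP : SimpleDi P) (hG : SimpleDi G) :
    (Finset.univ.filter fun f : Fin k → Fin n => IsEmb P G f).card =
      (occ G P).ncard * numAut P := by
  have h1 : (Finset.univ.filter fun f : Fin k → Fin n => IsEmb P G f).card =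
      (Finset.univ : Finset {f : Fin k → Fin n // IsEmb P G f}).card := by
    rw [Finset.card_univ, Fintype.card_subtype]
  have h2 : (occ G P) = ((Finset.univ.image (image (P := P) (G := G)) : Finset _) : Set _) := by
    rw [occ_eq_range hP hG, Finset.coe_image, Finset.coe_univ, Set.image_univ]
  rw [h1, h2, Set.ncard_coe_finset, Finset.card_eq_sum_card_image (image (P := P) (G := G))]
  refine Finset.sum_const_nat fun S hS => ?_
  obtain ⟨f₀, -, rfl⟩ := Finset.mem_image.mp hS
  exact card_image_eq f₀

theorem returns_iff {f : Fin k → Fin n} (hf : IsEmb P G f) (hs : Found f s) (S : SubDigraph G) :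
    Returns P S s ↔ image ⟨f, hf⟩ = S := by
  rw [Returns, SubDigraph.ext_iff, eq_comm (a := S.verts), eq_comm (a := S.edges)]
  simp [hs.one, hs.out, image, Fin.val_inj]

/-! ### Sampling with a family of codes -/

open Classical in
/-- The valid codes are in bijection with the embeddings. -/
theorem Setting.numValid_eq (h : Setting w D G P fam α β γ) (hP : SimpleDi P) (hG : SimpleDi G) :
    numValid D P fam = (occ G P).ncard * numAut P := by
  rw [← card_isEmb hP hG]
  have := card_codes h.famOK h.rep (fun s => s.rad_pos h.valid) fun _ => True
  simp only [and_true] at this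
  rw [← this, numValid]
  congr 1
  refine Finset.filter_congr fun x _ => ⟨fun ⟨g, hg⟩ => ?_, fun ⟨f, hf, hc⟩ => ⟨_, hc⟩⟩
  obtain ⟨f, hf, rfl⟩ := h.rep.exists_isEmb h.noIsolated hg.2
  exact ⟨f, hf, hg⟩

theorem setup_spec (h : Setting w D G P fam α β γ) (hs : Holds k D s) :
    Ex w (setup fam) s (2 * (fam.headD []).length + 8) (Head D P fam) := by
  have hlen := h.length_lt
  have hcodes := h.codes_lt
  have hpos := h.numCodes_pos
  have hp1 : ∀ l : List (Stp k), 0 < prodRad D l := fun l =>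
    List.prod_pos fun x hx => by
      obtain ⟨c, -, rfl⟩ := List.mem_map.mp hx
      exact c.rad_pos h.valid
  have key : ∀ (l : List (Stp k)) (s : State), Holds k D s →
      s.reg (rM k) * prodRad D l < 2 ^ w →
      (((l.map fun c => Instr.arith .mul (rM k) (rM k) c.radReg).foldl
        (fun s i => i.detExec w s) s).reg (rM k) = s.reg (rM k) * prodRad D l) ∧
      SameOutside {rM k} s ((l.map fun c => Instr.arith .mul (rM k) (rM k) c.radReg).foldl
        (fun s i => i.detExec w s) s) := by
    intro l
    induction l with
    | nil => exact fun s _ _ => ⟨by simp [prodRad], .refl⟩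
    | cons c l ih =>
      intro s hs hlt
      have hc : s.reg c.radReg = c.rad D := by
        cases c
        · exact hs.m
        · exact hs.lam
        · exact hs.q
        · exact hs.q
      have hprod : prodRad D (c :: l) = c.rad D * prodRad D l := by simp [prodRad]
      rw [hprod, ← mul_assoc] at hlt ⊢
      have hlt' : s.reg (rM k) * c.rad D < 2 ^ w :=
        (Nat.le_mul_of_pos_right _ (hp1 l)).trans_lt hlt
      simp only [List.map_cons, List.foldl_cons]
      set s₁ := Instr.detExec w (Instr.arith .mul (rM k) (rM k) c.radReg) s with hs₁
      have e1 : s₁.reg (rM k) = s.reg (rM k) * c.rad D := by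
        simp [hs₁, Instr.detExec, State.setReg, Op.eval, hc, Nat.mod_eq_of_lt hlt']
      have h1 : SameOutside {rM k} s s₁ := .setReg (by simp)
      obtain ⟨h2, h3⟩ := ih s₁ (hs.of_same h1 (by intro r; simp [rM, rg, sampRegs]; omega))
        (by rwa [e1])
      exact ⟨by rw [h2, e1], h1.trans h3⟩
  refine Ex.block (fun i hi => ?_) ?_ (by simp; omega)
  · simp only [List.mem_append, List.mem_map, List.mem_cons, List.not_mem_nil, or_false] at hi
    rcases hi with ((rfl | rfl) | ⟨c, -, rfl⟩) | (rfl | rfl) <;> trivial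
  rw [List.foldl_append, List.foldl_append]
  set s₁ := [Instr.const (rB k) fam.length, Instr.arith .add (rM k) (rB k) (rZero k)].foldl
    (fun s i => i.detExec w s) s with hs₁
  have h1 : SameOutside {rB k, rM k} s s₁ :=
    SameOutside.trans (.setReg (by simp)) (.setReg (by simp))
  have hH₁ : Holds k D s₁ := hs.of_same h1 (by intro r; simp [rB, rM, rg, sampRegs]; omega)
  have eB : s₁.reg (rB k) = fam.length := by
    simp [hs₁, Instr.detExec, State.setReg, Nat.mod_eq_of_lt hlen, rB, rM, rg]
  have eM : s₁.reg (rM k) = fam.length := by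
    simp [hs₁, Instr.detExec, State.setReg, Op.eval, hs.zero, Nat.mod_eq_of_lt hlen]
  obtain ⟨h2, h3⟩ := key (fam.headD []) s₁ hH₁ (by rw [eM]; exact hcodes)
  set s₂ := ((fam.headD []).map fun c => Instr.arith .mul (rM k) (rM k) c.radReg).foldl
    (fun s i => i.detExec w s) s₁ with hs₂
  have h4 : SameOutside {rT k, 0} s₂ ([Instr.const (rT k) 0, Instr.const 0 0].foldl
      (fun s i => i.detExec w s) s₂) :=
    SameOutside.trans (.setReg (by simp)) (.setReg (by simp))
  have eT : ([Instr.const (rT k) 0, Instr.const 0 0].foldl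
      (fun s i => i.detExec w s) s₂).reg (rT k) = 0 := by
    simp [Instr.detExec, State.setReg, rT, rg]
  refine ⟨(hH₁.of_same h3 (by intro r; simp [rM, rg, sampRegs]; omega)).of_same h4
    (by intro r; simp [rT, rg, sampRegs]; omega), ?_, ?_, ?_, ?_, ?_⟩
  · rw [h4.2 _ (by simp [rB, rT, rg]), h3.2 _ (by simp [rB, rM, rg]), eB]
  · rw [h4.2 _ (by simp [rM, rT, rg]), h2, eM, numCodes]
  · simp [Instr.detExec, State.setReg]
  · rw [eT]; omega
  · rw [eT]; omega

theorem Ex.wp_seq {p q : Prog} {T : ℕ} {Q : State → Prop} (h : Ex w p s T Q) :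
    ∃ s', Q s' ∧ (∀ φ, wp w 0 (.seq p q) φ s = wp w 0 q φ s') ∧
      wp w 1 (.seq p q) (fun _ => 0) s ≤ (T + 1 : ℕ) + wp w 1 q (fun _ => 0) s' := by
  obtain ⟨s', ⟨t, ht, hr⟩, hQ⟩ := h
  refine ⟨s', hQ, fun φ => ?_, ?_⟩
  · rw [DirectedSampling.wp_seq, hr]; simp
  · rw [DirectedSampling.wp_seq, hr, mul_one, ← add_assoc]
    gcongr
    exact_mod_cast Nat.add_le_add_right ht 1

/-- A constant factor for the expected running time of sampling. -/
noncomputable def sampConst (P : Digraph (Fin k)) (fam : List (List (Stp k))) : ℕ :=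
  2 * (fam.headD []).length + tryTime P fam + 14

/-- The specification of a sampling operation: it takes at most `c / max 1 OUT` steps on average,
and its result is correctly distributed. -/
def Samples (w : ℕ) (p : Prog) (P : Digraph (Fin k)) (G : Digraph (Fin n)) (c : ℝ≥0∞) (s : State) :
    Prop :=
  wp w 1 p (fun _ => 0) s ≤ c / max 1 ((occ G P).ncard : ℝ≥0∞) ∧
  (∀ S ∈ occ G P, wp w 0 p ({t | Returns P S t}.indicator 1) s = ((occ G P).ncard : ℝ≥0∞)⁻¹) ∧
  (occ G P = ∅ → wp w 0 p ({t | DeclaresAbsence t}.indicator 1) s = 1)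

theorem sampWith_spec (h : Setting w D G P fam α β γ) (hP : SimpleDi P) (hG : SimpleDi G)
    (hs : Holds k D s) :
    Samples w (sampWith P fam) P G (sampConst P fam * numCodes D fam) s := by
  classical
  obtain ⟨s₁, hs₁, h0, h1⟩ := (setup_spec h hs).wp_seq (q := sampLoop P fam)
  have hval := h.numValid_eq hP hG
  have haut := numAut_pos (P := P)
  have hfin : (occ G P).Finite := by rw [occ_eq_range hP hG]; exact Set.finite_range _
  have hle := numValid_le (D := D) (P := P) (fam := fam)
  rcases Nat.eq_zero_or_pos (occ G P).ncard with h0' | hpos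
  · have hemp : occ G P = ∅ := (Set.ncard_eq_zero hfin).mp h0'
    have hinv : ∀ x < numCodes D fam, ¬ ValidCode D P fam x := by
      rw [h0', zero_mul, numValid, Finset.card_eq_zero, Finset.filter_eq_empty_iff] at hval
      exact fun x hx => hval (Finset.mem_range.mpr hx)
    refine ⟨?_, fun S hS => ?_, fun _ => ?_⟩
    · rw [h0', Nat.cast_zero, max_eq_left (by simp), div_one]
      refine h1.trans ((add_le_add_right (sampLoop_time_absent h hinv hs₁) _).trans ?_)
      have := h.numCodes_pos
      norm_cast
      rw [sampConst]
      nlinarith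
    · rw [hemp] at hS; exact hS.elim
    · rw [sampWith, h0, sampLoop_absent h hinv hs₁]
  · have hv : 0 < numValid D P fam := by rw [hval]; positivity
    have hne : occ G P ≠ ∅ := by rintro he; simp [he] at hpos
    refine ⟨?_, fun S hS => ?_, fun he => absurd he hne⟩
    · have hmax : max 1 ((occ G P).ncard : ℝ≥0∞) = (occ G P).ncard :=
        max_eq_right (by exact_mod_cast hpos)
      have ho0 : ((occ G P).ncard : ℝ≥0∞) ≠ 0 := by exact_mod_cast hpos.ne'
      have hov : (occ G P).ncard ≤ numValid D P fam := by
        rw [hval]; exact Nat.le_mul_of_pos_right _ haut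
      rw [hmax]
      have h2 : (1 : ℝ≥0∞) ≤ numCodes D fam / (occ G P).ncard := by
        rw [ENNReal.le_div_iff_mul_le (.inl ho0) (.inl (ENNReal.natCast_ne_top _)), one_mul]
        exact_mod_cast hov.trans hle
      refine h1.trans ((add_le_add_right (sampLoop_time h hv hs₁) _).trans ?_)
      calc _ ≤ ((2 * (fam.headD []).length + 8 + 1 : ℕ) : ℝ≥0∞) *
            (numCodes D fam / (occ G P).ncard) +
            (tryTime P fam + 5 : ℕ) * (numCodes D fam / (occ G P).ncard) := by
            gcongr
            exact le_mul_of_one_le_right zero_le h2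
        _ = _ := by
            rw [← add_mul, mul_div_assoc, sampConst]
            congr 1
            push_cast
            ring
    · rw [occ_eq_range hP hG] at hS
      obtain ⟨f₀, rfl⟩ := hS
      rw [sampWith, h0, sampLoop_found_prob h hv hs₁ {t | Returns P (image f₀) t}
        (fun f => ∃ hf : IsEmb P G f, image ⟨f, hf⟩ = image f₀) (fun f s' hf hs' => by
          rw [Set.mem_ofPred_eq, returns_iff hf hs']
          exact ⟨fun h => ⟨hf, h⟩, fun ⟨_, h⟩ => h⟩),
        card_codes h.famOK h.rep (fun s => s.rad_pos h.valid)]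
      have hcard : (Finset.univ.filter fun f : Fin k → Fin n =>
          IsEmb P G f ∧ ∃ hf : IsEmb P G f, image ⟨f, hf⟩ = image f₀).card = numAut P := by
        rw [numAut, ← card_image_eq f₀]
        symm
        refine Finset.card_bij (fun f _ => f.1) (fun f hf => ?_) (fun f _ g _ h => Subtype.ext h)
          (fun f hf => ?_)
        · simp only [Finset.mem_filter, Finset.mem_univ, true_and] at hf ⊢
          exact ⟨f.2, f.2, hf⟩
        · simp only [Finset.mem_filter, Finset.mem_univ, true_and] at hf
          obtain ⟨hf, hf', he⟩ := hf
          exact ⟨⟨f, hf⟩, by simpa using he, rfl⟩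
      refine Eq.trans (congrArg (fun c : ℕ => (c : ℝ≥0∞) / _) (?_ : _ = numAut P)) ?_
      · convert hcard
      rw [hval]
      have ha0 : (numAut P : ℝ≥0∞) ≠ 0 := by exact_mod_cast haut.ne'
      push_cast
      rw [div_eq_mul_inv, ENNReal.mul_inv (.inr (ENNReal.natCast_ne_top _)) (.inr ha0), mul_comm,
        mul_assoc, ENNReal.inv_mul_cancel ha0 (ENNReal.natCast_ne_top _), mul_one]

end

/-! ### Preprocessing -/

/-- The edges with vertices numbered from `1`. -/
def edges1 {n : ℕ} (E : List (Fin n × Fin n)) : List (ℕ × ℕ) :=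
  E.map fun e => ((e.1 : ℕ) + 1, (e.2 : ℕ) + 1)

/-- The out-neighbours of `u` in a list of edges. -/
def nbr (L : List (ℕ × ℕ)) (u : ℕ) : List ℕ := (L.filter fun e => e.1 = u).map Prod.snd

theorem nbr_concat (L : List (ℕ × ℕ)) (a b u : ℕ) :
    nbr (L ++ [(a, b)]) u = if u = a then nbr L u ++ [b] else nbr L u := by
  by_cases h : u = a
  · subst h; simp [nbr, List.filter_append]
  · simp [nbr, List.filter_append, h, Ne.symm h]

theorem mem_nbr {L : List (ℕ × ℕ)} {u v : ℕ} : v ∈ nbr L u ↔ (u, v) ∈ L := by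
  simp [nbr]

theorem nodup_nbr {L : List (ℕ × ℕ)} (h : L.Nodup) (u : ℕ) : (nbr L u).Nodup := by
  refine List.Nodup.map_on ?_ (h.filter _)
  intro x hx y hy hxy
  simp only [List.mem_filter, decide_eq_true_eq] at hx hy
  exact Prod.ext (hx.2.trans hy.2.symm) hxy

theorem sum_length_nbr_le (L : List (ℕ × ℕ)) (A : Finset ℕ) :
    ∑ u ∈ A, (nbr L u).length ≤ L.length := by
  induction L with
  | nil => simp [nbr]
  | cons e L ih =>
    have h : ∀ u, (nbr (e :: L) u).length = (nbr L u).length + if e.1 = u then 1 else 0 := by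
      intro u
      by_cases h : e.1 = u <;> simp [nbr, h]
    simp only [h, Finset.sum_add_distrib, Finset.sum_ite_eq, List.length_cons]
    split <;> omega

theorem length_le_of_nodup {l : List ℕ} {n : ℕ} (h : l.Nodup) (hl : ∀ x ∈ l, 1 ≤ x ∧ x ≤ n) :
    l.length ≤ n := by
  have h1 : l.toFinset ⊆ Finset.Icc 1 n := fun x hx => by
    simpa using hl x (by simpa using hx)
  have h2 := Finset.card_le_card h1
  rwa [List.toFinset_card_of_nodup h, Nat.card_Icc, Nat.add_sub_cancel] at h2

section program
variable (k : ℕ)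

/-! The preprocessing uses the registers from `rg k 9` on in its own way. -/

/-- The address of the next number of the input. -/
abbrev pP := rg k 9
/-- The tail of the edge. -/
abbrev pU := rg k 10
/-- The head of the edge. -/
abbrev pV := rg k 11
/-- The offset of the row of the tail in a two-dimensional table. -/
abbrev pRow := rg k 12
/-- The address to write to. -/
abbrev pAd := rg k 13
/-- The address of the out-degree of the tail. -/
abbrev pE := rg k 14
/-- The out-degree of the tail. -/
abbrev pDeg := rg k 15
/-- The number of vertices of high out-degree. -/
abbrev pH := rg k 16
/-- The number of edges that have been read. -/
abbrev pIx := rg k 17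
/-- The address of the table of out-degrees. -/
abbrev pDB := rg k 18
/-- The size of a two-dimensional table. -/
abbrev pSz := rg k 19
/-- The square of `rq`. -/
abbrev pQQ := rg k 20

/-- Computes the addresses of the tables. -/
def preConsts : Prog :=
  block [.load (rN1 k) (rZero k), .const (rOne k) 1, .load (rm k) (rOne k),
    .arith .add (rN1 k) (rN1 k) (rOne k), .arith .mul (pSz k) (rN1 k) (rN1 k),
    .arith .add (rAdj k) (pSz k) (pSz k), .arith .add (rOut k) (rAdj k) (pSz k),
    .arith .add (rHvy k) (rOut k) (pSz k), .arith .add (pDB k) (rHvy k) (pSz k),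
    .const (pP k) 2]

/-- Computes the rounded-up square root of the number of edges. -/
def preSqrt : Prog :=
  .loop (.lt (pQQ k) (rm k)) <|
    block [.arith .add (rq k) (rq k) (rOne k), .arith .mul (pQQ k) (rq k) (rq k)]

/-- Reads an edge and enters it into the adjacency matrix and the list of out-neighbours. -/
def preRead : Prog :=
  block [.load (pU k) (pP k), .arith .add (pP k) (pP k) (rOne k), .load (pV k) (pP k),
    .arith .add (pP k) (pP k) (rOne k), .arith .add (pU k) (pU k) (rOne k),
    .arith .add (pV k) (pV k) (rOne k), .arith .mul (pRow k) (pU k) (rN1 k),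
    .arith .add (pAd k) (rAdj k) (pRow k), .arith .add (pAd k) (pAd k) (pV k),
    .store (pAd k) (rOne k), .arith .add (pE k) (pDB k) (pU k), .load (pDeg k) (pE k),
    .arith .add (pAd k) (rOut k) (pRow k), .arith .add (pAd k) (pAd k) (pDeg k),
    .store (pAd k) (pV k)]

/-- Enters a vertex into the list of vertices of high out-degree, at the moment when its out-degree,
which is `pDeg` without the current edge, is about to exceed `q`. -/
def preHeavy : Prog :=
  .ite (.eq (pDeg k) (rq k))
    (block [.arith .add (pAd k) (rHvy k) (pH k), .store (pAd k) (pU k),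
      .arith .add (pH k) (pH k) (rOne k)]) .skip

/-- Updates the out-degree and the maximum out-degree. -/
def preDeg : Prog :=
  .seq (block [.arith .add (pDeg k) (pDeg k) (rOne k), .store (pE k) (pDeg k),
    .arith .add (pIx k) (pIx k) (rOne k)]) <|
    .ite (.lt (rlam k) (pDeg k)) (.instr (.arith .add (rlam k) (pDeg k) (rZero k))) .skip

/-- Enters all the edges into the tables. -/
def preEdges : Prog :=
  .loop (.lt (pIx k) (rm k)) <| .seq (preRead k) <| .seq (preHeavy k) (preDeg k)

/-- The preprocessing. -/
def preProg : Prog := .seq (preConsts k) <| .seq (preSqrt k) (preEdges k)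
end program

section
variable {k n w : ℕ} {E : List (Fin n × Fin n)} {s s' : State}

/-- The contents of the memory in the initial state. -/
def inputMem {n : ℕ} (E : List (Fin n × Fin n)) : ℕ → ℕ := (inputState E).mem

/-- The endpoints of the edges in the input. -/
theorem getD_flatMap_pair (E : List (Fin n × Fin n)) (i : ℕ) (hi : i < E.length) :
    (E.flatMap fun e => [(e.1 : ℕ), (e.2 : ℕ)]).getD (2 * i) 0 = E[i].1 ∧
    (E.flatMap fun e => [(e.1 : ℕ), (e.2 : ℕ)]).getD (2 * i + 1) 0 = E[i].2 := by
  induction E generalizing i with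
  | nil => simp at hi
  | cons e E ih =>
    cases i with
    | zero => simp
    | succ i =>
      have := ih i (by simpa using hi)
      simpa [List.flatMap_cons, Nat.mul_add, Nat.add_assoc] using this

theorem inputMem_edge {i : ℕ} (hi : i < E.length) :
    inputMem E (2 + 2 * i) = E[i].1 ∧ inputMem E (3 + 2 * i) = E[i].2 := by
  have := getD_flatMap_pair E i hi
  unfold inputMem inputState
  rw [show 2 + 2 * i = 2 * i + 1 + 1 by ring, show 3 + 2 * i = 2 * i + 1 + 1 + 1 by ring]
  simpa using this

theorem inputMem_of_le {a : ℕ} (ha : 2 + 2 * E.length ≤ a) : inputMem E a = 0 := by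
  unfold inputMem inputState
  refine List.getD_eq_default _ _ ?_
  have : (E.flatMap fun e => [(e.1 : ℕ), (e.2 : ℕ)]).length = 2 * E.length := by
    simp [List.length_flatMap, mul_comm]
  simp only [List.length_cons, this]
  omega

/-- The data structure in the course of the preprocessing. -/
def dataOf (k n : ℕ) (s : State) : Data where
  n := n
  m := s.reg (rm k)
  lam := s.reg (rlam k)
  q := s.reg (rq k)
  mem := s.mem

/-- The invariant for the entering of the edges, when the first `i` have been entered. -/
structure PreInv (k : ℕ) {n : ℕ} (E : List (Fin n × Fin n)) (i : ℕ) (s : State) : Prop where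
  holds : Holds k (dataOf k n s) s
  m : s.reg (rm k) = E.length
  db : s.reg (pDB k) = 5 * (dataOf k n s).S
  ix : s.reg (pIx k) = i
  ptr : s.reg (pP k) = 2 + 2 * i
  input : ∀ a < 2 + 2 * E.length, s.mem a = inputMem E a
  adj : ∀ u ≤ n, ∀ v ≤ n, ((dataOf k n s).adj u v ≠ 0 ↔ (u, v) ∈ (edges1 E).take i)
  out : ∀ u ≤ n, ∀ r ≤ n, (dataOf k n s).out u r = (nbr ((edges1 E).take i) u).getD r 0
  deg : ∀ u ≤ n, s.mem (5 * (dataOf k n s).S + u) = (nbr ((edges1 E).take i) u).length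
  heavy : ∃ hv : List ℕ, s.reg (pH k) = hv.length ∧
    (∀ r < (dataOf k n s).S, (dataOf k n s).hvy r = hv.getD r 0) ∧ hv.Nodup ∧
    ∀ u, u ∈ hv ↔ s.reg (rq k) < (nbr ((edges1 E).take i) u).length
  lam_le : ∀ u, (nbr ((edges1 E).take i) u).length ≤ s.reg (rlam k)
  lam_eq : ∃ u, s.reg (rlam k) = (nbr ((edges1 E).take i) u).length

theorem S_dataOf : (dataOf k n s).S = (n + 1) * (n + 1) := rfl

theorem edges1_take_succ {i : ℕ} (hi : i < E.length) :
    (edges1 E).take (i + 1) = (edges1 E).take i ++ [((E[i].1 : ℕ) + 1, (E[i].2 : ℕ) + 1)] := by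
  rw [List.take_succ_eq_append_getElem (by simpa [edges1] using hi)]
  simp [edges1]

theorem nodup_edges1 (hE : E.Nodup) : (edges1 E).Nodup :=
  hE.map fun a b h => by
    simp only [Prod.mk.injEq, Nat.add_right_cancel_iff, Fin.val_inj] at h
    exact Prod.ext h.1 h.2

theorem mem_edges1_bound {u v : ℕ} (h : (u, v) ∈ edges1 E) : 1 ≤ u ∧ u ≤ n ∧ 1 ≤ v ∧ v ≤ n := by
  simp only [edges1, List.mem_map, Prod.mk.injEq, Prod.exists] at h
  obtain ⟨a, b, -, rfl, rfl⟩ := h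
  have := a.isLt
  have := b.isLt
  omega

theorem nbr_take_length_le (hE : E.Nodup) (i u : ℕ) :
    (nbr ((edges1 E).take i) u).length ≤ n := by
  refine length_le_of_nodup (nodup_nbr ((nodup_edges1 hE).sublist (List.take_sublist _ _)) u) ?_
  intro x hx
  have := mem_edges1_bound (List.mem_of_mem_take (mem_nbr.mp hx))
  omega

theorem preRead_spec (hE : E.Nodup) (hw : 6 * ((n + 1) * (n + 1)) < 2 ^ w)
    (hm : E.length ≤ n * n) {i : ℕ} (hi : i < E.length) (hs : PreInv k E i s) :
    Ex w (preRead k) s 30 fun s' =>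
      s'.reg (pU k) = E[i].1 + 1 ∧ s'.reg (pP k) = 2 + 2 * (i + 1) ∧
      s'.reg (pE k) = 5 * ((n + 1) * (n + 1)) + (E[i].1 + 1) ∧
      s'.reg (pDeg k) = (nbr ((edges1 E).take i) (E[i].1 + 1)).length ∧
      s'.mem = Function.update (Function.update s.mem
        (2 * ((n + 1) * (n + 1)) + ((E[i].1 + 1) * (n + 1) + (E[i].2 + 1))) 1)
        (3 * ((n + 1) * (n + 1)) + ((E[i].1 + 1) * (n + 1) +
          (nbr ((edges1 E).take i) (E[i].1 + 1)).length)) (E[i].2 + 1) ∧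
      ∀ r, r ≤ k + 9 ∨ k + 17 ≤ r → s'.reg r = s.reg r := by
  obtain ⟨h1, h2⟩ := inputMem_edge hi
  rw [← hs.input _ (by omega)] at h1 h2
  have hdeg := nbr_take_length_le hE i (E[i].1 + 1)
  have hd := hs.deg (E[i].1 + 1) E[i].1.isLt
  rw [S_dataOf] at hd
  have hu := E[i].1.isLt
  have hv := E[i].2.isLt
  have hadj := hs.holds.adj
  have hout := hs.holds.out
  have hdb := hs.db
  rw [S_dataOf] at hadj hout hdb
  have hN1 : s.reg (rN1 k) = n + 1 := hs.holds.N1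
  have hrow1 : (E[i].1 + 1) * (n + 1) + (E[i].2 + 1) < (n + 1) * (n + 1) :=
    (dataOf k n s).row_lt hu hv
  have hrow2 : (E[i].1 + 1) * (n + 1) + (nbr ((edges1 E).take i) (E[i].1 + 1)).length <
      (n + 1) * (n + 1) := (dataOf k n s).row_lt hu hdeg
  have hnn : n * n + 2 * n + 1 = (n + 1) * (n + 1) := by ring
  set S := (n + 1) * (n + 1) with hS
  set d := (nbr ((edges1 E).take i) (E[i].1 + 1)).length with hdd
  refine Ex.block (by simp [Instr.IsDet]) ?_ (by simp)
  have e3 : (2 + 2 * i + 1) % 2 ^ w = 3 + 2 * i := by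
    rw [Nat.mod_eq_of_lt (by omega)]; ring
  have e4 : ((E[i].1 : ℕ) + 1) % 2 ^ w = E[i].1 + 1 := Nat.mod_eq_of_lt (by omega)
  have e5 : ((E[i].2 : ℕ) + 1) % 2 ^ w = E[i].2 + 1 := Nat.mod_eq_of_lt (by omega)
  have e6 : ((E[i].1 + 1 : ℕ) * (n + 1)) % 2 ^ w = (E[i].1 + 1) * (n + 1) :=
    Nat.mod_eq_of_lt (by omega)
  have e7 : (5 * S + (E[i].1 + 1 : ℕ)) % 2 ^ w = 5 * S + (E[i].1 + 1) :=
    Nat.mod_eq_of_lt (by omega)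
  have e8 : 2 * S + (E[i].1 + 1 : ℕ) * (n + 1) + (E[i].2 + 1) =
    2 * S + ((E[i].1 + 1) * (n + 1) + (E[i].2 + 1)) := by ring
  have e9 : 3 * S + (E[i].1 + 1 : ℕ) * (n + 1) + d =
    3 * S + ((E[i].1 + 1) * (n + 1) + d) := by ring
  have e10 : (3 + 2 * i + 1) % 2 ^ w = 2 + 2 * (i + 1) := by
    rw [Nat.mod_eq_of_lt (by omega)]; ring
  have e11 : (2 * S + ((E[i].1 + 1 : ℕ) * (n + 1) + (E[i].2 + 1))) % 2 ^ w =
      2 * S + ((E[i].1 + 1 : ℕ) * (n + 1) + (E[i].2 + 1)) := Nat.mod_eq_of_lt (by omega)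
  have e12 : (3 * S + ((E[i].1 + 1 : ℕ) * (n + 1) + d)) % 2 ^ w =
      3 * S + ((E[i].1 + 1 : ℕ) * (n + 1) + d) := Nat.mod_eq_of_lt (by omega)
  have e13 : 5 * S + ((E[i].1 : ℕ) + 1) ≠ 2 * S + ((E[i].1 + 1) * (n + 1) + (E[i].2 + 1)) := by
    omega
  simp only [List.foldl_cons, List.foldl_nil, Instr.detExec, State.setReg, State.setMem, Op.eval]
  refine ⟨?_, ?_, ?_, ?_, ?_, fun r hr => ?_⟩
  · simp [hs.holds.one, hs.ptr, h1, e4]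
  · simp [hs.holds.one, hs.ptr, e3, e10]
  · simp [hs.holds.one, hs.ptr, h1, e4, hdb, e7]
  · simp [hs.holds.one, hs.ptr, h1, h2, e3, e4, e5, e6, hdb, hN1, hadj, e7, e8, e11, hd,
      Function.update_of_ne e13]
  · simp [hs.holds.one, hs.ptr, h1, h2, e3, e4, e5, e6, hdb, hN1, hadj, hout, e7, e8, e9, e11, e12,
      hd, Function.update_of_ne e13]
  · have : ∀ j, 9 ≤ j → j ≤ 15 → r ≠ k + 1 + j := fun j _ _ => by omega
    simp [this]

end

section
variable {k n w : ℕ} {E : List (Fin n × Fin n)} {s s' : State}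

theorem row_inj {n u v a b : ℕ} (hv : v ≤ n) (hb : b ≤ n) :
    u * (n + 1) + v = a * (n + 1) + b ↔ u = a ∧ v = b := by
  constructor
  · intro h
    have h1 : (u * (n + 1) + v) / (n + 1) = u := by
      rw [mul_comm, Nat.mul_add_div (by omega), Nat.div_eq_of_lt (by omega), add_zero]
    have h2 : (a * (n + 1) + b) / (n + 1) = a := by
      rw [mul_comm, Nat.mul_add_div (by omega), Nat.div_eq_of_lt (by omega), add_zero]
    have h3 : u = a := by rw [← h1, h, h2]
    subst h3
    exact ⟨rfl, by omega⟩
  · rintro ⟨rfl, rfl⟩; rfl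

theorem row_lt' {n u r : ℕ} (hu : u ≤ n) (hr : r ≤ n) :
    u * (n + 1) + r < (n + 1) * (n + 1) := by nlinarith

theorem getD_concat (l : List ℕ) (b r : ℕ) :
    (l ++ [b]).getD r 0 = if r = l.length then b else l.getD r 0 := by
  rcases lt_trichotomy r l.length with h | h | h
  · rw [if_neg h.ne, List.getD_append _ _ _ _ h]
  · rw [if_pos h, List.getD_append_right _ _ _ _ h.ge]; simp [h]
  · rw [if_neg h.ne', List.getD_append_right _ _ _ _ h.le, List.getD_eq_default _ _ h.le,
      List.getD_eq_default]
    simp; omega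

/-- The effect of the entering of one edge on the tables. -/
theorem PreInv.step (hE : E.Nodup) (hm : E.length ≤ n * n) {i : ℕ} (hi : i < E.length)
    (hs : PreInv k E i s)
    {a b d S : ℕ} (ha : a = E[i].1 + 1) (hb : b = E[i].2 + 1)
    (hd : d = (nbr ((edges1 E).take i) a).length) (hS : S = (n + 1) * (n + 1))
    (hmem : s'.mem = Function.update
      (if d = s.reg (rq k) then
        Function.update (Function.update (Function.update s.mem (2 * S + (a * (n + 1) + b)) 1)
          (3 * S + (a * (n + 1) + d)) b) (4 * S + s.reg (pH k)) a
      else Function.update (Function.update s.mem (2 * S + (a * (n + 1) + b)) 1)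
          (3 * S + (a * (n + 1) + d)) b) (5 * S + a) (d + 1))
    (hH : s'.reg (pH k) = if d = s.reg (rq k) then s.reg (pH k) + 1 else s.reg (pH k))
    (hlam : s'.reg (rlam k) = if s.reg (rlam k) < d + 1 then d + 1 else s.reg (rlam k))
    (hix : s'.reg (pIx k) = i + 1) (hptr : s'.reg (pP k) = 2 + 2 * (i + 1))
    (hconst : ∀ j < 9, j ≠ 3 → s'.reg (rg k j) = s.reg (rg k j))
    (hdb : s'.reg (pDB k) = s.reg (pDB k)) :
    PreInv k E (i + 1) s' := by
  have hu := E[i].1.isLt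
  have hv := E[i].2.isLt
  have han : a ≤ n := by omega
  have hbn : b ≤ n := by omega
  have hdn : d ≤ n := hd ▸ nbr_take_length_le hE i a
  have hL : (edges1 E).take (i + 1) = (edges1 E).take i ++ [(a, b)] := by
    rw [edges1_take_succ hi, ha, hb]
  have hq : s'.reg (rq k) = s.reg (rq k) := hconst 4 (by omega) (by omega)
  have hrow1 := row_lt' han hbn
  have hrow2 := row_lt' han hdn
  have hnn : n * n + 2 * n + 1 = (n + 1) * (n + 1) := by ring
  obtain ⟨hv, hvl, hvy, hvn, hvm⟩ := hs.heavy
  have hvle : hv.length ≤ n := by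
    refine length_le_of_nodup hvn fun u hu => ?_
    have h := (hvm u).mp hu
    obtain ⟨v, hv⟩ := List.exists_mem_of_length_pos
      (by omega : 0 < (nbr ((edges1 E).take i) u).length)
    have := mem_edges1_bound (List.mem_of_mem_take (mem_nbr.mp hv))
    omega
  have hsadj := hs.adj
  have hsout := hs.out
  have hsdeg := hs.deg
  simp only [Data.adj, Data.out, Data.hvy, S_dataOf] at hsadj hsout hsdeg hvy
  rw [← hS] at hrow1 hrow2 hnn hsadj hsout hsdeg hvy
  have hI : ∀ y < 2 * S, s'.mem y = s.mem y := fun y hy => by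
    rw [hmem]
    split_ifs <;> simp only [Function.update_apply] <;> split_ifs <;> first | rfl | omega
  have hA : ∀ y < S, s'.mem (2 * S + y) = if y = a * (n + 1) + b then 1 else s.mem (2 * S + y) :=
    fun y hy => by
    rw [hmem]
    split_ifs <;> simp only [Function.update_apply] <;> split_ifs <;> first | rfl | omega
  have hO : ∀ y < S, s'.mem (3 * S + y) = if y = a * (n + 1) + d then b else s.mem (3 * S + y) :=
    fun y hy => by
    rw [hmem]
    split_ifs <;> simp only [Function.update_apply] <;> split_ifs <;> first | rfl | omega
  have hY : ∀ y < S, s'.mem (4 * S + y) =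
      if d = s.reg (rq k) ∧ y = hv.length then a else s.mem (4 * S + y) :=
    fun y hy => by
    rw [hmem, hvl]
    split_ifs <;> simp only [Function.update_apply] <;> split_ifs <;> first | rfl | omega
  have hD : ∀ y ≤ n, s'.mem (5 * S + y) = if y = a then d + 1 else s.mem (5 * S + y) :=
    fun y hy => by
    rw [hmem, hvl]
    split_ifs <;> simp only [Function.update_apply] <;> split_ifs <;> first | rfl | omega
  have hlen : ∀ u, (nbr ((edges1 E).take (i + 1)) u).length =
      if u = a then d + 1 else (nbr ((edges1 E).take i) u).length := fun u => by
    rw [hL, nbr_concat]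
    split_ifs with h
    · simp [hd, h]
    · rfl
  refine ⟨⟨rfl, ?_, ?_, rfl, rfl, rfl, ?_, ?_, ?_, ?_⟩,
    ?_, ?_, hix, hptr, ?_, ?_, ?_, ?_, ?_, ?_, ?_⟩
  · exact (hconst 0 (by omega) (by omega)).trans hs.holds.one
  · exact (hconst 1 (by omega) (by omega)).trans hs.holds.N1
  · exact (hconst 5 (by omega) (by omega)).trans hs.holds.adj
  · exact (hconst 6 (by omega) (by omega)).trans hs.holds.out
  · exact (hconst 7 (by omega) (by omega)).trans hs.holds.hvy
  · exact (hconst 8 (by omega) (by omega)).trans hs.holds.zero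
  · exact (hconst 2 (by omega) (by omega)).trans hs.m
  · exact hdb.trans hs.db
  · intro y hy
    rw [hI y (by omega), hs.input y hy]
  · intro u hu v hv
    have hr := row_lt' hu hv
    rw [← hS] at hr
    have h0 := hsadj u hu v hv
    change s'.mem (2 * ((n + 1) * (n + 1)) + (u * (n + 1) + v)) ≠ 0 ↔ _
    change s.mem (2 * S + (u * (n + 1) + v)) ≠ 0 ↔ _ at h0
    rw [← hS, hA _ hr, hL, List.mem_append, ← h0]
    simp only [row_inj hv hbn, List.mem_singleton, Prod.mk.injEq]
    split_ifs with h <;> simp [h]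
  · intro u hu r hr
    have hrr := row_lt' hu hr
    rw [← hS] at hrr
    have h0 := hsout u hu r hr
    change s'.mem (3 * ((n + 1) * (n + 1)) + (u * (n + 1) + r)) = _
    change s.mem (3 * S + (u * (n + 1) + r)) = _ at h0
    rw [← hS, hO _ hrr, hL, nbr_concat, h0]
    simp only [row_inj hr hdn]
    by_cases hua : u = a
    · subst hua
      rw [if_pos rfl, getD_concat, ← hd]
      simp
    · simp [hua]
  · intro u hu
    have h0 := hsdeg u hu
    change s'.mem (5 * ((n + 1) * (n + 1)) + u) = _
    rw [← hS, hD _ hu, hlen, h0]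
  · rw [hq]
    have hnot : d = s.reg (rq k) → a ∉ hv := fun h ha => by
      have := (hvm a).mp ha
      omega
    refine ⟨if d = s.reg (rq k) then hv ++ [a] else hv, ?_, ?_, ?_, fun u => ?_⟩
    · rw [hH]
      split_ifs <;> simp [hvl]
    · intro r hr
      change r < (n + 1) * (n + 1) at hr
      change s'.mem (4 * ((n + 1) * (n + 1)) + r) = _
      rw [← hS] at hr ⊢
      have h0 : s.mem (4 * S + r) = _ := hvy r hr
      rw [hY r hr, h0]
      by_cases h : d = s.reg (rq k)
      · rw [if_pos h, getD_concat]
        simp [h]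
      · simp [h]
    · split_ifs with h
      · simpa [List.nodup_append, hvn] using fun x hx (hxa : x = a) => hnot h (hxa ▸ hx)
      · exact hvn
    · rw [hlen]
      by_cases hua : u = a
      · subst hua
        have := hvm u
        rw [← hd] at this
        rw [if_pos rfl]
        split_ifs with h
        · simp; omega
        · rw [this]; omega
      · rw [if_neg hua, ← hvm]
        split_ifs <;> simp [hua]
  · intro u
    rw [hlen, hlam]
    have := hs.lam_le u
    split_ifs <;> omega
  · obtain ⟨u, hu⟩ := hs.lam_eq
    by_cases h : s.reg (rlam k) < d + 1
    · exact ⟨a, by rw [hlam, hlen, if_pos h, if_pos rfl]⟩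
    · refine ⟨u, ?_⟩
      rw [hlam, if_neg h, hlen, if_neg, hu]
      rintro rfl
      omega

theorem preHeavy_spec {S a h d q : ℕ} (hw : 6 * S < 2 ^ w) (hS : 4 * S + h < 5 * S)
    (hb : s.reg (rHvy k) = 4 * S) (h1 : s.reg (rOne k) = 1) (hh : s.reg (pH k) = h)
    (ha : s.reg (pU k) = a) (hd : s.reg (pDeg k) = d) (hq : s.reg (rq k) = q) :
    Ex w (preHeavy k) s 7 fun s' =>
      s'.mem = (if d = q then Function.update s.mem (4 * S + h) a else s.mem) ∧
      s'.reg (pH k) = (if d = q then h + 1 else h) ∧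
      ∀ r, r ≠ pH k → r ≠ pAd k → s'.reg r = s.reg r := by
  refine Ex.ite (T₁ := 6) ?_ ?_ (by omega) <;> intro ht <;>
    simp only [Test.holds, hd, hq, decide_eq_true_eq, decide_eq_false_iff_not] at ht
  · refine Ex.block (by simp [Instr.IsDet]) ?_ (by simp)
    have e1 : (4 * S + h) % 2 ^ w = 4 * S + h := Nat.mod_eq_of_lt (by omega)
    have e2 : (h + 1) % 2 ^ w = h + 1 := Nat.mod_eq_of_lt (by omega)
    simp only [List.foldl_cons, List.foldl_nil, Instr.detExec, State.setReg, State.setMem, Op.eval]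
    simp only [if_pos ht]
    refine ⟨?_, ?_, fun r hr hr' => ?_⟩
    · simp [hb, hh, e1, ha]
    · simp [h1, hh, e2]
    · simp [hr, hr']
  · exact Ex.skip (by simp [ht, hh])

theorem preDeg_spec {S a d i l : ℕ} (hw : 6 * S < 2 ^ w) (hd' : d < S) (hi : i < S)
    (h1 : s.reg (rOne k) = 1) (h0 : s.reg (rZero k) = 0) (hd : s.reg (pDeg k) = d)
    (he : s.reg (pE k) = 5 * S + a) (hix : s.reg (pIx k) = i) (hl : s.reg (rlam k) = l) :
    Ex w (preDeg k) s 10 fun s' =>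
      s'.mem = Function.update s.mem (5 * S + a) (d + 1) ∧
      s'.reg (pIx k) = i + 1 ∧ s'.reg (rlam k) = (if l < d + 1 then d + 1 else l) ∧
      ∀ r, r ≠ pIx k → r ≠ pDeg k → r ≠ rlam k → s'.reg r = s.reg r := by
  have e1 : (d + 1) % 2 ^ w = d + 1 := Nat.mod_eq_of_lt (by omega)
  have e2 : (i + 1) % 2 ^ w = i + 1 := Nat.mod_eq_of_lt (by omega)
  refine Ex.seq (T₁ := 6) (T₂ := 2) ?_ (by omega)
  refine Ex.block (by simp [Instr.IsDet]) ?_ (by simp)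
  simp only [List.foldl_cons, List.foldl_nil, Instr.detExec, State.setReg, State.setMem, Op.eval]
  refine Ex.ite (T₁ := 1) ?_ ?_ (by omega) <;> intro ht <;>
    simp [Test.holds, hd, hl, h1, e1] at ht
  · refine Ex.arith ?_
    rw [if_pos (Nat.lt_succ_of_le ht)]
    refine ⟨?_, ?_, ?_, fun r hr hr' hr'' => ?_⟩
    · simp [State.setReg, hd, h1, he, e1]
    · simp [State.setReg, hix, h1, e2]
    · simp [State.setReg, hd, h1, e1, Op.eval, h0]
    · simp [State.setReg, hr, hr', hr'']
  · refine Ex.skip ?_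
    rw [if_neg (by omega)]
    refine ⟨?_, ?_, ?_, fun r hr hr' hr'' => ?_⟩
    · simp [hd, h1, he, e1]
    · simp [hix, h1, e2]
    · simp [hl]
    · simp [hr, hr']

theorem preStep_spec (hE : E.Nodup) (hw : 6 * ((n + 1) * (n + 1)) < 2 ^ w)
    (hm : E.length ≤ n * n) {i : ℕ} (hi : i < E.length) (hs : PreInv k E i s) :
    Ex w (.seq (preRead k) <| .seq (preHeavy k) (preDeg k)) s 50
      fun s' => PreInv k E (i + 1) s' ∧ s'.reg (rq k) = s.reg (rq k) := by
  have hu := E[i].1.isLt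
  have hdn := nbr_take_length_le hE i (E[i].1 + 1)
  have hnn : n * n + 2 * n + 1 = (n + 1) * (n + 1) := by ring
  have hhvy : s.reg (pH k) ≤ n := by
    obtain ⟨hv, hvl, -, hvn, hvm⟩ := hs.heavy
    rw [hvl]
    refine length_le_of_nodup hvn fun u hu => ?_
    have h := (hvm u).mp hu
    obtain ⟨v, hv⟩ :=
      List.exists_mem_of_length_pos (by omega : 0 < (nbr ((edges1 E).take i) u).length)
    have := mem_edges1_bound (List.mem_of_mem_take (mem_nbr.mp hv))
    omega
  refine Ex.seq (T₁ := 30) (T₂ := 18) ((preRead_spec hE hw hm hi hs).mono le_rfl ?_) (by omega)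
  rintro s1 ⟨h1u, h1p, h1e, h1d, h1m, h1r⟩
  refine Ex.seq (T₁ := 7) (T₂ := 10) ((preHeavy_spec (k := k) (S := (n + 1) * (n + 1))
    (h := s.reg (pH k)) hw (by omega) ?_ ?_ ?_ h1u h1d rfl).mono le_rfl ?_) (by omega)
  · rw [h1r _ (by simp)]; exact hs.holds.hvy
  · rw [h1r _ (by simp)]; exact hs.holds.one
  · rw [h1r _ (by simp)]
  rintro s2 ⟨h2m, h2h, h2r⟩
  refine (preDeg_spec (k := k) (S := (n + 1) * (n + 1)) (a := E[i].1 + 1) (i := i)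
    (d := (nbr ((edges1 E).take i) (E[i].1 + 1)).length) (l := s.reg (rlam k))
    hw (by omega) (by omega) ?_ ?_ ?_ ?_ ?_ ?_).mono le_rfl ?_
  · rw [h2r _ (by simp) (by simp), h1r _ (by simp)]; exact hs.holds.one
  · rw [h2r _ (by simp) (by simp), h1r _ (by simp)]; exact hs.holds.zero
  · rw [h2r _ (by simp) (by simp), h1d]
  · rw [h2r _ (by simp) (by simp), h1e]
  · rw [h2r _ (by simp) (by simp), h1r _ (by simp)]; exact hs.ix
  · rw [h2r _ (by simp) (by simp), h1r _ (by simp)]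
  rintro s3 ⟨h3m, h3i, h3l, h3r⟩
  have hq1 : s1.reg (rq k) = s.reg (rq k) := h1r _ (by simp)
  have hc : ∀ j < 9, j ≠ 3 → s3.reg (rg k j) = s.reg (rg k j) := fun j hj hj3 => by
    rw [h3r _ (by simp; omega) (by simp; omega) (by simpa using hj3),
      h2r _ (by simp; omega) (by simp; omega), h1r (rg k j) (.inl (by simp only [rg]; omega))]
  refine ⟨hs.step hE hm hi rfl rfl rfl rfl ?_ ?_ h3l h3i ?_ hc ?_, hc 4 (by omega) (by omega)⟩
  · rw [h3m, h2m, h1m, hq1]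
  · rw [h3r _ (by simp) (by simp) (by simp), h2h, hq1]
  · rw [h3r _ (by simp) (by simp) (by simp), h2r _ (by simp) (by simp), h1p]
  · rw [h3r _ (by simp) (by simp) (by simp), h2r _ (by simp) (by simp), h1r _ (by simp)]

end

section
variable {k n w : ℕ} {E : List (Fin n × Fin n)} {s s' : State}

/-- The rounded-up square root. -/
def ceilSqrt (m : ℕ) : ℕ := Nat.sqrt (m - 1) + 1

theorem le_ceilSqrt_sq (m : ℕ) : m ≤ ceilSqrt m * ceilSqrt m := by
  have := Nat.lt_succ_sqrt (m - 1)
  simp only [Nat.succ_eq_add_one] at this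
  unfold ceilSqrt
  omega

theorem sq_lt_of_lt_ceilSqrt {m i : ℕ} (hm : 1 ≤ m) (h : i < ceilSqrt m) : i * i < m := by
  have h1 : i ≤ Nat.sqrt (m - 1) := by unfold ceilSqrt at h; omega
  have h2 := Nat.le_sqrt.mp h1
  omega

theorem ceilSqrt_le {m n : ℕ} (hm : 1 ≤ m) (h : m ≤ n * n) : ceilSqrt m ≤ n := by
  have : Nat.sqrt (m - 1) < n := Nat.sqrt_lt.mpr (by omega)
  unfold ceilSqrt
  omega

theorem ceilSqrt_le_self {m : ℕ} (hm : 1 ≤ m) : ceilSqrt m ≤ m := by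
  have := Nat.sqrt_le_self (m - 1)
  unfold ceilSqrt
  omega

theorem ceilSqrt_sq_le {m : ℕ} (hm : 1 ≤ m) : ceilSqrt m * ceilSqrt m ≤ 4 * m := by
  have h1 := Nat.sqrt_le (m - 1)
  have h2 := Nat.sqrt_le_self (m - 1)
  unfold ceilSqrt
  have h3 : (Nat.sqrt (m - 1) + 1) * (Nat.sqrt (m - 1) + 1) =
    Nat.sqrt (m - 1) * Nat.sqrt (m - 1) + 2 * Nat.sqrt (m - 1) + 1 := by ring
  omega

theorem preConsts_spec (hw : 6 * ((n + 1) * (n + 1)) < 2 ^ w) :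
    Ex w (preConsts k) (inputState E) 20 fun s =>
      s.mem = inputMem E ∧ s.reg (rOne k) = 1 ∧ s.reg (rN1 k) = n + 1 ∧ s.reg (rm k) = E.length ∧
      s.reg (rAdj k) = 2 * ((n + 1) * (n + 1)) ∧ s.reg (rOut k) = 3 * ((n + 1) * (n + 1)) ∧
      s.reg (rHvy k) = 4 * ((n + 1) * (n + 1)) ∧ s.reg (pDB k) = 5 * ((n + 1) * (n + 1)) ∧
      s.reg (pP k) = 2 ∧ s.reg (rZero k) = 0 ∧ s.reg (rlam k) = 0 ∧ s.reg (rq k) = 0 ∧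
      s.reg (pQQ k) = 0 ∧ s.reg (pH k) = 0 ∧ s.reg (pIx k) = 0 := by
  have hnn : n * n + 2 * n + 1 = (n + 1) * (n + 1) := by ring
  set S := (n + 1) * (n + 1) with hS
  refine Ex.block (by simp [Instr.IsDet]) ?_ (by simp)
  have e0 : (inputState E).mem 0 = n := rfl
  have e1 : (inputState E).mem 1 = E.length := rfl
  have er : ∀ r, (inputState E).reg r = 0 := fun r => rfl
  have e2 : 1 % 2 ^ w = 1 := Nat.mod_eq_of_lt (by omega)
  have e3 : 2 % 2 ^ w = 2 := Nat.mod_eq_of_lt (by omega)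
  have e4 : (n + 1) % 2 ^ w = n + 1 := Nat.mod_eq_of_lt (by omega)
  have e5 : S % 2 ^ w = S := Nat.mod_eq_of_lt (by omega)
  have e6 : (S + S) % 2 ^ w = 2 * S := by rw [Nat.mod_eq_of_lt (by omega)]; ring
  have e7 : (2 * S + S) % 2 ^ w = 3 * S := by rw [Nat.mod_eq_of_lt (by omega)]; ring
  have e8 : (3 * S + S) % 2 ^ w = 4 * S := by rw [Nat.mod_eq_of_lt (by omega)]; ring
  have e9 : (4 * S + S) % 2 ^ w = 5 * S := by rw [Nat.mod_eq_of_lt (by omega)]; ring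
  simp only [List.foldl_cons, List.foldl_nil, Instr.detExec, State.setReg, Op.eval]
  refine ⟨rfl, ?_, ?_, ?_, ?_, ?_, ?_, ?_, ?_, ?_, ?_, ?_, ?_, ?_, ?_⟩ <;>
    simp [e0, e1, er, e2, e3, e4, ← hS, e5, e6, e7, e8, e9]

theorem preSqrt_spec {m : ℕ} (hm : 1 ≤ m) (hmn : m ≤ n * n) (hw : n * n < 2 ^ w) (hn : n < 2 ^ w)
    (hsm : s.reg (rm k) = m) (h1 : s.reg (rOne k) = 1) (hq : s.reg (rq k) = 0)
    (hqq : s.reg (pQQ k) = 0) :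
    Ex w (preSqrt k) s (6 * m + 1) fun s' => s'.mem = s.mem ∧ s'.reg (rq k) = ceilSqrt m ∧
      ∀ r, r ≠ rq k → r ≠ pQQ k → s'.reg r = s.reg r := by
  have hN := ceilSqrt_le hm hmn
  refine (Ex.loop_count (fun i s' => s'.mem = s.mem ∧ s'.reg (rq k) = i ∧
    s'.reg (pQQ k) = i * i ∧ ∀ r, r ≠ rq k → r ≠ pQQ k → s'.reg r = s.reg r)
    (ceilSqrt m) 4 ?_ ?_ ⟨rfl, hq, hqq, fun _ _ _ => rfl⟩).mono ?_
    fun s' h => ⟨h.1, h.2.1, h.2.2.2⟩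
  · rintro i hi s1 ⟨h1m, h1q, h1qq, h1r⟩
    refine ⟨?_, Ex.block (by simp [Instr.IsDet]) ?_ (by simp)⟩
    · simp only [Test.holds, h1qq, h1r (rm k) (by simp) (by simp), hsm, decide_eq_true_eq]
      exact sq_lt_of_lt_ceilSqrt hm hi
    · have e1 : (i + 1) % 2 ^ w = i + 1 := Nat.mod_eq_of_lt (by omega)
      have e2 : ((i + 1) * (i + 1)) % 2 ^ w = (i + 1) * (i + 1) := by
        refine Nat.mod_eq_of_lt (lt_of_le_of_lt ?_ hw)
        exact Nat.mul_le_mul (by omega) (by omega)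
      have h1o : s1.reg (rOne k) = 1 := (h1r _ (by simp) (by simp)).trans h1
      simp only [List.foldl_cons, List.foldl_nil, Instr.detExec, State.setReg, Op.eval]
      refine ⟨h1m, ?_, ?_, fun r hr hr' => ?_⟩
      · simp [h1q, h1o, e1]
      · simp [h1q, h1o, e1, e2]
      · simp [hr, hr', h1r r hr hr']
  · rintro s1 ⟨h1m, h1q, h1qq, h1r⟩
    simp only [Test.holds, h1qq, h1r (rm k) (by simp) (by simp), hsm, decide_eq_false_iff_not,
      not_lt]
    exact le_ceilSqrt_sq m
  · have := ceilSqrt_le_self hm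
    omega

theorem preProg_inv (hE : E.Nodup) (hw : 6 * ((n + 1) * (n + 1)) < 2 ^ w)
    (hm1 : 1 ≤ E.length) (hm : E.length ≤ n * n) :
    Ex w (preProg k) (inputState E) (100 * E.length)
      fun s => PreInv k E E.length s ∧ s.reg (rq k) = ceilSqrt E.length := by
  have hnn : n * n + 2 * n + 1 = (n + 1) * (n + 1) := by ring
  refine Ex.seq (T₁ := 20) (T₂ := 79 * E.length) ((preConsts_spec hw).mono le_rfl ?_) (by omega)
  rintro s ⟨hmem, h1, hN1, hsm, hadj, hout, hhvy, hdb, hp, h0, hl, hq, hqq, hh, hix⟩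
  refine Ex.seq (T₁ := 6 * E.length + 1) (T₂ := 52 * E.length + 1)
    ((preSqrt_spec (n := n) hm1 hm (by omega) (by omega) hsm h1 hq hqq).mono le_rfl ?_) (by omega)
  rintro s1 ⟨h1m, h1q, h1r⟩
  have hz : ∀ y, 2 + 2 * E.length ≤ y → s1.mem y = 0 := fun y hy => by
    rw [h1m, hmem, inputMem_of_le hy]
  refine (Ex.loop_count (fun i s => PreInv k E i s ∧ s.reg (rq k) = ceilSqrt E.length)
    E.length 50 ?_ ?_ ⟨?_, h1q⟩).mono (by omega) fun _ h => h
  · rintro i hi s ⟨hs, hq⟩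
    refine ⟨?_, (preStep_spec hE hw hm hi hs).mono le_rfl fun s' h => ⟨h.1, h.2.trans hq⟩⟩
    simp only [Test.holds, hs.ix, hs.m, decide_eq_true_eq]
    exact hi
  · rintro s ⟨hs, -⟩
    simp only [Test.holds, hs.ix, hs.m, decide_eq_false_iff_not, not_lt]
    exact le_rfl
  · have hS : (dataOf k n s1).S = (n + 1) * (n + 1) := rfl
    have hr : ∀ j ≠ 4, j ≠ 20 → s1.reg (rg k j) = s.reg (rg k j) := fun j h h' =>
      h1r _ (by simpa using h) (by simpa using h')
    refine ⟨⟨rfl, ?_, ?_, rfl, rfl, rfl, ?_, ?_, ?_, ?_⟩,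
      ?_, ?_, ?_, ?_, ?_, ?_, ?_, ?_, ?_, ?_, ?_⟩
    · exact (hr 0 (by simp) (by simp)).trans h1
    · exact (hr 1 (by simp) (by simp)).trans hN1
    · exact (hr 5 (by simp) (by simp)).trans hadj
    · exact (hr 6 (by simp) (by simp)).trans hout
    · exact (hr 7 (by simp) (by simp)).trans hhvy
    · exact (hr 8 (by simp) (by simp)).trans h0
    · exact (hr 2 (by simp) (by simp)).trans hsm
    · exact (hr 18 (by simp) (by simp)).trans hdb
    · exact (hr 17 (by simp) (by simp)).trans hix
    · exact (hr 9 (by simp) (by simp)).trans hp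
    · intro a _; rw [h1m, hmem]
    · intro u _ v _
      simp only [List.take_zero, List.not_mem_nil, iff_false, not_not]
      exact hz _ (by rw [hS]; omega)
    · intro u _ r _
      simp only [List.take_zero, nbr, List.filter_nil, List.map_nil, List.getD_nil]
      exact hz _ (by rw [hS]; omega)
    · intro u _
      simp only [List.take_zero, nbr, List.filter_nil, List.map_nil, List.length_nil]
      exact hz _ (by rw [hS]; omega)
    · refine ⟨[], (hr 16 (by simp) (by simp)).trans hh, ?_, List.nodup_nil, by simp [nbr]⟩
      intro r _
      rw [List.getD_nil]
      exact hz _ (by rw [hS]; omega)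
    · simp [nbr]
    · refine ⟨0, ?_⟩
      rw [(hr 3 (by simp) (by simp)).trans hl]
      simp [nbr]

theorem getD_ne_zero_iff {l : List ℕ} (hl : ∀ x ∈ l, 1 ≤ x) (r : ℕ) :
    l.getD r 0 ≠ 0 ↔ r < l.length := by
  constructor
  · intro h
    by_contra hr
    exact h (List.getD_eq_default _ _ (by omega))
  · intro h
    rw [List.getD_eq_getElem _ _ h]
    have := hl _ (List.getElem_mem h)
    omega

theorem getD_inj_of_nodup {l : List ℕ} (hl : l.Nodup) (h1 : ∀ x ∈ l, 1 ≤ x) {r r' : ℕ}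
    (h : l.getD r 0 = l.getD r' 0) (h0 : l.getD r 0 ≠ 0) : r = r' := by
  have hr := (getD_ne_zero_iff h1 r).mp h0
  have hr' := (getD_ne_zero_iff h1 r').mp (h ▸ h0)
  rw [List.getD_eq_getElem _ _ hr, List.getD_eq_getElem _ _ hr'] at h
  exact (hl.getElem_inj_iff).mp h

theorem getD_le {l : List ℕ} {b : ℕ} (hl : ∀ x ∈ l, x ≤ b) (r : ℕ) : l.getD r 0 ≤ b := by
  by_cases hr : r < l.length
  · rw [List.getD_eq_getElem _ _ hr]
    exact hl _ (List.getElem_mem hr)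
  · rw [List.getD_eq_default _ _ (by omega)]
    exact Nat.zero_le _

theorem exists_getD_of_mem {l : List ℕ} {x : ℕ} (h : x ∈ l) : ∃ r < l.length, l.getD r 0 = x := by
  obtain ⟨r, hr, rfl⟩ := List.getElem_of_mem h
  exact ⟨r, hr, List.getD_eq_getElem _ _ hr⟩

variable {G : Digraph (Fin n)}

theorem mem_edges1 {u v : Fin n} : ((u : ℕ) + 1, (v : ℕ) + 1) ∈ edges1 E ↔ (u, v) ∈ E := by
  simp [edges1, Fin.val_inj]

theorem length_nbr_le_ncard (hE : E.Nodup) (hG : ∀ u v, (u, v) ∈ E ↔ G.Adj u v) (u : Fin n) :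
    (nbr (edges1 E) (u + 1)).length ≤ {v | G.Adj u v}.ncard := by
  have h1 : (fun v : Fin n => (v : ℕ) + 1) '' {v | G.Adj u v} =
      ((nbr (edges1 E) (u + 1)).toFinset : Set ℕ) := by
    ext x
    simp only [Set.mem_image, Set.mem_ofPred_eq, List.coe_toFinset, mem_nbr]
    constructor
    · rintro ⟨v, hv, rfl⟩
      exact mem_edges1.mpr ((hG u v).mpr hv)
    · intro h
      have hb := mem_edges1_bound h
      have hx : x = ((⟨x - 1, by omega⟩ : Fin n) : ℕ) + 1 := by simp; omega
      refine ⟨⟨x - 1, by omega⟩, ?_, hx.symm⟩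
      rw [hx] at h
      exact (hG _ _).mp (mem_edges1.mp h)
  have h2 : ({v | G.Adj u v}).ncard = _ := (Set.ncard_image_of_injective _ (f := fun v : Fin n =>
    (v : ℕ) + 1) (by intro a b h; simpa [Fin.val_inj] using h)).symm
  rw [h2, h1, Set.ncard_coe_finset,
    List.toFinset_card_of_nodup (nodup_nbr (nodup_edges1 hE) _)]

/-- The preprocessing builds the data structure in linear time. -/
theorem preProg_spec (hE : E.Nodup) (hG : ∀ u v, (u, v) ∈ E ↔ G.Adj u v)
    (hw : 6 * ((n + 1) * (n + 1)) < 2 ^ w) (hm1 : 1 ≤ E.length) (hm : E.length ≤ n * n) {lam : ℕ}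
    (hlam : ∀ u : Fin n, {v | G.Adj u v}.ncard ≤ lam) :
    Ex w (preProg k) (inputState E) (100 * E.length) fun s => ∃ D : Data, Holds k D s ∧
      D.Valid w ∧ D.Rep G ∧ D.m = E.length ∧ D.lam ≤ lam ∧ D.lam ≤ D.m ∧
      D.q * D.q ≤ 4 * D.m := by
  refine (preProg_inv hE hw hm1 hm).mono le_rfl ?_
  rintro s ⟨hs, hq⟩
  have htake : (edges1 E).take E.length = edges1 E :=
    List.take_of_length_le (by simp [edges1])
  have hle := nbr_take_length_le hE E.length
  have hadj := hs.adj
  have hout := hs.out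
  obtain ⟨hv, -, hvy, hvn, hvm⟩ := hs.heavy
  have hlam1 := hs.lam_le
  obtain ⟨u0, hu0⟩ := hs.lam_eq
  simp only [htake] at hle hadj hout hvm hlam1 hu0
  have hnb : ∀ u, ∀ x ∈ nbr (edges1 E) u, 1 ≤ u ∧ u ≤ n ∧ 1 ≤ x ∧ x ≤ n := fun u x hx =>
    mem_edges1_bound (mem_nbr.mp hx)
  have hvb : ∀ x ∈ hv, 1 ≤ x ∧ x ≤ n := fun x hx => by
    have := (hvm x).mp hx
    obtain ⟨v, hv⟩ := List.exists_mem_of_length_pos (by omega : 0 < (nbr (edges1 E) x).length)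
    have := hnb x v hv
    omega
  -- more than `q` vertices of out-degree above `q` would have more than `q ^ 2 ≥ m` edges
  have hvq : hv.length ≤ s.reg (rq k) := by
    have h1 := sum_length_nbr_le (edges1 E) hv.toFinset
    have h2 : hv.toFinset.card * (s.reg (rq k) + 1) ≤
        ∑ u ∈ hv.toFinset, (nbr (edges1 E) u).length := by
      rw [← smul_eq_mul]
      refine Finset.card_nsmul_le_sum _ _ _ fun u hu => ?_
      have := (hvm u).mp (by simpa using hu)
      omega
    rw [List.toFinset_card_of_nodup hvn] at h2
    have h3 := le_ceilSqrt_sq E.length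
    rw [← hq] at h3
    have h4 : (edges1 E).length = E.length := by simp [edges1]
    by_contra h
    nlinarith
  have hqn : s.reg (rq k) ≤ n := hq ▸ ceilSqrt_le hm1 hm
  have hqS : s.reg (rq k) < (dataOf k n s).S := by rw [S_dataOf]; nlinarith
  have hlam0 : 1 ≤ s.reg (rlam k) := by
    have h1 : E[0] ∈ E := List.getElem_mem (by omega)
    have h2 := mem_nbr.mpr (mem_edges1.mpr h1)
    exact (List.length_pos_of_mem h2).trans_le (hlam1 _)
  have hlamn : s.reg (rlam k) ≤ n := hu0 ▸ hle u0
  have hin : ∀ r (hr : r < E.length), s.mem (2 + 2 * r) = E[r].1 ∧ s.mem (3 + 2 * r) = E[r].2 :=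
    fun r hr => by
    rw [hs.input _ (by omega), hs.input _ (by omega)]
    exact inputMem_edge hr
  have hm' : (dataOf k n s).m = E.length := hs.m
  have hlen : ∀ u, (nbr (edges1 E) u).length ≤ n := hle
  refine ⟨dataOf k n s, hs.holds, ⟨?_, hlam0, ?_, ?_, hlamn, hqn, ?_, ?_, ?_, ?_, hw⟩,
    ⟨rfl, hlamn, hqn, ?_, ?_, ?_, ?_, ?_, ?_, ?_, ?_, ?_⟩, hm', ?_, ?_, ?_⟩
  · rw [hm']; exact hm1
  · change 1 ≤ s.reg (rq k)
    rw [hq]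
    exact Nat.le_add_left _ _
  · rw [hm']; exact hm
  · intro r hr
    rw [hm'] at hr
    change s.mem _ + 1 ≤ n
    rw [(hin r hr).1]
    exact E[r].1.isLt
  · intro r hr
    rw [hm'] at hr
    change s.mem _ + 1 ≤ n
    rw [(hin r hr).2]
    exact E[r].2.isLt
  · intro u hu r hr
    rw [hout u hu r hr]
    exact getD_le (fun x hx => (hnb u x hx).2.2.2) r
  · intro r hr
    rw [hvy r (hr.trans hqS)]
    exact getD_le (fun x hx => (hvb x hx).2) r
  · intro u v hu hv
    rw [hadj u hu v hv]
    constructor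
    · intro h
      simp only [edges1, List.mem_map, Prod.mk.injEq, Prod.exists] at h
      obtain ⟨a, b, h, rfl, rfl⟩ := h
      exact ⟨a, b, rfl, rfl, (hG _ _).mp h⟩
    · rintro ⟨u', v', rfl, rfl, h⟩
      exact mem_edges1.mpr ((hG _ _).mpr h)
  · intro u v huv
    obtain ⟨r, hr, h⟩ := List.getElem_of_mem ((hG u v).mpr huv)
    refine ⟨r, by rw [hm']; exact hr, ?_, ?_⟩
    · change s.mem _ + 1 = _
      rw [(hin r hr).1, h]
    · change s.mem _ + 1 = _
      rw [(hin r hr).2, h]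
  · intro r hr r' hr' h1 h2
    rw [hm'] at hr hr'
    change s.mem _ + 1 = s.mem _ + 1 at h1
    change s.mem _ + 1 = s.mem _ + 1 at h2
    rw [(hin r hr).1, (hin r' hr').1, Nat.add_right_cancel_iff, Fin.val_inj] at h1
    rw [(hin r hr).2, (hin r' hr').2, Nat.add_right_cancel_iff, Fin.val_inj] at h2
    exact (hE.getElem_inj_iff).mp (Prod.ext h1 h2)
  · intro u v huv
    obtain ⟨r, hr, h⟩ := exists_getD_of_mem (mem_nbr.mpr (mem_edges1.mpr ((hG u v).mpr huv)))
    refine ⟨r, hr.trans_le (hlam1 _), ?_⟩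
    rw [hout _ u.isLt r (hr.le.trans (hlen _)), h]
  · intro u hu r hr r' hr' h h0
    rw [hout u hu r hr] at h h0
    rw [hout u hu r' hr'] at h
    exact getD_inj_of_nodup (nodup_nbr (nodup_edges1 hE) u) (fun x hx => (hnb u x hx).2.2.1) h h0
  · intro u hu r hr h0 h1
    have hpos : ∀ x ∈ nbr (edges1 E) u, 1 ≤ x := fun x hx => (hnb u x hx).2.2.1
    rw [hout u hu r hr, getD_ne_zero_iff hpos] at h0
    have h2 := (getD_ne_zero_iff hpos (s.reg (rq k))).not.mp
      (by rw [← hout u hu _ hqn]; exact not_not.mpr h1)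
    change r < s.reg (rq k)
    omega
  · intro u h
    have hpos : ∀ x ∈ nbr (edges1 E) (u + 1), 1 ≤ x := fun x hx => (hnb _ x hx).2.2.1
    change (dataOf k n s).out (u + 1) (s.reg (rq k)) ≠ 0 at h
    rw [hout (u + 1) u.isLt _ hqn, getD_ne_zero_iff hpos] at h
    obtain ⟨r, hr, h1⟩ := exists_getD_of_mem ((hvm _).mpr h)
    exact ⟨r, hr.trans_le hvq, by rw [hvy r ((hr.trans_le hvq).trans hqS), h1]⟩
  · intro r hr h0
    have hpos : ∀ u, ∀ x ∈ nbr (edges1 E) u, 1 ≤ x := fun u x hx => (hnb _ x hx).2.2.1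
    rw [hvy r (lt_trans hr hqS)] at h0 ⊢
    have hr' := (getD_ne_zero_iff (fun x hx => (hvb x hx).1) r).mp h0
    have hmem : hv.getD r 0 ∈ hv := by
      rw [List.getD_eq_getElem _ _ hr']
      exact List.getElem_mem hr'
    change (dataOf k n s).out _ (s.reg (rq k)) ≠ 0
    rw [hout _ (hvb _ hmem).2 _ hqn, getD_ne_zero_iff (hpos _)]
    exact (hvm _).mp hmem
  · intro r hr r' hr' h h0
    rw [hvy r (lt_trans hr hqS)] at h h0
    rw [hvy r' (lt_trans hr' hqS)] at h
    exact getD_inj_of_nodup hvn (fun x hx => (hvb x hx).1) h h0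
  · change s.reg (rlam k) ≤ lam
    obtain ⟨v, hv⟩ := List.exists_mem_of_length_pos (by omega : 0 < (nbr (edges1 E) u0).length)
    have hb := hnb _ _ hv
    have h1 : u0 = ((⟨u0 - 1, by omega⟩ : Fin n) : ℕ) + 1 := by simp; omega
    rw [hu0, h1]
    exact (length_nbr_le_ncard hE hG _).trans (hlam _)
  · rw [hm']
    change s.reg (rlam k) ≤ _
    rw [hu0]
    have := sum_length_nbr_le (edges1 E) {u0}
    simpa [edges1] using this
  · rw [hm']
    change s.reg (rq k) * s.reg (rq k) ≤ _
    rw [hq]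
    exact ceilSqrt_sq_le hm1

end

open scoped Finset

/-! ### Lower bounds for the polymatroid bound -/

section
variable {V : Type*} [DecidableEq V] {P : Digraph V} {m lam : ℕ}

/-- The number of members of `F` that meet `X`. -/
def meetCount (F : Finset (Finset V)) (X : Finset V) : ℕ := #{U ∈ F | ¬ Disjoint U X}

theorem meetCount_union_add_inter_le (F : Finset (Finset V)) (X Y : Finset V) :
    meetCount F (X ∪ Y) + meetCount F (X ∩ Y) ≤ meetCount F X + meetCount F Y := by
  unfold meetCount
  rw [← Finset.card_union_add_card_inter {U ∈ F | ¬ Disjoint U X} {U ∈ F | ¬ Disjoint U Y}]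
  refine Nat.add_le_add (Finset.card_le_card fun U hU => ?_) (Finset.card_le_card fun U hU => ?_)
  · simp only [Finset.mem_union, Finset.mem_filter, Finset.disjoint_union_right] at hU ⊢
    tauto
  · simp only [Finset.mem_inter, Finset.mem_filter] at hU ⊢
    exact ⟨⟨hU.1, fun h => hU.2 (h.mono_right Finset.inter_subset_left)⟩,
      ⟨hU.1, fun h => hU.2 (h.mono_right Finset.inter_subset_right)⟩⟩

theorem meetCount_mono (F : Finset (Finset V)) {X Y : Finset V} (h : X ⊆ Y) :
    meetCount F X ≤ meetCount F Y :=
  Finset.card_le_card <| Finset.monotone_filter_right _ fun _ _ hU h' => hU (h'.mono_right h)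

/-- The polymatroids that are used as lower bounds: a modular function plus a multiple of the
number of members of a family of sets that are met. -/
def weightFn (x : V → ℝ≥0) (c : ℝ≥0) (F : Finset (Finset V)) (X : Finset V) : ℝ≥0 :=
  ∑ v ∈ X, x v + c * meetCount F X

theorem weightFn_mem_polymatroids (x : V → ℝ≥0) (c : ℝ≥0) (F : Finset (Finset V)) :
    weightFn x c F ∈ polymatroids V := by
  refine ⟨by simp [weightFn, meetCount], fun X Y h => ?_, fun X Y => ?_⟩
  · exact add_le_add (Finset.sum_le_sum_of_subset h)
      (mul_le_mul_right (Nat.cast_le.mpr (meetCount_mono F h)) c)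
  · have h1 : ∑ v ∈ X ∪ Y, x v + ∑ v ∈ X ∩ Y, x v = ∑ v ∈ X, x v + ∑ v ∈ Y, x v :=
      Finset.sum_union_inter
    have h2 : (meetCount F (X ∪ Y) + meetCount F (X ∩ Y) : ℝ≥0) ≤
        meetCount F X + meetCount F Y := by
      exact_mod_cast meetCount_union_add_inter_le F X Y
    calc weightFn x c F (X ∪ Y) + weightFn x c F (X ∩ Y)
        = (∑ v ∈ X ∪ Y, x v + ∑ v ∈ X ∩ Y, x v) +
          c * (meetCount F (X ∪ Y) + meetCount F (X ∩ Y)) := by unfold weightFn; ring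
      _ ≤ (∑ v ∈ X, x v + ∑ v ∈ Y, x v) + c * (meetCount F X + meetCount F Y) := by
        rw [h1]; gcongr
      _ = _ := by unfold weightFn; ring

variable [Fintype V]

/-- A polymatroid of the form `weightFn` that obeys the rules bounds `polymatDir` from below. -/
theorem le_polymatDir (x : V → ℝ) (hx : ∀ v, 0 ≤ x v) (c : ℝ) (hc : 0 ≤ c)
    (F : Finset (Finset V)) (hF : ∀ U ∈ F, U.Nonempty) (hP : SimpleDi P)
    (h1 : ∀ u v, P.Adj u v → x u + x v + c * meetCount F {u, v} ≤ Real.logb 2 m)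
    (h2 : ∀ u v, P.Adj u v →
      x v + c * (meetCount F {u, v} - meetCount F {u}) ≤ Real.logb 2 lam) :
    ENNReal.ofReal (2 ^ (∑ v, x v + c * #F)) ≤ polymatDir m lam P := by
  lift x to V → ℝ≥0 using hx
  lift c to ℝ≥0 using hc
  have hu : meetCount F Finset.univ = #F := by
    unfold meetCount
    rw [Finset.filter_true_of_mem]
    intro U hU h
    have := hF U hU
    rw [Finset.disjoint_left] at h
    obtain ⟨v, hv⟩ := this
    exact h hv (Finset.mem_univ v)
  have h : ∑ v, (x v : ℝ) + c * #F = (weightFn x c F Finset.univ : ℝ) := by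
    simp [weightFn, hu]
  rw [h]
  refine le_iSup₂_of_le (weightFn x c F) ⟨weightFn_mem_polymatroids x c F, ?_⟩ le_rfl
  rintro r ⟨u, v, huv, rfl | rfl⟩
  · have hne : u ≠ v := fun h => hP v (h ▸ huv)
    have := h1 u v huv
    simp only [weightFn, Finset.sum_pair hne]
    simpa [meetCount] using this
  · have hne : u ≠ v := fun h => hP v (h ▸ huv)
    have := h2 u v huv
    simp only [weightFn, Finset.sum_pair hne, Finset.sum_singleton]
    push_cast
    linarith

theorem polymatDir_mono {lam' : ℕ} (h0 : 1 ≤ lam) (h : lam ≤ lam') :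
    polymatDir m lam P ≤ polymatDir m lam' P := by
  refine iSup₂_le fun f hf => le_iSup₂_of_le f ⟨hf.1, ?_⟩ le_rfl
  rintro r ⟨u, v, huv, rfl | rfl⟩
  · exact hf.2 _ ⟨u, v, huv, .inl rfl⟩
  · refine (hf.2 _ ⟨u, v, huv, .inr rfl⟩).trans ?_
    exact Real.logb_le_logb_of_le (by norm_num) (by exact_mod_cast h0) (by exact_mod_cast h)

/-! ### Matchings and vertex covers -/

/-- A set `X` that maximizes the deficiency `#X - #N(X)`. -/
theorem exists_max_deficiency (t : V → Finset V) :
    ∃ X : Finset V, ∀ A : Finset V, #A + #(X.biUnion t) ≤ #(A.biUnion t) + #X := by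
  obtain ⟨X, -, hX⟩ := Finset.exists_max_image (Finset.univ : Finset (Finset V))
    (fun X => (#X : ℤ) - #(X.biUnion t)) Finset.univ_nonempty
  refine ⟨X, fun A => ?_⟩
  have := hX A (Finset.mem_univ A)
  omega

/-- The theorem of König: a matching and a vertex cover of the same size, in the bipartite graph
given by `t`. It follows from the theorem of Hall, with as many dummies as the maximum deficiency
added to every neighbourhood. -/
theorem exists_matching_cover (t : V → Finset V) :
    ∃ (I : Finset V) (g : V → V) (C : Finset V), Set.InjOn g I ∧ (∀ i ∈ I, g i ∈ t i) ∧
      (∀ u, ∀ v ∈ t u, u ∈ C ∨ v ∈ C) ∧ #C ≤ #I := by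
  obtain ⟨X, hX⟩ := exists_max_deficiency t
  have h0 := hX ∅
  simp only [Finset.card_empty, Finset.biUnion_empty, zero_add] at h0
  obtain ⟨f, hf, hft⟩ := (Finset.all_card_le_biUnion_card_iff_exists_injective
    (fun v => (t v).disjSum (Finset.univ : Finset (Fin (#X - #(X.biUnion t)))))).mp fun A => by
      rcases A.eq_empty_or_nonempty with rfl | ⟨a, ha⟩
      · simp
      · have h1 : ((A.biUnion t).disjSum (Finset.univ : Finset (Fin (#X - #(X.biUnion t))))) ⊆
            A.biUnion fun v =>
              (t v).disjSum (Finset.univ : Finset (Fin (#X - #(X.biUnion t)))) := by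
          rintro (v | i) h
          · simpa using h
          · simpa using ⟨a, ha⟩
        refine le_trans ?_ (Finset.card_le_card h1)
        rw [Finset.card_disjSum, Finset.card_univ, Fintype.card_fin]
        have := hX A
        omega
  let I : Finset V := {v | (f v).isLeft}
  have hI : #Iᶜ ≤ #X - #(X.biUnion t) := by
    have h1 : #(Iᶜ.image f) ≤ #((Finset.univ : Finset (Fin (#X - #(X.biUnion t)))).image
        (Sum.inr : _ → V ⊕ _)) := by
      refine Finset.card_le_card fun w hw => ?_
      obtain ⟨v, hv, rfl⟩ := Finset.mem_image.mp hw
      cases h : f v with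
      | inl a => simp [I, h] at hv
      | inr a => simp
    rw [Finset.card_image_of_injective _ hf] at h1
    refine h1.trans (Finset.card_image_le.trans ?_)
    simp
  refine ⟨I, fun v => (f v).elim id fun _ => v, Xᶜ ∪ X.biUnion t, ?_, ?_, ?_, ?_⟩
  · intro u hu v hv h
    simp only [I, Finset.coe_filter, Finset.mem_univ, true_and, Set.mem_ofPred_eq,
      Sum.isLeft_iff] at hu hv
    obtain ⟨a, ha⟩ := hu
    obtain ⟨b, hb⟩ := hv
    simp only [ha, hb, Sum.elim_inl, id] at h
    exact hf (by rw [ha, hb, h])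
  · intro v hv
    simp only [I, Finset.mem_filter, Finset.mem_univ, true_and, Sum.isLeft_iff] at hv
    obtain ⟨a, ha⟩ := hv
    have := hft v
    rw [ha] at this
    simpa [ha] using this
  · intro u v hv
    by_cases hu : u ∈ X
    · exact .inr (Finset.mem_union_right _ (Finset.mem_biUnion.mpr ⟨u, hu, hv⟩))
    · exact .inl (Finset.mem_union_left _ (by simpa using hu))
  · have h1 := Finset.card_union_le Xᶜ (X.biUnion t)
    have h2 := Finset.card_add_card_compl X
    have h3 := Finset.card_add_card_compl I
    omega

end

/-! ### Sequences of steps without case distinction -/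

section
variable {k : ℕ} {P : Digraph (Fin k)} {K A B L : Finset (Fin k)} {b b' : List (Stp k)}
  {α α' β β' : ℕ} {u v : Fin k}

theorem known_append (K : Finset (Fin k)) (b b' : List (Stp k)) :
    known K (b ++ b') = known (known K b) b' := List.foldl_append

theorem ordered_append : Ordered K (b ++ b') ↔ Ordered K b ∧ Ordered (known K b) b' := by
  induction b generalizing K with
  | nil => simp [Ordered, known]
  | cons s b ih => simp only [List.cons_append, Ordered, ih, and_assoc]; rfl

theorem known_union (K L : Finset (Fin k)) (b : List (Stp k)) :
    known (K ∪ L) b = known K b ∪ L := by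
  induction b generalizing K with
  | nil => rfl
  | cons s b ih =>
    change known (K ∪ L ∪ s.sets) b = known (K ∪ s.sets) b ∪ L
    rw [Finset.union_right_comm, ih]

theorem Ordered.mono (h : Ordered K b) (hKL : K ⊆ L) : Ordered L b := by
  induction b generalizing K L with
  | nil => trivial
  | cons s b ih =>
    exact ⟨h.1.trans hKL, ih h.2 (Finset.union_subset_union_left hKL)⟩

/-- The steps in `b`, each of which is of kind `edge` or `lam`, extend the set of known vertices
from `K` to `A`, with `α` steps of the first and `β` of the second kind. -/
structure Seg (P : Digraph (Fin k)) (K A : Finset (Fin k)) (b : List (Stp k)) (α β : ℕ) :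
    Prop where
  ordered : Ordered K b
  known : known K b = A
  onP : ∀ s ∈ b, s.OnP P
  compat : ∀ s ∈ b, ∀ H, s.Compat H
  prod : ∀ D, prodRad D b = D.m ^ α * D.lam ^ β

namespace Seg

theorem nil : Seg P K K [] 0 0 := ⟨trivial, rfl, by simp, by simp, by simp [prodRad]⟩

theorem edge (h : P.Adj u v) (hb : Seg P (K ∪ {u, v}) A b α β) :
    Seg P K A (.edge u v :: b) (α + 1) β :=
  ⟨⟨Finset.empty_subset _, hb.ordered⟩, hb.known, by simpa [Stp.OnP, h] using hb.onP,
    by simpa [Stp.Compat] using hb.compat, fun D => by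
      have := hb.prod D
      simp only [prodRad, List.map_cons, List.prod_cons, Stp.rad] at this ⊢
      rw [this]; ring⟩

theorem lam (h : P.Adj u v) (hu : u ∈ K) (hb : Seg P (K ∪ {v}) A b α β) :
    Seg P K A (.lam u v :: b) α (β + 1) :=
  ⟨⟨by simpa [Stp.needs] using hu, hb.ordered⟩, hb.known, by simpa [Stp.OnP, h] using hb.onP,
    by simpa [Stp.Compat] using hb.compat, fun D => by
      have := hb.prod D
      simp only [prodRad, List.map_cons, List.prod_cons, Stp.rad] at this ⊢
      rw [this]; ring⟩

theorem append (hb : Seg P K A b α β) (hb' : Seg P A B b' α' β') :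
    Seg P K B (b ++ b') (α + α') (β + β') :=
  ⟨ordered_append.mpr ⟨hb.ordered, hb.known ▸ hb'.ordered⟩,
    by rw [known_append, hb.known, hb'.known],
    fun s hs => (List.mem_append.mp hs).elim (hb.onP s) (hb'.onP s),
    fun s hs => (List.mem_append.mp hs).elim (hb.compat s) (hb'.compat s), fun D => by
      have h1 := hb.prod D
      have h2 := hb'.prod D
      simp only [prodRad, List.map_append, List.prod_append] at h1 h2 ⊢
      rw [h1, h2]; ring⟩

/-- One `edge` step for each vertex of `S`, along the edge to `g s`. -/
theorem edges (S : Finset (Fin k)) (g : Fin k → Fin k) (hS : ∀ s ∈ S, P.Adj s (g s))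
    (hb : Seg P (K ∪ (S ∪ S.image g)) A b α β) : ∃ b', Seg P K A b' (α + #S) β := by
  induction S using Finset.induction_on generalizing K with
  | empty => exact ⟨b, by simpa using hb⟩
  | insert s S hs ih =>
    have h : K ∪ (insert s S ∪ (insert s S).image g) = K ∪ {s, g s} ∪ (S ∪ S.image g) := by
      ext x; simp only [Finset.mem_union, Finset.mem_insert, Finset.mem_image,
        Finset.mem_singleton, exists_eq_or_imp, eq_comm (a := x)]; tauto
    rw [h] at hb
    obtain ⟨b', hb'⟩ := ih (fun s hs => hS s (by simp [hs])) hb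
    refine ⟨.edge s (g s) :: b', ?_⟩
    rw [Finset.card_insert_of_notMem hs, ← add_assoc]
    exact hb'.edge (hS s (by simp))

theorem famOK (hb : Seg P ∅ Finset.univ b α β) : FamOK P [b] α β 0 where
  ordered := by simpa using ⟨hb.ordered, hb.known⟩
  onP := by simpa using hb.onP
  uniq H := by
    refine ⟨0, ⟨b, rfl, fun s hs => hb.compat s hs H⟩, ?_⟩
    rintro i ⟨b', hi, -⟩
    cases i with
    | zero => rfl
    | succ i => simp at hi
  prod := by simpa using hb.prod

end Seg

theorem card_compl_union_lt (hv : v ∉ K) (hvL : v ∈ L) : #(K ∪ L)ᶜ < #Kᶜ := by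
  refine Finset.card_lt_card ⟨fun x hx => ?_, fun h => ?_⟩
  · simp only [Finset.mem_compl, Finset.mem_union, not_or] at hx ⊢
    exact hx.1
  · have := h (Finset.mem_compl.mpr hv)
    simp [hvL] at this

/-- The set contains all the predecessors of its members. -/
def PredClosed (P : Digraph (Fin k)) (U : Finset (Fin k)) : Prop := ∀ v ∈ U, ∀ u, P.Adj u v → u ∈ U

/-- Starting from the known vertices `K`, the greedy process determines the remaining vertices, two
at a time only when this is unavoidable, because of a set closed under predecessors that is disjoint
from the known vertices. The sets found in this way are disjoint: a minimal set `U` that met a later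
one `U'` would be contained in it, although a vertex of `U` is known from then on. -/
theorem exists_greedy (hP : SimpleDi P) (hK : ∀ v ∉ K, ∃ u, P.Adj u v) :
    ∃ (b : List (Stp k)) (F : Finset (Finset (Fin k))) (β : ℕ), Seg P K Finset.univ b #F β ∧
      β + 2 * #F = #Kᶜ ∧ (∀ U ∈ F, U.Nonempty ∧ PredClosed P U ∧ Disjoint U K) ∧
      ∀ U ∈ F, ∀ U' ∈ F, U ≠ U' → Disjoint U U' := by
  classical
  induction h : #Kᶜ using Nat.strong_induction_on generalizing K with
  | _ N ih =>
  subst h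
  by_cases huniv : K = Finset.univ
  · subst huniv
    exact ⟨[], ∅, 0, by simpa using Seg.nil, by simp, by simp, by simp⟩
  by_cases hex : ∃ v ∉ K, ∃ u ∈ K, P.Adj u v
  · obtain ⟨v, hv, u, hu, huv⟩ := hex
    obtain ⟨b, F, β, hb, hβ, hF, hF'⟩ := ih _ (card_compl_union_lt (L := {v}) hv (by simp))
      (fun v hv => hK v fun h => hv (Finset.mem_union_left _ h)) rfl
    refine ⟨_, F, β + 1, hb.lam huv hu, ?_, fun U hU => ⟨(hF U hU).1, (hF U hU).2.1,
      (hF U hU).2.2.mono_right Finset.subset_union_left⟩, hF'⟩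
    have h1 := Finset.card_add_card_compl K
    have h2 := Finset.card_add_card_compl (K ∪ {v})
    rw [Finset.card_union_of_disjoint (by simpa using hv), Finset.card_singleton] at h2
    omega
  · push Not at hex
    have hne : Kᶜ.Nonempty := by
      rw [Finset.nonempty_iff_ne_empty, Ne, Finset.compl_eq_empty_iff]
      exact huniv
    -- a minimal set of unknown vertices that is closed under predecessors
    obtain ⟨U, hU, hmin⟩ := Finset.exists_min_image
      ({U | U.Nonempty ∧ PredClosed P U ∧ Disjoint U K} : Finset (Finset (Fin k))) Finset.card
      ⟨Kᶜ, by
        simp only [Finset.mem_filter, Finset.mem_univ, true_and]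
        refine ⟨hne, fun v hv u huv => ?_, disjoint_compl_left⟩
        rw [Finset.mem_compl] at hv ⊢
        exact fun hu => hex v hv u hu huv⟩
    simp only [Finset.mem_filter, Finset.mem_univ, true_and] at hU hmin
    obtain ⟨⟨v, hv⟩, hUc, hUK⟩ := hU
    have hvK := Finset.disjoint_left.mp hUK hv
    obtain ⟨u, huv⟩ := hK v hvK
    have hu := hUc v hv u huv
    have huK := Finset.disjoint_left.mp hUK hu
    obtain ⟨b, F, β, hb, hβ, hF, hF'⟩ := ih _ (card_compl_union_lt (L := {u, v}) hvK (by simp))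
      (fun v hv => hK v fun h => hv (Finset.mem_union_left _ h)) rfl
    have hdisj : ∀ U' ∈ F, Disjoint U U' := fun U' hU' => by
      obtain ⟨h1, h2, h3⟩ := hF U' hU'
      rw [Finset.disjoint_iff_inter_eq_empty]
      by_contra hne
      have hle := hmin (U ∩ U') ⟨Finset.nonempty_iff_ne_empty.mpr hne, fun v hv u huv => by
        rw [Finset.mem_inter] at hv ⊢
        exact ⟨hUc v hv.1 u huv, h2 v hv.2 u huv⟩, hUK.mono_left Finset.inter_subset_left⟩
      have heq := Finset.eq_of_subset_of_card_le Finset.inter_subset_left hle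
      have huU' : u ∈ U' := Finset.inter_eq_left.mp heq hu
      exact Finset.disjoint_left.mp h3 huU' (by simp)
    have hUF : U ∉ F := fun h => by
      have := hdisj U h
      rw [disjoint_self, Finset.bot_eq_empty] at this
      rw [this] at hv
      simp at hv
    refine ⟨.edge u v :: b, insert U F, β, ?_, ?_, ?_, ?_⟩
    · rw [Finset.card_insert_of_notMem hUF]
      exact hb.edge huv
    · rw [Finset.card_insert_of_notMem hUF]
      have hne : u ≠ v := fun h => hP v (h ▸ huv)
      have h1 := Finset.card_add_card_compl K
      have h2 := Finset.card_add_card_compl (K ∪ {u, v})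
      rw [Finset.card_union_of_disjoint (by simpa using ⟨huK, hvK⟩), Finset.card_pair hne] at h2
      omega
    · intro U' hU'
      rcases Finset.mem_insert.mp hU' with rfl | hU'
      · exact ⟨⟨v, hv⟩, hUc, hUK⟩
      · exact ⟨(hF _ hU').1, (hF _ hU').2.1, (hF _ hU').2.2.mono_right Finset.subset_union_left⟩
    · intro U₁ h₁ U₂ h₂ hne
      rcases Finset.mem_insert.mp h₁ with e₁ | e₁ <;> rcases Finset.mem_insert.mp h₂ with e₂ | e₂
      · exact absurd (e₁.trans e₂.symm) hne
      · exact e₁ ▸ hdisj _ e₂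
      · exact e₂ ▸ (hdisj _ e₁).symm
      · exact hF' _ e₁ _ e₂ hne

/-- The vertices without predecessors. -/
noncomputable def sources (P : Digraph (Fin k)) : Finset (Fin k) := by
  classical exact {v | ∀ u, ¬ P.Adj u v}

theorem mem_sources : v ∈ sources P ↔ ∀ u, ¬ P.Adj u v := by
  simp [sources]

/-- A matching and a vertex cover of the same size in the bipartite graph of the edges that start
in sources. -/
theorem exists_source_matching (P : Digraph (Fin k)) :
    ∃ (I : Finset (Fin k)) (g : Fin k → Fin k) (C : Finset (Fin k)), I ⊆ sources P ∧
      Set.InjOn g I ∧ (∀ i ∈ I, P.Adj i (g i)) ∧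
      (∀ u ∈ sources P, ∀ v, P.Adj u v → u ∈ C ∨ v ∈ C) ∧ #C ≤ #I := by
  classical
  obtain ⟨I, g, C, hg, hgt, hC, hle⟩ := exists_matching_cover
    fun u => ({v | u ∈ sources P ∧ P.Adj u v} : Finset (Fin k))
  simp only [Finset.mem_filter, Finset.mem_univ, true_and, and_imp] at hgt hC
  exact ⟨I, g, C, fun i hi => (hgt i hi).1, hg, fun i hi => (hgt i hi).2,
    fun u hu v huv => hC u v hu huv, hle⟩

theorem ofReal_two_rpow_mono {m lam : ℕ} {x y : ℝ}
    (h : ENNReal.ofReal (2 ^ y) ≤ polymatDir m lam P) (hxy : x ≤ y) :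
    ENNReal.ofReal (2 ^ x) ≤ polymatDir m lam P :=
  le_trans (ENNReal.ofReal_le_ofReal (Real.rpow_le_rpow_of_exponent_le (by norm_num) hxy)) h

theorem sum_ite_mem_const (C : Finset (Fin k)) (x : ℝ) :
    ∑ v : Fin k, (if v ∈ C then x else 0) = #C * x := by
  simp [Finset.sum_ite_mem]

/-- When `lam ^ 2 ≤ m`, a single branch is optimal. -/
theorem exists_fam_sparse (hP : SimpleDi P) (hiso : NoIsolated P) :
    ∃ fam α β γ, FamOK P fam α β γ ∧ ∀ m lam : ℕ, 1 ≤ lam → lam * lam ≤ m →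
      ENNReal.ofReal (2 ^ (α * Real.logb 2 m + β * Real.logb 2 lam +
        γ * (Real.logb 2 m / 2))) ≤ polymatDir m lam P := by
  classical
  obtain ⟨I, g, C, hIS, hginj, hgadj, hC, hle⟩ := exists_source_matching P
  have hout : ∀ s ∈ sources P, ∃ v, P.Adj s v := fun s hs => by
    obtain ⟨v, hv | hv⟩ := hiso s
    · exact ⟨v, hv⟩
    · exact absurd hv (mem_sources.mp hs v)
  choose! g₀ hg₀ using hout
  let g' : Fin k → Fin k := fun s => if s ∈ I then g s else g₀ s
  have hg' : ∀ s ∈ sources P, P.Adj s (g' s) := fun s hs => by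
    by_cases h : s ∈ I
    · simpa [g', h] using hgadj s h
    · simpa [g', h] using hg₀ s hs
  set K : Finset (Fin k) := ∅ ∪ (sources P ∪ (sources P).image g') with hK
  have hSK : sources P ⊆ K := by
    rw [hK, Finset.empty_union]; exact Finset.subset_union_left
  obtain ⟨b, F, β, hb, hβ, hF, hF'⟩ := exists_greedy (K := K) hP fun v hv => by
    have : v ∉ sources P := fun h => hv (hSK h)
    simpa [mem_sources] using this
  obtain ⟨b', hb'⟩ := hb.edges (K := ∅) (sources P) g' hg'
  refine ⟨[b'], _, _, 0, hb'.famOK, fun m lam hl hlm => ?_⟩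
  set a := Real.logb 2 m with ha
  set l := Real.logb 2 lam with hl'
  have hl0 : 0 ≤ l := Real.logb_nonneg (by norm_num) (by exact_mod_cast hl)
  have hla : 2 * l ≤ a := by
    have h1 : Real.logb 2 ((lam : ℝ) * lam) ≤ a :=
      Real.logb_le_logb_of_le (by norm_num) (by exact_mod_cast Nat.mul_pos hl hl)
        (by exact_mod_cast hlm)
    rw [Real.logb_mul (by positivity) (by positivity)] at h1
    linarith
  -- the dual weights: `a` on sources and `l` elsewhere, reduced by `l` on the vertex cover
  let x : Fin k → ℝ := fun v =>
    (if v ∈ sources P then a - l else 0) + l - if v ∈ C then l else 0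
  have hxS : ∀ v ∈ sources P, x v = a - if v ∈ C then l else 0 := fun v hv => by
    simp [x, hv]
  have hxN : ∀ v ∉ sources P, x v = l - if v ∈ C then l else 0 := fun v hv => by
    simp [x, hv]
  have hite : ∀ v, 0 ≤ (if v ∈ C then l else 0) ∧ (if v ∈ C then l else 0) ≤ l := fun v => by
    split_ifs <;> simp [hl0]
  have hx0 : ∀ v, 0 ≤ x v := fun v => by
    have := hite v
    by_cases hv : v ∈ sources P
    · rw [hxS v hv]; linarith
    · rw [hxN v hv]; linarith
  -- a set closed under predecessors that is met by an edge contains its tail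
  have hmeet : ∀ u v, P.Adj u v → ∀ U ∈ F, ¬ Disjoint U {u, v} → u ∈ U := by
    intro u v huv U hU hd
    simp only [Finset.disjoint_insert_right, Finset.disjoint_singleton_right] at hd
    by_contra hu
    exact hd ⟨hu, fun hv => hu ((hF U hU).2.1 v hv u huv)⟩
  have hcount : ∀ u v, P.Adj u v → meetCount F {u, v} = meetCount F {u} := fun u v huv => by
    unfold meetCount
    congr 1
    refine Finset.filter_congr fun U hU => ⟨fun h => ?_, fun h h' => h (h'.mono_right (by simp))⟩
    simpa using hmeet u v huv U hU h
  have hcount1 : ∀ u, meetCount F {u} ≤ 1 := fun u => by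
    refine Finset.card_le_one.mpr fun U hU U' hU' => ?_
    simp only [Finset.mem_filter, Finset.disjoint_singleton_right, not_not] at hU hU'
    by_contra hne
    exact Finset.disjoint_left.mp (hF' U hU.1 U' hU'.1 hne) hU.2 hU'.2
  have hcount0 : ∀ u ∈ sources P, meetCount F {u} = 0 := fun u hu => by
    refine Finset.card_eq_zero.mpr (Finset.filter_eq_empty_iff.mpr fun U hU => ?_)
    simpa using fun h => Finset.disjoint_left.mp (hF U hU).2.2 h (hSK hu)
  have htarget : ∀ u v, P.Adj u v → v ∉ sources P := fun u v huv h => mem_sources.mp h u huv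
  refine ofReal_two_rpow_mono (le_polymatDir x hx0 (a - 2 * l) (by linarith) F
    (fun U hU => (hF U hU).1) hP (fun u v huv => ?_) fun u v huv => ?_) ?_
  · rw [hcount u v huv, hxN v (htarget u v huv)]
    by_cases hu : u ∈ sources P
    · rw [hxS u hu, hcount0 u hu]
      rcases hC u hu v huv with h | h
      · have := hite v
        simp [h]
        linarith
      · have := hite u
        simp [h]
        linarith
    · rw [hxN u hu]
      have h1 := hite u
      have h2 := hite v
      have h3 : (meetCount F {u} : ℝ) ≤ 1 := by exact_mod_cast hcount1 u
      nlinarith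
  · rw [hcount u v huv, hxN v (htarget u v huv), sub_self, mul_zero]
    have := hite v
    linarith
  · have hsum : ∑ v, x v = #(sources P) * (a - l) + k * l - #C * l := by
      simp only [x, Finset.sum_sub_distrib, Finset.sum_add_distrib, sum_ite_mem_const]
      simp
    have hcard : #(sources P) + #I ≤ #K := by
      have h1 : Disjoint (sources P) (I.image g) := by
        rw [Finset.disjoint_right]
        intro v hv
        obtain ⟨i, hi, rfl⟩ := Finset.mem_image.mp hv
        exact htarget i _ (hgadj i hi)
      rw [← Finset.card_image_of_injOn hginj, ← Finset.card_union_of_disjoint h1]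
      refine Finset.card_le_card ?_
      rw [hK, Finset.empty_union]
      refine Finset.union_subset_union_right fun v hv => ?_
      obtain ⟨i, hi, rfl⟩ := Finset.mem_image.mp hv
      exact Finset.mem_image.mpr ⟨i, hIS hi, by simp [g', hi]⟩
    have hcard2 : #(sources P) + #C + β + 2 * #F ≤ k := by
      have h2 := Finset.card_add_card_compl K
      rw [Fintype.card_fin] at h2
      omega
    have hcard3 : (#(sources P) : ℝ) + #C + β + 2 * #F ≤ k := by exact_mod_cast hcard2
    rw [hsum]
    push_cast
    nlinarith

end

/-! ### Families of branches -/

section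
variable {k : ℕ} {P : Digraph (Fin k)} {K A B L : Finset (Fin k)} {b b' : List (Stp k)}
  {α α' β β' γ γ' : ℕ} {u v : Fin k} {fam fam' : List (List (Stp k))}

/-- Exactly one position of a list holds a member with a property that has count `1`. -/
theorem existsUnique_of_countP {ι : Type*} {p : ι → Bool} {l : List ι} (h : l.countP p = 1) :
    ∃! i : ℕ, ∃ b : ι, l[i]? = some b ∧ p b = true := by
  induction l with
  | nil => simp at h
  | cons x l ih =>
    by_cases hx : p x = true
    · rw [List.countP_cons_of_pos hx, Nat.add_eq_right, List.countP_eq_zero] at h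
      refine ⟨0, ⟨x, rfl, hx⟩, ?_⟩
      rintro (_ | i) ⟨b, hb, hpb⟩
      · rfl
      · rw [List.getElem?_cons_succ] at hb
        exact absurd hpb (h b (List.mem_of_getElem? hb))
    · rw [List.countP_cons_of_neg hx] at h
      obtain ⟨i, ⟨b, hb, hpb⟩, huniq⟩ := ih h
      refine ⟨i + 1, ⟨b, by simpa using hb, hpb⟩, ?_⟩
      rintro (_ | j) ⟨b', hb', hpb'⟩
      · simp only [List.getElem?_cons_zero, Option.some.injEq] at hb'
        exact absurd (hb' ▸ hpb') hx
      · rw [huniq j ⟨b', by simpa using hb', hpb'⟩]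

open Classical in
/-- The branch `b` applies to the embeddings that map exactly the vertices in `H` to vertices of
out-degree above `q`. -/
noncomputable def applies (H : Fin k → Prop) (b : List (Stp k)) : Bool :=
  decide (∀ s ∈ b, s.Compat H)

theorem applies_iff {H : Fin k → Prop} : applies H b = true ↔ ∀ s ∈ b, s.Compat H := by
  simp [applies]

theorem applies_append {H : Fin k → Prop} :
    applies H (b ++ b') = (applies H b && applies H b') := by
  rw [Bool.eq_iff_iff, Bool.and_eq_true, applies_iff, applies_iff, applies_iff,
    List.forall_mem_append]

/-- The branches in `fam` each determine the vertices in `A`, for every embedding there is exactly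
one branch that applies, and the number of codes in each of them is `m ^ α * lam ^ β * q ^ γ`. -/
structure Part (P : Digraph (Fin k)) (fam : List (List (Stp k))) (A : Finset (Fin k))
    (α β γ : ℕ) : Prop where
  ordered : ∀ b ∈ fam, Ordered ∅ b ∧ known ∅ b = A
  onP : ∀ b ∈ fam, ∀ s ∈ b, s.OnP P
  count : ∀ H : Fin k → Prop, fam.countP (applies H) = 1
  prod : ∀ b ∈ fam, ∀ D, prodRad D b = D.m ^ α * D.lam ^ β * D.q ^ γ

theorem prodRad_append (D : Data) (b b' : List (Stp k)) :
    prodRad D (b ++ b') = prodRad D b * prodRad D b' := by simp [prodRad]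

theorem Seg.part (hb : Seg P ∅ A b α β) : Part P [b] A α β 0 where
  ordered := by simpa using ⟨hb.ordered, hb.known⟩
  onP := by simpa using hb.onP
  count H := by
    have := applies_iff.mpr fun s hs => hb.compat s hs H
    simp [this]
  prod := by simpa using hb.prod

theorem Part.append (h : Part P fam A α β γ) (h' : Part P fam' B α' β' γ') :
    Part P (fam.flatMap fun b => fam'.map (b ++ ·)) (A ∪ B) (α + α') (β + β') (γ + γ') where
  ordered := by
    simp only [List.mem_flatMap, List.mem_map]
    rintro _ ⟨b, hb, b', hb', rfl⟩
    obtain ⟨h1, h2⟩ := h.ordered b hb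
    obtain ⟨h1', h2'⟩ := h'.ordered b' hb'
    refine ⟨ordered_append.mpr ⟨h1, h1'.mono (Finset.empty_subset _)⟩, ?_⟩
    rw [known_append, h2, ← Finset.empty_union A, known_union, h2', Finset.empty_union,
      Finset.union_comm]
  onP := by
    simp only [List.mem_flatMap, List.mem_map]
    rintro _ ⟨b, hb, b', hb', rfl⟩ s hs
    exact (List.mem_append.mp hs).elim (h.onP b hb s) (h'.onP b' hb' s)
  count H := by
    have h1 := h.count H
    have h2 := h'.count H
    clear h h'
    have key : (fam.flatMap fun b => fam'.map (b ++ ·)).countP (applies H) =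
        fam.countP (applies H) := by
      clear h1
      induction fam with
      | nil => rfl
      | cons b fam ih =>
        rw [List.flatMap_cons, List.countP_append, ih, List.countP_map, List.countP_cons, add_comm]
        congr 1
        have h3 : applies H ∘ (b ++ ·) = fun b' => applies H b && applies H b' := by
          funext b'
          exact applies_append
        rw [h3]
        cases applies H b
        · simp
        · simpa using h2
    rw [key, h1]
  prod := by
    simp only [List.mem_flatMap, List.mem_map]
    rintro _ ⟨b, hb, b', hb', rfl⟩ D
    rw [prodRad_append, h.prod b hb, h'.prod b' hb']
    ring

theorem Part.famOK (h : Part P fam A α β γ) (hb : Seg P A Finset.univ b α' β') :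
    FamOK P (fam.map (· ++ b)) (α + α') (β + β') γ where
  ordered := by
    simp only [List.mem_map]
    rintro _ ⟨b', hb', rfl⟩
    obtain ⟨h1, h2⟩ := h.ordered b' hb'
    exact ⟨ordered_append.mpr ⟨h1, h2 ▸ hb.ordered⟩, by rw [known_append, h2, hb.known]⟩
  onP := by
    simp only [List.mem_map]
    rintro _ ⟨b', hb', rfl⟩ s hs
    exact (List.mem_append.mp hs).elim (h.onP b' hb' s) (hb.onP s)
  uniq H := by
    have h1 : (fam.map (· ++ b)).countP (applies H) = 1 := by
      rw [← h.count H, List.countP_map]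
      congr 1
      have := applies_iff.mpr fun s hs => hb.compat s hs H
      funext b'
      simp [applies_append, this]
    simpa only [applies_iff] using existsUnique_of_countP h1
  prod := by
    simp only [List.mem_map]
    rintro _ ⟨b', hb', rfl⟩ D
    rw [prodRad_append, h.prod b' hb', hb.prod D]
    ring

/-- The part of an embedding on a set of odd size, where `t` and `h` form an edge and where there
are perfect matchings of both the other vertices than `t` and the other vertices than `h`: the image
of `t` is either one of the few vertices of out-degree above `q`, or has few out-neighbours. -/
theorem part_odd {t h : Fin k} (hth : P.Adj t h) {At Ah : Finset (Fin k)} {j : ℕ}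
    (hb : Seg P ∅ At b j 0) (hb' : Seg P ∅ Ah b' j 0) (hAt : insert t At = A)
    (hAh : insert h Ah = A) (ht : t ∈ Ah) :
    Part P [.heavy t :: b, b' ++ [.light t h]] A j 0 1 where
  ordered := by
    simp only [List.mem_cons, List.not_mem_nil, or_false, forall_eq_or_imp, forall_eq]
    refine ⟨⟨⟨by simp [Stp.needs], hb.ordered.mono (Finset.empty_subset _)⟩, ?_⟩,
      ordered_append.mpr ⟨hb'.ordered, ?_, trivial⟩, ?_⟩
    · change known (∅ ∪ {t}) b = A
      rw [known_union, hb.known, ← hAt, Finset.union_comm]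
      rfl
    · rw [hb'.known]
      simpa [Stp.needs] using ht
    · rw [known_append, hb'.known, ← hAh, Finset.insert_eq, Finset.union_comm]
      rfl
  onP := by
    simp only [List.mem_cons, List.not_mem_nil, or_false, forall_eq_or_imp, forall_eq,
      List.forall_mem_append]
    exact ⟨⟨trivial, hb.onP⟩, hb'.onP, hth⟩
  count H := by
    have e1 : applies H (.heavy t :: b) = true ↔ H t := by
      rw [applies_iff, List.forall_mem_cons]
      exact and_iff_left fun s hs => hb.compat s hs H
    have e2 : applies H (b' ++ [.light t h]) = true ↔ ¬ H t := by
      rw [applies_iff, List.forall_mem_append, List.forall_mem_singleton]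
      exact and_iff_right fun s hs => hb'.compat s hs H
    by_cases hH : H t <;> simp only [List.countP_cons, List.countP_nil, e1, e2, hH] <;> simp
  prod := by
    simp only [List.mem_cons, List.not_mem_nil, or_false, forall_eq_or_imp, forall_eq]
    refine ⟨fun D => ?_, fun D => ?_⟩
    · have := hb.prod D
      simp only [prodRad, List.map_cons, List.prod_cons, Stp.rad] at this ⊢
      rw [this]; ring
    · rw [prodRad_append, hb'.prod D]
      simp [prodRad, Stp.rad]

/-! ### Coverings of the pattern by edges and odd cycles -/

/-- The vertices `u` and `v` are joined by an edge. -/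
def UAdj (P : Digraph (Fin k)) (u v : Fin k) : Prop := P.Adj u v ∨ P.Adj v u

theorem seg_pair (h : UAdj P u v) : ∃ s, Seg P K (K ∪ {u, v}) [s] 1 0 := by
  rcases h with h | h
  · exact ⟨_, Seg.nil.edge h⟩
  · refine ⟨_, Finset.pair_comm u v ▸ Seg.nil.edge h⟩

theorem image_Ico_add_two {ι : Type*} [DecidableEq ι] (c : ℕ → ι) {i j : ℕ} (h : i ≤ j) :
    (Finset.Ico i (j + 2)).image c = (Finset.Ico i j).image c ∪ {c j, c (j + 1)} := by
  ext x
  simp only [Finset.mem_image, Finset.mem_Ico, Finset.mem_union, Finset.mem_insert,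
    Finset.mem_singleton]
  constructor
  · rintro ⟨y, hy, rfl⟩
    by_cases h1 : y < j
    · exact .inl ⟨y, ⟨hy.1, h1⟩, rfl⟩
    · obtain rfl | rfl : y = j ∨ y = j + 1 := by omega
      · exact .inr (.inl rfl)
      · exact .inr (.inr rfl)
  · rintro (⟨y, hy, rfl⟩ | rfl | rfl)
    · exact ⟨y, by omega, rfl⟩
    · exact ⟨j, by omega, rfl⟩
    · exact ⟨j + 1, by omega, rfl⟩

/-- The perfect matching of a path with an even number of vertices. -/
theorem exists_seg_path (c : ℕ → Fin k) (hc : ∀ i, UAdj P (c i) (c (i + 1))) (i j : ℕ) :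
    ∃ b, Seg P ∅ ((Finset.Ico i (i + 2 * j)).image c) b j 0 := by
  induction j with
  | zero => exact ⟨[], by simpa using Seg.nil⟩
  | succ j ih =>
    obtain ⟨b, hb⟩ := ih
    obtain ⟨s, hs⟩ := seg_pair (K := (Finset.Ico i (i + 2 * j)).image c) (hc (i + 2 * j))
    refine ⟨b ++ [s], ?_⟩
    rw [show i + 2 * (j + 1) = i + 2 * j + 2 by ring, image_Ico_add_two c (by omega)]
    exact hb.append hs

/-- Adjacency in the graph obtained from the pattern by adding a clique of dummy vertices, joined to
all the vertices outside `I`. -/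
def DAdj (P : Digraph (Fin k)) (I : Finset (Fin k)) {d : ℕ} : Fin k ⊕ Fin d → Fin k ⊕ Fin d → Prop
  | .inl u, .inl v => UAdj P u v
  | .inl u, .inr _ => u ∉ I
  | .inr _, .inl v => v ∉ I
  | .inr _, .inr _ => True

/-- The vertices of the pattern in `A` can be covered, up to a set `Z` disjoint from `I` that has at
most as many members as there are dummies in `A`. -/
def Covers (P : Digraph (Fin k)) (I : Finset (Fin k)) {d : ℕ} (A : Finset (Fin k ⊕ Fin d)) : Prop :=
  ∃ fam T Z α γ, Part P fam T α 0 γ ∧ 2 * α + γ = #T ∧ Disjoint T Z ∧ T ∪ Z = A.toLeft ∧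
    Disjoint Z I ∧ #Z ≤ #A.toRight

variable {I : Finset (Fin k)} {d : ℕ}

theorem Covers.union {A B : Finset (Fin k ⊕ Fin d)} (hA : Covers P I A) (hB : Covers P I B)
    (h : Disjoint A B) : Covers P I (A ∪ B) := by
  obtain ⟨fam, T, Z, α, γ, h1, h2, h3, h4, h5, h6⟩ := hA
  obtain ⟨fam', T', Z', α', γ', h1', h2', h3', h4', h5', h6'⟩ := hB
  have hd : Disjoint (T ∪ Z) (T' ∪ Z') := by
    rw [h4, h4', Finset.disjoint_left]
    intro v hv hv'
    exact Finset.disjoint_left.mp h (Finset.mem_toLeft.mp hv) (Finset.mem_toLeft.mp hv')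
  simp only [Finset.disjoint_union_left, Finset.disjoint_union_right] at hd
  have hr : Disjoint A.toRight B.toRight := by
    rw [Finset.disjoint_left]
    intro v hv hv'
    exact Finset.disjoint_left.mp h (Finset.mem_toRight.mp hv) (Finset.mem_toRight.mp hv')
  refine ⟨_, T ∪ T', Z ∪ Z', _, _, h1.append h1', ?_, ?_, ?_, ?_, ?_⟩
  · rw [Finset.card_union_of_disjoint hd.1.1]; omega
  · simp only [Finset.disjoint_union_left, Finset.disjoint_union_right]
    exact ⟨⟨h3, hd.1.2.symm⟩, hd.2.1, h3'⟩
  · rw [Finset.toLeft_union, ← h4, ← h4', Finset.union_union_union_comm]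
  · rw [Finset.disjoint_union_left]; exact ⟨h5, h5'⟩
  · rw [Finset.toRight_union, Finset.card_union_of_disjoint hr]
    exact (Finset.card_union_le _ _).trans (Nat.add_le_add h6 h6')

theorem covers_of_disjoint {A : Finset (Fin k ⊕ Fin d)} (h : Disjoint A.toLeft I)
    (hA : #A.toLeft ≤ #A.toRight) : Covers P I A :=
  ⟨_, ∅, A.toLeft, 0, 0, Seg.nil.part, by simp, by simp, by simp, h, hA⟩

theorem covers_empty : Covers P I (∅ : Finset (Fin k ⊕ Fin d)) := by
  have h : (∅ : Finset (Fin k ⊕ Fin d)).toLeft = ∅ := by ext; simp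
  exact covers_of_disjoint (by simp [h]) (by simp [h])

theorem covers_pair {x y : Fin k ⊕ Fin d} (hxy : x ≠ y) (h : DAdj P I x y) : Covers P I {x, y} := by
  rcases x with u | i <;> rcases y with v | i'
  · obtain ⟨s, hs⟩ := seg_pair (K := ∅) h
    have huv : u ≠ v := fun h => hxy (by rw [h])
    refine ⟨_, {u, v}, ∅, 1, 0, by simpa using hs.part, by rw [Finset.card_pair huv], by simp, ?_,
      by simp, by simp⟩
    ext; simp
  · refine covers_of_disjoint ?_ ?_
    · rw [Finset.disjoint_left]
      intro w hw
      have : w = u := by simpa using hw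
      exact this ▸ h
    · have h1 : ({.inl u, .inr i'} : Finset (Fin k ⊕ Fin d)).toLeft = {u} := by ext; simp
      have h2 : ({.inl u, .inr i'} : Finset (Fin k ⊕ Fin d)).toRight = {i'} := by ext; simp
      rw [h1, h2]; simp
  · refine covers_of_disjoint ?_ ?_
    · rw [Finset.disjoint_left]
      intro w hw
      have : w = v := by simpa using hw
      exact this ▸ h
    · have h1 : ({.inr i, .inl v} : Finset (Fin k ⊕ Fin d)).toLeft = {v} := by ext; simp
      have h2 : ({.inr i, .inl v} : Finset (Fin k ⊕ Fin d)).toRight = {i} := by ext; simp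
      rw [h1, h2]; simp
  · refine covers_of_disjoint ?_ ?_
    · rw [Finset.disjoint_left]
      intro w hw
      simp at hw
    · have : ({Sum.inr i, Sum.inr i'} : Finset (Fin k ⊕ Fin d)).toLeft = ∅ := by ext; simp
      simp [this]

theorem covers_path (c : ℕ → Fin k ⊕ Fin d) (hc : ∀ i, DAdj P I (c i) (c (i + 1))) (i j : ℕ)
    (hinj : Set.InjOn c (Set.Ico i (i + 2 * j))) :
    Covers P I ((Finset.Ico i (i + 2 * j)).image c) := by
  induction j with
  | zero => simpa using covers_empty
  | succ j ih =>
    rw [show i + 2 * (j + 1) = i + 2 * j + 2 by ring] at hinj ⊢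
    rw [image_Ico_add_two c (by omega)]
    have hne : ∀ a b, i ≤ a → a < b → b < i + 2 * j + 2 → c a ≠ c b := fun a b h1 h2 h3 h =>
      h2.ne (hinj ⟨by omega, by omega⟩ ⟨by omega, by omega⟩ h)
    refine (ih (hinj.mono (Set.Ico_subset_Ico_right (by omega)))).union
      (covers_pair (hne _ _ (by omega) (by omega) (by omega)) (hc _)) ?_
    rw [Finset.disjoint_left]
    intro x hx
    obtain ⟨a, ha, rfl⟩ := Finset.mem_image.mp hx
    rw [Finset.mem_Ico] at ha
    simp only [Finset.mem_insert, Finset.mem_singleton, not_or]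
    exact ⟨hne _ _ ha.1 ha.2 (by omega), hne _ _ ha.1 (by omega) (by omega)⟩

/-- A cycle of odd length that consists of vertices of the pattern. -/
theorem covers_odd (hP : SimpleDi P) (c : ℕ → Fin k) (hc : ∀ i, UAdj P (c i) (c (i + 1))) (j : ℕ)
    (hinj : Set.InjOn c (Set.Ico 0 (2 * j + 1))) (hper : c (2 * j + 1) = c 0) :
    Covers P I ((Finset.Ico 0 (2 * j + 1)).image fun i => (.inl (c i) : Fin k ⊕ Fin d)) := by
  have hirr : ∀ v, ¬ UAdj P v v := fun v h => h.elim (hP v) (hP v)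
  have hj : 1 ≤ j := by
    by_contra hj
    obtain rfl : j = 0 := by omega
    exact hirr (c 0) (by simpa [hper] using hc 0)
  obtain ⟨b₀, hb₀⟩ := exists_seg_path c hc 1 j
  obtain ⟨b₁, hb₁⟩ := exists_seg_path c hc 2 j
  set A := (Finset.Ico 0 (2 * j + 1)).image c with hA
  have h0 : insert (c 0) ((Finset.Ico 1 (1 + 2 * j)).image c) = A := by
    rw [hA, ← Finset.image_insert]
    congr 1
    ext; simp; omega
  have h1 : insert (c 1) ((Finset.Ico 2 (2 + 2 * j)).image c) = A := by
    ext x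
    simp only [hA, Finset.mem_insert, Finset.mem_image, Finset.mem_Ico]
    constructor
    · rintro (rfl | ⟨a, ha, rfl⟩)
      · exact ⟨1, by omega, rfl⟩
      · by_cases h : a = 2 * j + 1
        · exact ⟨0, by omega, by rw [h, hper]⟩
        · exact ⟨a, by omega, rfl⟩
    · rintro ⟨a, ha, rfl⟩
      by_cases h : a = 1
      · exact .inl (by rw [h])
      · by_cases h' : a = 0
        · exact .inr ⟨2 * j + 1, by omega, by rw [h', hper]⟩
        · exact .inr ⟨a, by omega, rfl⟩
  have hcard : 2 * j + 1 = #A := by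
    rw [hA, Finset.card_image_of_injOn (by rw [Finset.coe_Ico]; exact hinj)]
    simp
  have hm0 : c 0 ∈ (Finset.Ico 2 (2 + 2 * j)).image c :=
    Finset.mem_image.mpr ⟨2 * j + 1, by simp; omega, hper⟩
  have hm1 : c 1 ∈ (Finset.Ico 1 (1 + 2 * j)).image c :=
    Finset.mem_image.mpr ⟨1, by simp; omega, rfl⟩
  have hleft : ((Finset.Ico 0 (2 * j + 1)).image
      fun i => (.inl (c i) : Fin k ⊕ Fin d)).toLeft = A := by
    ext; simp [hA]
  obtain ⟨fam, hfam⟩ : ∃ fam, Part P fam A j 0 1 := by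
    rcases hc 0 with h | h
    · exact ⟨_, part_odd h hb₀ hb₁ h0 h1 hm0⟩
    · exact ⟨_, part_odd h hb₁ hb₀ h1 h0 hm1⟩
  exact ⟨fam, A, ∅, j, 1, hfam, hcard, by simp, by rw [hleft]; simp, by simp, by simp⟩

/-- The orbits of a permutation that moves every vertex to an adjacent one give a covering: those of
even length and those that contain a dummy are split into adjacent pairs, with one dummy left over
if the length is odd. -/
theorem covers_of_invariant (hP : SimpleDi P) {f : Fin k ⊕ Fin d → Fin k ⊕ Fin d}
    (hf : Function.Injective f) (hadj : ∀ x, DAdj P I x (f x)) (A : Finset (Fin k ⊕ Fin d))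
    (hA : ∀ x ∈ A, f x ∈ A) : Covers P I A := by
  induction h : #A using Nat.strong_induction_on generalizing A with
  | _ N ih =>
  subst h
  rcases A.eq_empty_or_nonempty with rfl | hne
  · exact covers_empty
  -- an orbit with a dummy, if there is one, is traversed from the dummy
  obtain ⟨x, hx, hxd⟩ : ∃ x ∈ A, (∃ i, x = .inr i) ∨ ∀ y ∈ A, ∃ v, y = .inl v := by
    by_cases h : ∃ i, (.inr i : Fin k ⊕ Fin d) ∈ A
    · obtain ⟨i, hi⟩ := h
      exact ⟨_, hi, .inl ⟨i, rfl⟩⟩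
    · obtain ⟨x, hx⟩ := hne
      refine ⟨x, hx, .inr ?_⟩
      rintro (v | i) hy
      · exact ⟨v, rfl⟩
      · exact absurd ⟨i, hy⟩ h
  let c : ℕ → Fin k ⊕ Fin d := fun i => f^[i] x
  have hcs : ∀ i, c (i + 1) = f (c i) := fun i => Function.iterate_succ_apply' f i x
  have hcA : ∀ i, c i ∈ A := fun i => by
    induction i with
    | zero => exact hx
    | succ i ih => rw [hcs]; exact hA _ ih
  have hcadj : ∀ i, DAdj P I (c i) (c (i + 1)) := fun i => by rw [hcs]; exact hadj _
  set n := Function.minimalPeriod f x with hn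
  have hpos : 0 < n := Function.minimalPeriod_pos_of_mem_periodicPts (hf.mem_periodicPts x)
  have hinj : Set.InjOn c (Set.Ico 0 n) := by
    have := Function.iterate_injOn_Iio_minimalPeriod (f := f) (x := x)
    exact this.mono fun i hi => hi.2
  have hper : c n = c 0 := by
    have := Function.iterate_minimalPeriod (f := f) (x := x)
    exact this
  set O := (Finset.Ico 0 n).image c with hO
  have hOA : O ⊆ A := fun y hy => by
    obtain ⟨i, -, rfl⟩ := Finset.mem_image.mp hy
    exact hcA i
  have hxO : x ∈ O := Finset.mem_image.mpr ⟨0, by simpa using hpos, rfl⟩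
  have hinv : ∀ y ∈ A \ O, f y ∈ A \ O := fun y hy => by
    rw [Finset.mem_sdiff] at hy ⊢
    refine ⟨hA y hy.1, fun h => hy.2 ?_⟩
    obtain ⟨i, hi, hiy⟩ := Finset.mem_image.mp h
    rw [Finset.mem_Ico] at hi
    rcases i with _ | i
    · refine Finset.mem_image.mpr ⟨n - 1, by simp; omega, hf ?_⟩
      rw [← hcs, Nat.sub_add_cancel hpos, hper, hiy]
    · refine Finset.mem_image.mpr ⟨i, by simp; omega, hf ?_⟩
      rw [← hcs, hiy]
  have hrest : Covers P I (A \ O) := ih _ (Finset.card_lt_card ⟨Finset.sdiff_subset,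
    fun h => (Finset.mem_sdiff.mp (h hx)).2 hxO⟩) _ hinv rfl
  have hcO : Covers P I O := by
    obtain ⟨j, hj | hj⟩ := Nat.even_or_odd' n
    · have := covers_path c hcadj 0 j (by rwa [zero_add, ← hj])
      rwa [zero_add, ← hj] at this
    · rcases hxd with ⟨i, hi⟩ | hxd
      · have h1 : O = {x} ∪ (Finset.Ico 1 (1 + 2 * j)).image c := by
          rw [hO, ← Finset.insert_eq, show x = c 0 from rfl, ← Finset.image_insert]
          congr 1
          ext; simp; omega
        have hl : ({x} : Finset (Fin k ⊕ Fin d)).toLeft = ∅ := by ext; simp [hi]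
        rw [h1]
        refine (covers_of_disjoint (by simp [hl]) (by simp [hl])).union (covers_path c hcadj 1 j
          (hinj.mono (Set.Ico_subset_Ico (Nat.zero_le _) (by omega)))) ?_
        rw [Finset.disjoint_singleton_left]
        intro h
        obtain ⟨y, hy, hyx⟩ := Finset.mem_image.mp h
        rw [Finset.mem_Ico] at hy
        have : y = 0 := hinj ⟨Nat.zero_le _, by omega⟩ ⟨le_rfl, hpos⟩ hyx
        omega
      · choose v hv using fun i => hxd (c i) (hcA i)
        rw [hj] at hinj hper
        have := covers_odd (I := I) (d := d) hP v
          (fun i => by have := hcadj i; rwa [hv i, hv (i + 1)] at this) j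
          (fun a ha b hb hab => hinj ha hb (by rw [hv, hv, hab]))
          (by rw [hv, hv] at hper; exact Sum.inl_injective hper)
        rw [hO, hj]
        convert this using 2
        funext i
        exact hv i
  have := hcO.union hrest Finset.disjoint_sdiff
  rwa [Finset.union_sdiff_of_subset hOA] at this

end

section
variable {k : ℕ} {P : Digraph (Fin k)} {K A B L : Finset (Fin k)} {b b' : List (Stp k)}
  {α α' β β' γ γ' : ℕ} {u v : Fin k} {fam fam' : List (List (Stp k))}

/-- The theorem of Hall gives a permutation that moves every vertex to an adjacent one, provided
that the vertices in `I` can be matched to vertices outside `I`, and that there are as many dummies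
as the maximum deficiency. -/
theorem exists_injective_dAdj {I : Finset (Fin k)} {g : Fin k → Fin k} {d : ℕ}
    (nb : Fin k → Finset (Fin k)) (hnb : ∀ u v, v ∈ nb u ↔ UAdj P u v)
    (hg : Set.InjOn g I) (hgadj : ∀ i ∈ I, P.Adj i (g i)) (hgI : ∀ i ∈ I, g i ∉ I)
    (hd : ∀ A : Finset (Fin k), #A ≤ #(A.biUnion nb) + d) :
    ∃ f : Fin k ⊕ Fin d → Fin k ⊕ Fin d, Function.Injective f ∧ ∀ x, DAdj P I x (f x) := by
  classical
  obtain ⟨f, hf, hft⟩ := (Finset.all_card_le_biUnion_card_iff_exists_injective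
    (fun x : Fin k ⊕ Fin d => ({y | DAdj P I x y} : Finset (Fin k ⊕ Fin d)))).mp fun X => by
    set A := X.toLeft with hA
    set Y := X.biUnion fun x : Fin k ⊕ Fin d => ({y | DAdj P I x y} : Finset (Fin k ⊕ Fin d))
      with hY
    have hYl : ∀ u ∈ A, ∀ v ∈ nb u, .inl v ∈ Y := fun u hu v hv => by
      refine Finset.mem_biUnion.mpr ⟨.inl u, Finset.mem_toLeft.mp hu, ?_⟩
      exact Finset.mem_filter.mpr ⟨Finset.mem_univ _, (hnb u v).mp hv⟩
    have hcard : #X = #A + #X.toRight := Finset.card_toLeft_add_card_toRight.symm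
    have hright : #X.toRight ≤ d := by simpa using Finset.card_le_univ X.toRight
    rcases X.toRight.eq_empty_or_nonempty with hB | ⟨i, hi⟩
    · rw [hB, Finset.card_empty, add_zero] at hcard
      rw [hcard]
      by_cases hAI : A ⊆ I
      · rw [← Finset.card_image_of_injOn (hg.mono (by exact_mod_cast hAI)),
          ← Finset.card_map (Function.Embedding.inl : Fin k ↪ Fin k ⊕ Fin d)]
        refine Finset.card_le_card fun y hy => ?_
        obtain ⟨v, hv, rfl⟩ := Finset.mem_map.mp hy
        obtain ⟨u, hu, rfl⟩ := Finset.mem_image.mp hv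
        exact hYl u hu _ ((hnb _ _).mpr (.inl (hgadj u (hAI hu))))
      · obtain ⟨u, hu, huI⟩ := Finset.not_subset.mp hAI
        have h1 : (A.biUnion nb).disjSum (Finset.univ : Finset (Fin d)) ⊆ Y := by
          rintro (v | j) h
          · obtain ⟨u, hu, hv⟩ := Finset.mem_biUnion.mp (Finset.inl_mem_disjSum.mp h)
            exact hYl u hu v hv
          · refine Finset.mem_biUnion.mpr ⟨.inl u, Finset.mem_toLeft.mp hu, ?_⟩
            exact Finset.mem_filter.mpr ⟨Finset.mem_univ _, huI⟩
        have h2 := Finset.card_le_card h1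
        rw [Finset.card_disjSum, Finset.card_univ, Fintype.card_fin] at h2
        exact (hd A).trans h2
    · -- a dummy in `X` makes all the dummies and all the vertices outside `I` available
      have h1 : (A.biUnion nb ∪ Iᶜ).disjSum (Finset.univ : Finset (Fin d)) ⊆ Y := by
        rintro (v | j) h
        · rcases Finset.mem_union.mp (Finset.inl_mem_disjSum.mp h) with h | h
          · obtain ⟨u, hu, hv⟩ := Finset.mem_biUnion.mp h
            exact hYl u hu v hv
          · refine Finset.mem_biUnion.mpr ⟨.inr i, Finset.mem_toRight.mp hi, ?_⟩
            exact Finset.mem_filter.mpr ⟨Finset.mem_univ _, Finset.mem_compl.mp h⟩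
        · refine Finset.mem_biUnion.mpr ⟨.inr i, Finset.mem_toRight.mp hi, ?_⟩
          exact Finset.mem_filter.mpr ⟨Finset.mem_univ _, trivial⟩
      have h2 := Finset.card_le_card h1
      rw [Finset.card_disjSum, Finset.card_univ, Fintype.card_fin] at h2
      have e1 : #(A ∩ I) + #(A \ I) = #A := Finset.card_inter_add_card_sdiff A I
      have e2 : #(A ∩ I) ≤ #I := Finset.card_le_card Finset.inter_subset_right
      have e3 : #{s ∈ I | g s ∈ A} + #{s ∈ I | ¬ g s ∈ A} = #I :=
        Finset.card_filter_add_card_filter_not _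
      have e4 : #{s ∈ I | ¬ g s ∈ A} ≤ #(Iᶜ \ A) := by
        rw [← Finset.card_image_of_injOn (f := g) (s := {s ∈ I | ¬ g s ∈ A})
          (hg.mono fun s hs => (Finset.mem_filter.mp hs).1)]
        refine Finset.card_le_card fun y hy => ?_
        obtain ⟨s, hs, rfl⟩ := Finset.mem_image.mp hy
        rw [Finset.mem_filter] at hs
        simpa using ⟨hgI s hs.1, hs.2⟩
      have e5 : #(Iᶜ ∩ A) + #(Iᶜ \ A) = #Iᶜ := Finset.card_inter_add_card_sdiff _ _
      have e6 : #(A \ I) = #(Iᶜ ∩ A) := by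
        congr 1; ext; simp [and_comm]
      have e7 : #({s ∈ I | g s ∈ A} ∪ Iᶜ) ≤ #(A.biUnion nb ∪ Iᶜ) := by
        refine Finset.card_le_card (Finset.union_subset_union_left fun s hs => ?_)
        rw [Finset.mem_filter] at hs
        exact Finset.mem_biUnion.mpr ⟨g s, hs.2, (hnb _ _).mpr (.inr (hgadj s hs.1))⟩
      rw [Finset.card_union_of_disjoint (by
        rw [Finset.disjoint_left]
        intro s hs
        simpa using (Finset.mem_filter.mp hs).1)] at e7
      omega
  exact ⟨f, hf, fun x => by simpa using hft x⟩

/-- When the known vertices `K` are extended by `L`, the cost of the remaining ones decreases by at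
least that of the new vertices `L'`. -/
theorem sum_compl_union_add_le {c : Fin k → ℝ} (hc : ∀ v, 0 ≤ c v) {L' : Finset (Fin k)}
    (h : L' ⊆ L) (hd : Disjoint L' K) : ∑ v ∈ (K ∪ L)ᶜ, c v + ∑ v ∈ L', c v ≤ ∑ v ∈ Kᶜ, c v := by
  have h1 : Disjoint (K ∪ L)ᶜ L' := by
    rw [Finset.disjoint_right]
    intro v hv
    simp [h hv]
  rw [← Finset.sum_union h1]
  refine Finset.sum_le_sum_of_subset_of_nonneg (fun v hv => ?_) fun v _ _ => hc v
  rw [Finset.mem_union] at hv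
  rw [Finset.mem_compl]
  rcases hv with hv | hv
  · intro h
    simp [h] at hv
  · exact Finset.disjoint_left.mp hd hv

/-- The vertices outside `K` can be determined at a cost of `a` for every source and `l` for every
other vertex. -/
theorem exists_completion (hP : SimpleDi P) (hiso : NoIsolated P) (K : Finset (Fin k)) :
    ∃ b α β, Seg P K Finset.univ b α β ∧ ∀ a l : ℝ, 0 ≤ l → l ≤ a → a ≤ 2 * l →
      α * a + β * l ≤ ∑ v ∈ Kᶜ, if v ∈ sources P then a else l := by
  induction h : #Kᶜ using Nat.strong_induction_on generalizing K with
  | _ N ih =>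
  subst h
  by_cases huniv : K = Finset.univ
  · subst huniv
    exact ⟨[], 0, 0, Seg.nil, by simp⟩
  obtain ⟨v, hv⟩ : ∃ v, v ∉ K := by
    by_contra! h
    exact huniv (Finset.eq_univ_iff_forall.mpr h)
  have hc : ∀ a l : ℝ, 0 ≤ l → l ≤ a → ∀ v, 0 ≤ if v ∈ sources P then a else l := by
    intro a l h1 h2 v
    split_ifs <;> linarith
  by_cases hs : v ∈ sources P
  · obtain ⟨u, hu⟩ : ∃ u, P.Adj v u := by
      obtain ⟨u, hu | hu⟩ := hiso v
      · exact ⟨u, hu⟩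
      · exact absurd hu (mem_sources.mp hs u)
    obtain ⟨b, α, β, hb, hle⟩ := ih _ (card_compl_union_lt (L := {v, u}) hv (by simp)) _ rfl
    refine ⟨_, _, _, hb.edge hu, fun a l h1 h2 h3 => ?_⟩
    have h4 := sum_compl_union_add_le (K := K) (L := {v, u}) (L' := {v}) (hc a l h1 h2) (by simp)
      (by simpa using hv)
    rw [Finset.sum_singleton, if_pos hs] at h4
    have := hle a l h1 h2 h3
    push_cast
    linarith
  · obtain ⟨u, hu⟩ : ∃ u, P.Adj u v := by simpa [mem_sources] using hs
    by_cases huK : u ∈ K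
    · obtain ⟨b, α, β, hb, hle⟩ := ih _ (card_compl_union_lt (L := {v}) hv (by simp)) _ rfl
      refine ⟨_, _, _, hb.lam hu huK, fun a l h1 h2 h3 => ?_⟩
      have h4 := sum_compl_union_add_le (K := K) (L := {v}) (L' := {v}) (hc a l h1 h2) (by simp)
        (by simpa using hv)
      rw [Finset.sum_singleton, if_neg hs] at h4
      have := hle a l h1 h2 h3
      push_cast
      linarith
    · obtain ⟨b, α, β, hb, hle⟩ := ih _ (card_compl_union_lt (L := {u, v}) hv (by simp)) _ rfl
      refine ⟨_, _, _, hb.edge hu, fun a l h1 h2 h3 => ?_⟩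
      have hne : u ≠ v := fun h => hP v (h ▸ hu)
      have h4 := sum_compl_union_add_le (K := K) (L := {u, v}) (L' := {u, v}) (hc a l h1 h2)
        subset_rfl (by simpa using ⟨huK, hv⟩)
      rw [Finset.sum_pair hne, if_neg hs] at h4
      have h5 : l ≤ if u ∈ sources P then a else l := by split_ifs <;> linarith
      have := hle a l h1 h2 h3
      push_cast
      linarith

/-- When `m ≤ lam ^ 2`, a covering of most of the vertices by edges and odd cycles is optimal. -/
theorem exists_fam_dense (hP : SimpleDi P) (hiso : NoIsolated P) :
    ∃ fam α β γ, FamOK P fam α β γ ∧ ∀ m lam : ℕ, 1 ≤ lam → lam ≤ m → m ≤ lam * lam →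
      ENNReal.ofReal (2 ^ (α * Real.logb 2 m + β * Real.logb 2 lam +
        γ * (Real.logb 2 m / 2))) ≤ polymatDir m lam P := by
  classical
  obtain ⟨I, g, C, hIS, hginj, hgadj, hC, hCI⟩ := exists_source_matching P
  let nb : Fin k → Finset (Fin k) := fun u => {v | UAdj P u v}
  have hnb : ∀ u v, v ∈ nb u ↔ UAdj P u v := fun u v => by simp [nb]
  obtain ⟨X, hX⟩ := exists_max_deficiency nb
  have hX0 := hX ∅
  simp only [Finset.card_empty, Finset.biUnion_empty, zero_add] at hX0
  obtain ⟨d, hd⟩ : ∃ d, #X = #(X.biUnion nb) + d := ⟨_, (Nat.add_sub_of_le hX0).symm⟩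
  have htarget : ∀ u v, P.Adj u v → v ∉ sources P := fun u v huv h => mem_sources.mp h u huv
  obtain ⟨f, hf, hfadj⟩ := exists_injective_dAdj (d := d) nb hnb hginj hgadj
    (fun i hi h => htarget i _ (hgadj i hi) (hIS h)) fun A => by have := hX A; omega
  obtain ⟨fam, T, Z, α, γ, hT, hTc, hTZ, hTZu, hZI, hZd⟩ :=
    covers_of_invariant hP hf hfadj Finset.univ fun x _ => Finset.mem_univ _
  have hleft : (Finset.univ : Finset (Fin k ⊕ Fin d)).toLeft = Finset.univ := by ext; simp
  have hright : (Finset.univ : Finset (Fin k ⊕ Fin d)).toRight = Finset.univ := by ext; simp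
  rw [hleft] at hTZu
  rw [hright, Finset.card_univ, Fintype.card_fin] at hZd
  have hZ : Tᶜ = Z := by
    ext v
    have h1 := Finset.ext_iff.mp hTZu v
    simp only [Finset.mem_union, Finset.mem_univ, iff_true] at h1
    rw [Finset.mem_compl]
    exact ⟨fun h => h1.resolve_left h, fun h h' => Finset.disjoint_left.mp hTZ h' h⟩
  obtain ⟨b, α', β', hb, hcost⟩ := exists_completion hP hiso T
  refine ⟨_, _, _, γ, hT.famOK hb, fun m lam hl hlm hml => ?_⟩
  set a := Real.logb 2 m with ha
  set l := Real.logb 2 lam with hl'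
  have hl0 : 0 ≤ l := Real.logb_nonneg (by norm_num) (by exact_mod_cast hl)
  have hla : l ≤ a := Real.logb_le_logb_of_le (by norm_num) (by exact_mod_cast hl)
    (by exact_mod_cast hlm)
  have hal : a ≤ 2 * l := by
    have h1 : a ≤ Real.logb 2 ((lam : ℝ) * lam) :=
      Real.logb_le_logb_of_le (by norm_num) (by exact_mod_cast (hl.trans hlm))
        (by exact_mod_cast hml)
    rw [Real.logb_mul (by positivity) (by positivity)] at h1
    linarith
  let e : Fin k → ℝ := fun v => if v ∈ C then a - l else 0
  let y : Fin k → ℝ := fun v => (if v ∉ X then 1 else 0) + if v ∈ X.biUnion nb then 1 else 0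
  -- `y = 1` would be a uniform reduction by `l - a / 2`; moving weight from `X` to its neighbours
  -- keeps `y u + y v ≥ 2` on the edges, and makes the total smaller by the deficiency `d`
  let x : Fin k → ℝ := fun v =>
    (if v ∈ sources P then a - l else 0) + l - e v - (l - a / 2) * y v
  have hxS : ∀ v ∈ sources P, x v = a - e v - (l - a / 2) * y v := fun v hv => by
    simp [x, hv]
  have hxN : ∀ v ∉ sources P, x v = l - e v - (l - a / 2) * y v := fun v hv => by
    simp [x, hv]
  have he : ∀ v, 0 ≤ e v ∧ e v ≤ a - l := fun v => by
    simp only [e]; split_ifs <;> constructor <;> linarith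
  have hy : ∀ v, 0 ≤ y v ∧ y v ≤ 2 := fun v => by
    simp only [y]; split_ifs <;> norm_num
  have hly : ∀ v, 0 ≤ (l - a / 2) * y v ∧ (l - a / 2) * y v ≤ 2 * l - a := fun v => by
    have := hy v
    constructor <;> nlinarith
  have hx0 : ∀ v, 0 ≤ x v := fun v => by
    have h1 := he v
    have h2 := hly v
    by_cases hv : v ∈ sources P
    · rw [hxS v hv]; linarith
    · rw [hxN v hv]; linarith
  have hyy : ∀ u v, P.Adj u v → 2 ≤ y u + y v := fun u v huv => by
    have h1 : u ∈ X → v ∈ X.biUnion nb := fun h =>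
      Finset.mem_biUnion.mpr ⟨u, h, (hnb _ _).mpr (.inl huv)⟩
    have h2 : v ∈ X → u ∈ X.biUnion nb := fun h =>
      Finset.mem_biUnion.mpr ⟨v, h, (hnb _ _).mpr (.inr huv)⟩
    have h3 : ∀ u v, (u ∈ X → v ∈ X.biUnion nb) →
        (1 : ℝ) ≤ (if u ∉ X then 1 else 0) + if v ∈ X.biUnion nb then 1 else 0 := fun u v h => by
      by_cases hu : u ∈ X
      · rw [if_pos (h hu), if_neg (not_not.mpr hu)]; norm_num
      · rw [if_pos hu]; split_ifs <;> norm_num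
    have := h3 u v h1
    have := h3 v u h2
    simp only [y]
    linarith
  refine ofReal_two_rpow_mono (le_polymatDir x hx0 0 le_rfl ∅
    (by simp) hP (fun u v huv => ?_) fun u v huv => ?_) ?_
  · rw [zero_mul, add_zero, hxN v (htarget u v huv)]
    have h1 : 2 * l - a ≤ (l - a / 2) * y u + (l - a / 2) * y v := by
      have := hyy u v huv
      nlinarith
    have hu' := he u
    have hv' := he v
    by_cases hu : u ∈ sources P
    · rw [hxS u hu]
      have h2 : a - l ≤ e u + e v := by
        rcases hC u hu v huv with h | h
        · have : e u = a - l := by simp [e, h]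
          linarith
        · have : e v = a - l := by simp [e, h]
          linarith
      linarith
    · rw [hxN u hu]
      linarith
  · rw [zero_mul, add_zero, hxN v (htarget u v huv)]
    have := he v
    have := hly v
    linarith
  · have hsy : ∑ v, y v = k - d := by
      have h1 : ∑ v : Fin k, (if v ∉ X then (1 : ℝ) else 0) = #Xᶜ * 1 := by
        rw [← sum_ite_mem_const]
        simp
      have h2 := Finset.card_add_card_compl X
      rw [Fintype.card_fin] at h2
      have h3 : (#X : ℝ) + #Xᶜ = k := by exact_mod_cast h2
      have h4 : (#X : ℝ) = #(X.biUnion nb) + d := by exact_mod_cast hd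
      simp only [y, Finset.sum_add_distrib]
      rw [h1, sum_ite_mem_const]
      linarith
    have hsum : ∑ v, x v = #(sources P) * (a - l) + k * l - #C * (a - l) -
        (l - a / 2) * (k - d) := by
      simp only [x, e, Finset.sum_sub_distrib, Finset.sum_add_distrib, sum_ite_mem_const,
        ← Finset.mul_sum, hsy]
      simp
    have hc := hcost a l hl0 hla hal
    have hsplit : ∑ v ∈ Tᶜ, (if v ∈ sources P then a else l) =
        #(Z ∩ sources P) * (a - l) + #Z * l := by
      have h1 : ∀ v, (if v ∈ sources P then a else l) =
          (if v ∈ sources P then a - l else 0) + l := fun v => by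
        split_ifs <;> ring
      rw [hZ]
      simp only [h1, Finset.sum_add_distrib, Finset.sum_ite_mem]
      simp
      ring
    have hZs : #(Z ∩ sources P) + #I ≤ #(sources P) := by
      rw [← Finset.card_union_of_disjoint (hZI.mono_left Finset.inter_subset_left)]
      exact Finset.card_le_card (Finset.union_subset Finset.inter_subset_right hIS)
    have hZs' : (#(Z ∩ sources P) : ℝ) + #C ≤ #(sources P) := by
      exact_mod_cast (Nat.add_le_add_left hCI _).trans hZs
    have hTk : #T + #Z = k := by
      have := Finset.card_add_card_compl T
      rwa [hZ, Fintype.card_fin] at this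
    have hTk' : (#T : ℝ) + #Z = k := by exact_mod_cast hTk
    have hTc' : 2 * (α : ℝ) + γ = #T := by exact_mod_cast hTc
    have hZd' : (#Z : ℝ) ≤ d := by exact_mod_cast hZd
    rw [hsum]
    rw [hsplit] at hc
    push_cast
    have e1 : (α : ℝ) * a + γ * (a / 2) = #T * (a / 2) := by rw [← hTc']; ring
    have e2 := mul_le_mul_of_nonneg_right hZs' (sub_nonneg.mpr hla)
    have e3 := mul_le_mul_of_nonneg_right hZd' (by linarith : 0 ≤ l - a / 2)
    rw [← hTk']
    linarith

end

/-! ### Choice of the family of codes -/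

section
variable {k n w : ℕ} {P : Digraph (Fin k)} {G : Digraph (Fin n)} {D : Data} {s : State}
  {fam famA famB : List (List (Stp k))} {α β γ : ℕ}

theorem Samples.mono {p : Prog} {c c' : ℝ≥0∞} (h : Samples w p P G c s) (hc : c ≤ c') :
    Samples w p P G c' s :=
  ⟨h.1.trans (ENNReal.div_le_div_right hc _), h.2⟩

theorem one_le_wp {p : Prog} (hp : p ≠ .skip) : 1 ≤ wp w 1 p (fun _ => 0) s := by
  rw [wp_step hp]
  exact le_self_add

theorem sampWith_writesOnly (P : Digraph (Fin k)) (fam : List (List (Stp k))) :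
    (sampWith P fam).WritesOnly (sampRegs k) := by
  have hdec : (decode P fam).WritesOnly (sampRegs k) :=
    (decode_writesOnly P fam).mono (by intro r; simp [decRegs, sampRegs]; omega)
  refine ⟨block_writesOnly ?_, ?_, hdec, ⟨seqAll_writesOnly ?_, block_writesOnly ?_⟩, ?_, hdec,
    trivial, ?_⟩
  · intro i hi
    simp only [List.mem_append, List.mem_cons, List.not_mem_nil, or_false, List.mem_map] at hi
    rcases hi with ((rfl | rfl) | ⟨c, -, rfl⟩) | rfl | rfl <;>
      simp [Prog.WritesOnly, sampRegs]
  · simp [Prog.WritesOnly, sampRegs]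
  · intro u _
    have := u.isLt
    simp only [Prog.WritesOnly, sampRegs, Set.mem_ofPred_eq]
    omega
  · simp [Prog.WritesOnly, sampRegs]
  · simp [Prog.WritesOnly, sampRegs]
  · simp [Prog.WritesOnly, sampRegs]

/-- The sampling program: which one of two families of codes is used depends on whether
`lam ^ 2 ≤ m`. -/
noncomputable def sampler (P : Digraph (Fin k)) (famA famB : List (List (Stp k))) : Prog :=
  .seq (.instr (.arith .mul (rY k) (rlam k) (rlam k))) <|
    .ite (.le (rY k) (rm k)) (sampWith P famA) (sampWith P famB)

theorem sampler_writesOnly (P : Digraph (Fin k)) (famA famB : List (List (Stp k))) :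
    (sampler P famA famB).WritesOnly (sampRegs k) :=
  ⟨by simp [Prog.WritesOnly, sampRegs], sampWith_writesOnly P famA, sampWith_writesOnly P famB⟩

/-- The factor `4` allows for the comparison, as sampling takes at least one step. -/
theorem sampler_spec (hD : D.Valid w) {c : ℝ≥0∞}
    (hA : D.lam * D.lam ≤ D.m → ∀ s, Holds k D s → Samples w (sampWith P famA) P G c s)
    (hB : D.m ≤ D.lam * D.lam → ∀ s, Holds k D s → Samples w (sampWith P famB) P G c s)
    (hs : Holds k D s) : Samples w (sampler P famA famB) P G (4 * c) s := by
  have hlt : D.lam * D.lam < 2 ^ w := by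
    have h1 := hD.fits
    have h2 : D.lam * D.lam ≤ D.S := by
      have := hD.lam_le
      exact Nat.mul_le_mul (by unfold Data.N1; omega) (by unfold Data.N1; omega)
    omega
  obtain ⟨s₁, ⟨hY, hs₁⟩, h0, h1⟩ := Ex.wp_seq (w := w) (s := s) (T := 1)
    (p := .instr (.arith .mul (rY k) (rlam k) (rlam k)))
    (Q := fun s' => s'.reg (rY k) = D.lam * D.lam ∧ Holds k D s')
    (q := .ite (.le (rY k) (rm k)) (sampWith P famA) (sampWith P famB)) <| by
      refine ((Ex.arith (Q := fun s' => s'.reg (rY k) = D.lam * D.lam) ?_).frame (W := sampRegs k)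
        ?_).mono le_rfl fun s' h => ⟨h.1, hs.of_same h.2 subset_rfl⟩
      · simp [State.setReg, Op.eval, hs.lam, Nat.mod_eq_of_lt hlt]
      · simp [Prog.WritesOnly, sampRegs]
  obtain ⟨fam, hite, hS⟩ : ∃ fam, (∀ τ φ, wp w τ (.ite (.le (rY k) (rm k)) (sampWith P famA)
      (sampWith P famB)) φ s₁ = τ + wp w τ (sampWith P fam) φ s₁) ∧
      Samples w (sampWith P fam) P G c s₁ := by
    by_cases h : D.lam * D.lam ≤ D.m
    · refine ⟨famA, fun τ φ => ?_, hA h s₁ hs₁⟩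
      rw [wp_ite, if_pos (by simpa [Test.holds, hY, hs₁.m] using h)]
    · refine ⟨famB, fun τ φ => ?_, hB (by omega) s₁ hs₁⟩
      rw [wp_ite, if_neg (by simpa [Test.holds, hY, hs₁.m] using h)]
  refine ⟨?_, fun S hS' => ?_, fun he => ?_⟩
  · refine h1.trans ?_
    rw [hite, mul_div_assoc]
    have h2 : 1 ≤ wp w 1 (sampWith P fam) (fun _ => 0) s₁ := one_le_wp (by simp [sampWith])
    calc ((1 + 1 : ℕ) : ℝ≥0∞) + (1 + wp w 1 (sampWith P fam) (fun _ => 0) s₁)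
        = 3 * 1 + wp w 1 (sampWith P fam) (fun _ => 0) s₁ := by
          rw [← add_assoc]; norm_num
      _ ≤ 3 * wp w 1 (sampWith P fam) (fun _ => 0) s₁ +
          wp w 1 (sampWith P fam) (fun _ => 0) s₁ := by gcongr
      _ = 4 * wp w 1 (sampWith P fam) (fun _ => 0) s₁ := by ring
      _ ≤ _ := by gcongr; exact hS.1
  · rw [sampler, h0, hite, zero_add]
    exact hS.2.1 S hS'
  · rw [sampler, h0, hite, zero_add]
    exact hS.2.2 he

/-- The number of codes is within a constant factor of the polymatroid bound. -/
theorem numCodes_le (hF : FamOK P fam α β γ) (hD : D.Valid w) (hq : D.q * D.q ≤ 4 * D.m) :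
    (numCodes D fam : ℝ≥0∞) ≤ (fam.length * 2 ^ γ : ℕ) *
      ENNReal.ofReal (2 ^ (α * Real.logb 2 D.m + β * Real.logb 2 D.lam +
        γ * (Real.logb 2 D.m / 2))) := by
  have hm : (0 : ℝ) < D.m := by exact_mod_cast hD.m_pos
  have hl : (0 : ℝ) < D.lam := by exact_mod_cast hD.lam_pos
  have hpow : ∀ (j : ℕ) (x : ℝ), (2 : ℝ) ^ (j * x) = ((2 : ℝ) ^ x) ^ j := fun j x => by
    rw [mul_comm, Real.rpow_mul (by norm_num), Real.rpow_natCast]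
  set y : ℝ := (2 : ℝ) ^ (Real.logb 2 D.m / 2) with hy
  have hy0 : 0 < y := by positivity
  have hyy : y * y = D.m := by
    rw [hy, ← Real.rpow_add (by norm_num), add_halves,
      Real.rpow_logb (by norm_num) (by norm_num) hm]
  have hqy : (D.q : ℝ) ≤ 2 * y := by
    have h1 : (D.q : ℝ) * D.q ≤ 4 * D.m := by exact_mod_cast hq
    rw [← hyy] at h1
    nlinarith
  rw [Real.rpow_add (by norm_num), Real.rpow_add (by norm_num), hpow, hpow, hpow, ← hy,
    Real.rpow_logb (by norm_num) (by norm_num) hm, Real.rpow_logb (by norm_num) (by norm_num) hl,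
    hF.numCodes_eq, ← ENNReal.ofReal_natCast, ← ENNReal.ofReal_natCast (fam.length * 2 ^ γ),
    ← ENNReal.ofReal_mul (by positivity)]
  refine ENNReal.ofReal_le_ofReal ?_
  push_cast
  calc (fam.length : ℝ) * ((D.m : ℝ) ^ α * (D.lam : ℝ) ^ β * (D.q : ℝ) ^ γ)
      ≤ fam.length * ((D.m : ℝ) ^ α * (D.lam : ℝ) ^ β * (2 * y) ^ γ) := by gcongr
    _ = _ := by rw [mul_pow]; ring

/-- The number of codes is a word. -/
theorem numCodes_lt (hF : FamOK P fam α β γ) (hD : D.Valid w) (hn : 2 ≤ D.n) {c : ℕ}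
    (hc : fam.length + 2 * α + β + γ ≤ c) (hw : D.n ^ c ≤ 2 ^ w) : numCodes D fam < 2 ^ w := by
  rw [hF.numCodes_eq]
  have h1 : fam.length < D.n ^ fam.length := Nat.lt_pow_self (by omega)
  have h2 : D.m ^ α ≤ D.n ^ (2 * α) := by
    rw [pow_mul, pow_two]
    exact Nat.pow_le_pow_left hD.m_le α
  have h3 : D.lam ^ β ≤ D.n ^ β := Nat.pow_le_pow_left hD.lam_le β
  have h4 : D.q ^ γ ≤ D.n ^ γ := Nat.pow_le_pow_left hD.q_le γ
  have h5 : 0 < D.m ^ α * D.lam ^ β * D.q ^ γ := by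
    have := hD.m_pos
    have := hD.lam_pos
    have := hD.q_pos
    positivity
  calc fam.length * (D.m ^ α * D.lam ^ β * D.q ^ γ)
      < D.n ^ fam.length * (D.m ^ α * D.lam ^ β * D.q ^ γ) := Nat.mul_lt_mul_of_pos_right h1 h5
    _ ≤ D.n ^ fam.length * (D.n ^ (2 * α) * D.n ^ β * D.n ^ γ) := by gcongr
    _ = D.n ^ (fam.length + 2 * α + β + γ) := by rw [pow_add, pow_add, pow_add]; ring
    _ ≤ D.n ^ c := Nat.pow_le_pow_right (by omega) hc
    _ ≤ 2 ^ w := hw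

theorem sampWith_le_polymatDir (hF : FamOK P fam α β γ) (hD : D.Valid w) (hR : D.Rep G)
    (hiso : NoIsolated P) (hP : SimpleDi P) (hG : SimpleDi G) (hn : 2 ≤ D.n) {c : ℕ}
    (hc : fam.length + 2 * α + β + γ ≤ c) (hw : D.n ^ c ≤ 2 ^ w) (hq : D.q * D.q ≤ 4 * D.m)
    (hpoly : ENNReal.ofReal (2 ^ (α * Real.logb 2 D.m + β * Real.logb 2 D.lam +
        γ * (Real.logb 2 D.m / 2))) ≤ polymatDir D.m D.lam P) (hs : Holds k D s) :
    Samples w (sampWith P fam) P G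
      ((sampConst P fam * (fam.length * 2 ^ γ) : ℕ) * polymatDir D.m D.lam P) s := by
  refine (sampWith_spec ⟨hD, hR, hiso, hF, numCodes_lt hF hD hn hc hw⟩ hP hG hs).mono ?_
  rw [Nat.cast_mul, mul_assoc]
  gcongr
  exact (numCodes_le hF hD hq).trans (by gcongr)

/-! ### Guarantees -/

/-- When the preprocessing deterministically establishes a property that sampling preserves, then
all the reachable states have this property. -/
theorem reachable_of_invariant {pre samp : Prog} {s₀ : State} {T : ℕ} {W : Set ℕ}
    {Q : State → Prop} {A : State → Prop}
    (hpre : Ex w pre s₀ T A) (hA : ∀ s, A s → Q s) (hsamp : samp.WritesOnly W)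
    (hQ : ∀ s s', Q s → SameOutside W s s' → Q s') (hs : Reachable w pre samp s₀ s) : Q s := by
  induction hs with
  | @built s hs =>
    obtain ⟨s', ⟨t, -, h⟩, hA'⟩ := hpre
    rw [haltProb_eq_wp, h, mul_zero, zero_add] at hs
    have : s' = s := by simpa using (Set.mem_of_indicator_ne_zero hs.ne')
    exact this ▸ hA _ hA'
  | @next s t hs ht ih =>
    rw [haltProb_eq_wp] at ht
    by_cases h : SameOutside W s t
    · exact hQ _ _ ih h
    · exfalso
      refine ht.ne' (wp_eq_zero_of_writesOnly hsamp fun s' hs' => ?_)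
      rw [Set.indicator_of_notMem]
      rintro rfl
      exact h hs'

/-- The guarantees for the preprocessing `pre` and the sampling program `samp`, for the pattern
`P`. -/
def Guarantee (P : Digraph (Fin k)) (C c : ℕ) (pre samp : Prog) : Prop :=
  ∀ (n : ℕ) (G : Digraph (Fin n)) (E : List (Fin n × Fin n)) (lam w : ℕ),
    SimpleDi G → E.Nodup → (∀ u v : Fin n, (u, v) ∈ E ↔ G.Adj u v) → 1 ≤ E.length →
    (∀ u : Fin n, {v | G.Adj u v}.ncard ≤ lam) → n ^ c ≤ 2 ^ w →
    expectedTime w pre (inputState E) ≤ C * (E.length : ℝ≥0∞) ∧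
    ∀ s : State, Reachable w pre samp (inputState E) s →
      Samples w samp P G (C * polymatDir E.length lam P) s

theorem Guarantee.mono {C C' c c' : ℕ} {pre samp : Prog} (h : Guarantee P C c pre samp)
    (hC : C ≤ C') (hc : c ≤ c') : Guarantee P C' c' pre samp := by
  intro n G E lam w hG hE hEG hE1 hlam hw
  have hn : 1 ≤ n := by
    have e := E[0]
    have := e.1.isLt
    omega
  have hC' : (C : ℝ≥0∞) ≤ C' := by exact_mod_cast hC
  obtain ⟨h1, h2⟩ := h n G E lam w hG hE hEG hE1 hlam ((Nat.pow_le_pow_right hn hc).trans hw)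
  exact ⟨h1.trans (by gcongr), fun s hs => (h2 s hs).mono (by gcongr)⟩

theorem six_mul_sq_lt (hn : 2 ≤ n) : 6 * ((n + 1) * (n + 1)) < n ^ 7 := by
  have h1 : 2 ^ 5 ≤ n ^ 5 := Nat.pow_le_pow_left hn 5
  have h2 : n ^ 7 = n ^ 5 * (n * n) := by ring
  have h3 : 2 ^ 5 * (n * n) ≤ n ^ 5 * (n * n) := Nat.mul_le_mul_right _ h1
  rw [h2]
  refine lt_of_lt_of_le ?_ h3
  nlinarith

/-- Patterns with at least one edge. -/
theorem exists_guarantee_of_noIsolated (hP : SimpleDi P) (hiso : NoIsolated P) :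
    ∃ C c pre samp, Guarantee P C c pre samp := by
  obtain ⟨famA, α, β, γ, hA, hpA⟩ := exists_fam_sparse hP hiso
  obtain ⟨famB, α', β', γ', hB, hpB⟩ := exists_fam_dense hP hiso
  set KA := sampConst P famA * (famA.length * 2 ^ γ)
  set KB := sampConst P famB * (famB.length * 2 ^ γ')
  refine ⟨100 + 4 * (KA + KB), 7 + (famA.length + 2 * α + β + γ) +
    (famB.length + 2 * α' + β' + γ'), preProg k, sampler P famA famB, ?_⟩
  intro n G E lam w hG hE hEG hE1 hlam hw
  set c := 7 + (famA.length + 2 * α + β + γ) + (famB.length + 2 * α' + β' + γ') with hc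
  have hn : 2 ≤ n := by
    have h1 : E[0] ∈ E := List.getElem_mem (by omega)
    have h2 := (hEG _ _).mp h1
    have h3 : E[0].1 ≠ E[0].2 := fun h => hG _ (h ▸ h2)
    have h4 := Fin.val_ne_of_ne h3
    have := E[0].1.isLt
    have := E[0].2.isLt
    omega
  have hm : E.length ≤ n * n := by simpa using hE.length_le_card
  have hfit : 6 * ((n + 1) * (n + 1)) < 2 ^ w :=
    (six_mul_sq_lt hn).trans_le ((Nat.pow_le_pow_right (by omega) (by omega)).trans hw)
  have hpre := preProg_spec (k := k) hE hEG hfit hE1 hm hlam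
  refine ⟨?_, fun s hs => ?_⟩
  · obtain ⟨s', ⟨t, ht, h⟩, -⟩ := hpre
    rw [expectedTime_eq_wp, h, mul_one, add_zero]
    have : t ≤ (100 + 4 * (KA + KB)) * E.length := ht.trans (Nat.mul_le_mul_right _ (by omega))
    exact_mod_cast this
  · obtain ⟨s', hrun, D, hs', hD, hR, hDm, hDl, hlm, hq⟩ := hpre
    have hhold : Holds k D s := reachable_of_invariant (Q := Holds k D)
      (A := fun s => s = s') ⟨s', hrun, rfl⟩ (fun s h => h ▸ hs') (sampler_writesOnly P famA famB)
      (fun s s' h h' => h.of_same h' subset_rfl) hs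
    have hDn : D.n = n := hR.n_eq
    have hpm : polymatDir D.m D.lam P ≤ polymatDir E.length lam P :=
      hDm ▸ polymatDir_mono hD.lam_pos hDl
    refine (sampler_spec (c := (KA + KB : ℕ) * polymatDir D.m D.lam P) hD (fun h s hs => ?_)
      (fun h s hs => ?_) hhold).mono ?_
    · refine (sampWith_le_polymatDir hA hD hR hiso hP hG (hDn ▸ hn) (c := c) (by omega)
        (hDn ▸ hw) hq (hpA _ _ hD.lam_pos h) hs).mono ?_
      gcongr
      omega
    · refine (sampWith_le_polymatDir hB hD hR hiso hP hG (hDn ▸ hn) (c := c) (by omega)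
        (hDn ▸ hw) hq (hpB _ _ hD.lam_pos hlm h) hs).mono ?_
      gcongr
      omega
    · rw [← mul_assoc]
      refine mul_le_mul' ?_ hpm
      have : 4 * (KA + KB) ≤ 100 + 4 * (KA + KB) := by omega
      exact_mod_cast this

/-! ### The pattern with a single vertex -/

/-- Without edges there are no rules, and the bound is infinite. -/
theorem polymatDir_eq_top {P : Digraph (Fin 1)} (hP : SimpleDi P) (m lam : ℕ) :
    polymatDir m lam P = ⊤ := by
  have hadj : ∀ u v, ¬ P.Adj u v := fun u v h => hP v (Subsingleton.elim u v ▸ h)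
  refine ENNReal.eq_top_of_forall_nnreal_le fun r => ?_
  obtain ⟨j, hj⟩ := exists_nat_ge r
  refine le_trans ?_ (le_polymatDir (P := P) (fun _ => (j : ℝ)) (by simp) 0 le_rfl ∅ (by simp) hP
    (fun u v h => absurd h (hadj u v)) fun u v h => absurd h (hadj u v))
  have h2 : j < 2 ^ j := Nat.lt_two_pow_self
  have h3 : (2 : ℝ) ^ (∑ _v : Fin 1, (j : ℝ) + 0 * (#(∅ : Finset (Finset (Fin 1))) : ℝ)) =
      ((2 ^ j : ℕ) : ℝ) := by
    simp
  rw [h3, ENNReal.ofReal_natCast]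
  calc (r : ℝ≥0∞) ≤ (j : ℝ≥0) := by exact_mod_cast hj
    _ ≤ ((2 ^ j : ℕ) : ℝ≥0∞) := by exact_mod_cast h2.le

/-- Sampling a vertex. Register `3` is `0`, the address of the number of vertices. -/
def sampVertex : Prog :=
  .seq (.instr (.load 2 3)) <| .seq (.instr (.const 0 1)) (.instr (.rand 1 2))

theorem exists_guarantee_one {P : Digraph (Fin 1)} (hP : SimpleDi P) :
    ∃ C c pre samp, Guarantee P C c pre samp := by
  refine ⟨1, 1, .skip, sampVertex, ?_⟩
  intro n G E lam w hG hE hEG hE1 hlam hw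
  have hn : 1 ≤ n := by
    have e := E[0]
    have := e.1.isLt
    omega
  have hw1 : 1 < 2 ^ w := by
    have h1 : E[0] ∈ E := List.getElem_mem (by omega)
    have h2 := (hEG _ _).mp h1
    have h3 : E[0].1 ≠ E[0].2 := fun h => hG _ (h ▸ h2)
    have h4 := Fin.val_ne_of_ne h3
    have := E[0].1.isLt
    have := E[0].2.isLt
    rw [pow_one] at hw
    omega
  have hadj : ∀ u v, ¬ P.Adj u v := fun u v h => hP v (Subsingleton.elim u v ▸ h)
  have hemb : ∀ f : Fin 1 → Fin n, IsEmb P G f := fun f =>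
    ⟨fun u v h => absurd h (hadj u v), fun u v _ => Subsingleton.elim u v⟩
  refine ⟨by rw [expectedTime_eq_wp, wp_skip]; exact zero_le, fun s hs => ?_⟩
  obtain ⟨hs0, hs3⟩ : s.mem 0 = n ∧ s.reg 3 = 0 := by
    refine reachable_of_invariant (w := w) (pre := .skip) (samp := sampVertex) (s₀ := inputState E)
      (T := 0) (W := {r | r ≤ 2}) (Q := fun s => s.mem 0 = n ∧ s.reg 3 = 0)
      (A := fun s => s = inputState E) (Ex.skip rfl) ?_ ?_ ?_ hs
    · rintro _ rfl
      exact ⟨rfl, rfl⟩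
    · exact ⟨by simp [Prog.WritesOnly], by simp [Prog.WritesOnly], by simp [Prog.WritesOnly]⟩
    · rintro s s' ⟨h1, h2⟩ ⟨h3, h4⟩
      exact ⟨by rw [h3, h1], by rw [h4 3 (by simp), h2]⟩
  have hocc := occ_eq_range hP hG
  have hcard : (occ G P).ncard = n := by
    classical
    have h1 := card_isEmb hP hG
    have h2 : numAut P = 1 := by
      rw [numAut, Finset.card_eq_one]
      refine ⟨1, ?_⟩
      ext π
      simp [Subsingleton.elim π 1]
    rw [h2, mul_one, Finset.filter_true_of_mem fun f _ => hemb f] at h1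
    rw [← h1]
    simp
  have hne : (occ G P).Nonempty := by
    rw [hocc]
    exact ⟨_, ⟨⟨fun _ => ⟨0, hn⟩, hemb _⟩, rfl⟩⟩
  refine ⟨?_, fun S hS => ?_, fun h => absurd h hne.ne_empty⟩
  · rw [polymatDir_eq_top hP, Nat.cast_one, one_mul, ENNReal.top_div_of_ne_top]
    · exact le_top
    · simp [hcard]
  · rw [hocc] at hS
    obtain ⟨f, rfl⟩ := hS
    rw [hcard, sampVertex, wp_seq, wp_instr, Instr.exec, avg_pure, zero_add, zero_add, wp_seq,
      wp_instr, Instr.exec, avg_pure, zero_add, zero_add, wp_instr, Instr.exec, avg_map, zero_add]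
    have hr : ((s.setReg 2 (s.mem (s.reg 3))).setReg 0 (1 % 2 ^ w)).reg 2 = n := by
      simp [State.setReg, hs3, hs0]
    rw [hr, avg_uniformBelow hn]
    have hsum : ∀ x ∈ Finset.range n, ({t | Returns P (image f) t} : Set State).indicator
        (1 : State → ℝ≥0∞) (((s.setReg 2 (s.mem (s.reg 3))).setReg 0 (1 % 2 ^ w)).setReg 1 x) =
        if x = f.1 0 then 1 else 0 := by
      intro x hx
      have hret : Returns P (image f)
          (((s.setReg 2 (s.mem (s.reg 3))).setReg 0 (1 % 2 ^ w)).setReg 1 x) ↔ x = f.1 0 := by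
        constructor
        · rintro ⟨-, h, -⟩
          have h1 : f.1 0 ∈ (image f).verts := ⟨0, rfl⟩
          rw [h] at h1
          obtain ⟨i, hi⟩ := h1
          simpa [State.setReg, Subsingleton.elim i 0] using hi
        · rintro rfl
          refine ⟨?_, ?_, ?_⟩
          · simp [State.setReg, Nat.mod_eq_of_lt hw1]
          · ext v
            simp [image, State.setReg, Fin.val_inj]
          · ext e
            simp [image, hadj]
      by_cases h : x = f.1 0
      · rw [if_pos h, Set.indicator_of_mem (show _ ∈ {t | Returns P (image f) t} from hret.mpr h)]
        rfl
      · rw [if_neg h, Set.indicator_of_notMem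
          (show _ ∉ {t | Returns P (image f) t} from hret.not.mpr h)]
    rw [Finset.sum_congr rfl hsum, Finset.sum_ite_eq', if_pos (by simp), mul_one]

theorem noIsolated_of_weaklyConnected (h : WeaklyConnected P) (hk : 2 ≤ k) : NoIsolated P := by
  intro u
  have : Nontrivial (Fin k) := Fin.nontrivial_iff_two_le.mpr hk
  obtain ⟨v, hv⟩ := h.preconnected.exists_adj_of_nontrivial u
  exact ⟨v, hv.2⟩

theorem exists_guarantee (hP : SimpleDi P) (hW : WeaklyConnected P) :
    ∃ C c pre samp, Guarantee P C c pre samp := by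
  obtain ⟨v⟩ := hW.nonempty
  rcases Nat.lt_or_ge k 2 with h | h
  · obtain rfl : k = 1 := by have := v.isLt; omega
    exact exists_guarantee_one hP
  · exact exists_guarantee_of_noIsolated hP (noIsolated_of_weaklyConnected hW h)

end

end DirectedSampling

/-- Directed subgraph sampling. The constants `C`, `c` depend only on the number `k` of vertices of
the pattern, the programs only on the pattern. The data graph `G` has vertex set `Fin n` and its
edges are listed, in any order, in `E`; words have `w ≥ c * log₂ n` bits. The guarantees for a
sampling operation hold in every reachable state, that is, conditionally on the preprocessing and
on all the earlier operations, so that the operations are mutually independent. -/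
theorem theorem2 (k : ℕ) :
    ∃ C c : ℕ, ∀ P : Digraph (Fin k), SimpleDi P → WeaklyConnected P →
      ∃ pre samp : Prog,
        ∀ (n : ℕ) (G : Digraph (Fin n)) (E : List (Fin n × Fin n)) (lam w : ℕ),
          SimpleDi G →
          E.Nodup → (∀ u v : Fin n, (u, v) ∈ E ↔ G.Adj u v) →
          1 ≤ E.length →
          (∀ u : Fin n, {v | G.Adj u v}.ncard ≤ lam) →
          n ^ c ≤ 2 ^ w →
          expectedTime w pre (inputState E) ≤ C * (E.length : ℝ≥0∞) ∧
          ∀ s : State, Reachable w pre samp (inputState E) s →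
            expectedTime w samp s ≤
              C * (polymatDir E.length lam P / max 1 ((occ G P).ncard : ℝ≥0∞)) ∧
            (∀ S ∈ occ G P,
              haltProb w samp s {t | Returns P S t} = ((occ G P).ncard : ℝ≥0∞)⁻¹) ∧
            (occ G P = ∅ → haltProb w samp s {t | DeclaresAbsence t} = 1) := by
  have h : ∀ P : Digraph (Fin k), ∃ C c : ℕ, SimpleDi P → WeaklyConnected P →
      ∃ pre samp, Guarantee P C c pre samp := fun P => by
    by_cases hP : SimpleDi P ∧ WeaklyConnected P
    · obtain ⟨C, c, h⟩ := exists_guarantee hP.1 hP.2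
      exact ⟨C, c, fun _ _ => h⟩
    · exact ⟨0, 0, fun h1 h2 => absurd ⟨h1, h2⟩ hP⟩
  choose C c h using h
  have : Finite (Digraph (Fin k)) :=
    Finite.of_injective Digraph.Adj fun _ _ h => Digraph.ext h
  obtain ⟨C', hC⟩ := Finite.exists_le C
  obtain ⟨c', hc⟩ := Finite.exists_le c
  refine ⟨C', c', fun P hP hW => ?_⟩
  obtain ⟨pre, samp, hg⟩ := h P hP hW
  refine ⟨pre, samp, fun n G E lam w hG hE hEG hE1 hlam hw => ?_⟩
  obtain ⟨h1, h2⟩ := hg.mono (hC P) (hc P) n G E lam w hG hE hEG hE1 hlam hw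
  refine ⟨h1, fun s hs => ?_⟩
  obtain ⟨h3, h4, h5⟩ := h2 s hs
  rw [expectedTime_eq_wp, ← mul_div_assoc]
  simp only [haltProb_eq_wp]
  exact ⟨h3, h4, h5⟩
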